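/- **Setting.** Let $\Gamma\le \mathrm{SL}_2(\mathbb Z)$ be a subgroup of finite index and let $f\ne 0$ be a modular form of real weight $r>0$ for $\Gamma$ with unimodular multipliers $\mu_\gamma$: $f$ is holomorphic on the upper half-plane $\mathbb H$, $f(\gamma z)=\mu_\gamma (cz+d)^r f(z)$ for all $\gamma=\begin{pmatrix}a&b\\c&d\end{pmatrix}\in\Gamma$ (principal powers, $-\pi<\arg\le\pi$), and $|f(z)|\le C(\Im z)^{-A}$ for some constants $A,C$ and all $z$ with $\Im z$ small. For a cusp $\mathfrak a\in\mathbb Q\cup\{\infty\}$ let $m_{\mathfrak a}$ be its width, the order of its stabilizer in $\mathrm{SL}_2(\mathbb Z)$ modulo $\Gamma$ (matrices being identified up to sign). For $\gamma\in \mathrm{SL}_2(\mathbb Z)$ with $\gamma(\infty)=\mathfrak a$ and bottom row $(c,d)$, put $f|_\gamma(z)=(cz+d)^{-r}f(\gamma z)$ and write $$f|_\gamma(m_{\mathfrak a}z)=\sum_{n\ge 0}a_n^{\gamma}e^{2\pi i(n+\kappa_{\mathfrak a})z},\qquad 0\le\kappa_{\mathfrak a}<1 .$$ Assume $\kappa_{\mathfrak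 a}\in\mathbb Q$ for every cusp $\mathfrak a$. We say that $f$ is *cuspidal at* $\mathfrak a$ if $\kappa_{\mathfrak a}>0$ or $a_0^{\gamma}=0$, and that $f$ is a *cusp form* if it is cuspidal at every cusp. Put $\alpha_0=r/2$ if $f$ is a cusp form and $\alpha_0=r$ otherwise. Let $m=m_\infty$, $\kappa=\kappa_\infty$, let $a_n$ be the coefficients for $\gamma=I$, and for $\alpha>\alpha_0$ set $$f_\alpha(x)=\sum_{n+\kappa>0}\frac{a_n}{(n+\kappa)^\alpha}e^{2\pi i(n+\kappa)x/m}\qquad(x\in\mathbb R).$$ **Hölder exponents.** Let $g:\mathbb R\to\mathbb C$ be continuous. For $s\ge0$, $g\in\mathcal C^s(x_0)$ means that there is a polynomial $P$ of degree less than $s$ (or $P=0$) with $g(x)-P(x-x_0)=O(|x-x_0|^s)$ as $x\to x_0$. For an integer $k\ge0$ and $0\le s\le1$, $g\in\mathcal C^{k,s}(x_0)$ means that $g^{(k)}$ exists and is continuous on an open interval containing $x_0$, and $g^{(k)}(x)-g^{(k)}(x_0)=O(|x-x_0|^s)$ as $x\to x_0$. For $\Omega$ open, $g\in\mathcal C^{k,s}(\Omega)$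 means that $g^{(k)}$ exists and is continuous on $\Omega$ and is uniformly $s$-Hölder on every compact subset of $\Omega$. Put $$\beta(x_0)=\sup\{s: g\in\mathcal C^s(x_0)\},\quad \beta^*(x_0)=\sup\{k+s: g\in\mathcal C^{k,s}(x_0)\},\quad \beta^{**}(x_0)=\lim_{I\to\{x_0\}}\sup\{k+s: g\in\mathcal C^{k,s}(I)\},$$ the limit being along nested open intervals $I$ whose intersection is $\{x_0\}$. **Theorem.** Let $\alpha>\alpha_0$. The series defining $f_\alpha$ converges at every real number. Let $g$ be any of $f_\alpha$, $\Re f_\alpha$, $\Im f_\alpha$, let $\beta,\beta^*,\beta^{**}$ be the Hölder exponents of $g$, and let $x\in\mathbb Q$. Here $[\cdot]$ and $\{\cdot\}$ denote the integer and fractional parts. 1. $\beta(x)=2\alpha-r$ if $f$ is cuspidal at $x$, and $\beta(x)=\alpha-r$ otherwise. 2. If $f$ is a cusp form, then $\beta^*(x)=[\alpha-r/2]+\min(1,2\{\alpha-r/2\})$. If $f$ is not a cusp form, then $$\beta^*(x)=\begin{cases}[\alpha-r]+\min(1,2\{\alpha-r\}+r)& \text{if } f \text{ is cuspidal at } x \text{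 and } \alpha-r\notin\mathbb Z,\\ \alpha-r&\text{if } f \text{ is not cuspidal at } x \text{ or } \alpha-r\in\mathbb Z.\end{cases}$$ 3. $\beta^{**}(x)=\alpha-\alpha_0$. 4. If $0<\alpha-\alpha_0\le1$ and $f$ is not cuspidal at $x$, then $g$ is not differentiable at $x$. If $f$ is cuspidal at $x$, then $g$ is differentiable at $x$ if and only if $\alpha>(r+1)/2$; in that case $$f_\alpha'(x)=\frac{(2\pi)^\alpha}{(im)^\alpha\,\Gamma(\alpha)}\int_{(x)}(z-x)^{\alpha-1}f'(z)\,dz,$$ where $(x)$ is the vertical ray from $x$ to $i\infty$, the integral converges absolutely, and $(\Re f_\alpha)'(x)$, $(\Im f_\alpha)'(x)$ are the real and imaginary parts of the right-hand side. -/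

import Mathlib

open Filter Topology Asymptotics
open scoped MatrixGroups

noncomputable section

/-! ### Hölder spaces and Hölder exponents of functions on the real line -/

/-- The space `C^s(x₀)`: continuous functions which agree with a polynomial in `x - x₀`,
of degree less than `s`, up to `O(|x - x₀|^s)` as `x → x₀`. -/
def MemHolderAt (g : ℝ → ℂ) (s x₀ : ℝ) : Prop :=
  Continuous g ∧ ∃ P : Polynomial ℂ, (P = 0 ∨ (P.natDegree : ℝ) < s) ∧
    (fun x : ℝ => g x - P.eval ((x : ℂ) - x₀)) =O[𝓝 x₀] fun x : ℝ => |x - x₀| ^ s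

/-- The space `C^{k,s}(x₀)`: continuous functions whose `k`-th derivative exists and is continuous
on an open interval around `x₀`, and is `s`-Hölder at `x₀`. -/
def MemDerivHolderAt (g : ℝ → ℂ) (k : ℕ) (s x₀ : ℝ) : Prop :=
  Continuous g ∧ (∃ a b : ℝ, x₀ ∈ Set.Ioo a b ∧ ContDiffOn ℝ k g (Set.Ioo a b)) ∧
    (fun x : ℝ => iteratedDeriv k g x - iteratedDeriv k g x₀) =O[𝓝 x₀]
      fun x : ℝ => |x - x₀| ^ s

/-- The space `C^{k,s}(Ω)`, `Ω` open: continuous functions whose `k`-th derivative exists, is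
continuous on `Ω`, and is uniformly `s`-Hölder on every compact subset of `Ω`. -/
def MemDerivHolderOn (g : ℝ → ℂ) (k : ℕ) (s : ℝ) (Ω : Set ℝ) : Prop :=
  Continuous g ∧ ContDiffOn ℝ k g Ω ∧
    ∀ K : Set ℝ, K ⊆ Ω → IsCompact K → ∃ C : ℝ, ∀ x ∈ K, ∀ y ∈ K,
      ‖iteratedDeriv k g x - iteratedDeriv k g y‖ ≤ C * |x - y| ^ s

/-- The pointwise Hölder exponent `β(x₀) = sup {s : g ∈ C^s(x₀)}`. -/
def pointwiseHolderExponent (g : ℝ → ℂ) (x₀ : ℝ) : EReal :=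
  sSup {e : EReal | ∃ s : ℝ, 0 ≤ s ∧ MemHolderAt g s x₀ ∧ e = (s : EReal)}

/-- The restricted local Hölder exponent `β*(x₀) = sup {k + s : g ∈ C^{k,s}(x₀)}`. -/
def restrictedHolderExponent (g : ℝ → ℂ) (x₀ : ℝ) : EReal :=
  sSup {e : EReal | ∃ (k : ℕ) (s : ℝ), 0 ≤ s ∧ s ≤ 1 ∧ MemDerivHolderAt g k s x₀ ∧
    e = ((k + s : ℝ) : EReal)}

/-- `sup {k + s : g ∈ C^{k,s}(Ω)}`. -/
def holderExponentOn (g : ℝ → ℂ) (Ω : Set ℝ) : EReal :=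
  sSup {e : EReal | ∃ (k : ℕ) (s : ℝ), 0 ≤ s ∧ s ≤ 1 ∧ MemDerivHolderOn g k s Ω ∧
    e = ((k + s : ℝ) : EReal)}

/-- `β**(x₀) = e`: along every sequence of nested open intervals whose intersection is `{x₀}`,
the exponents `sup {k + s : g ∈ C^{k,s}(I)}` tend to `e`. -/
def HasLocalHolderExponent (g : ℝ → ℂ) (x₀ : ℝ) (e : EReal) : Prop :=
  ∀ a b : ℕ → ℝ, Monotone a → Antitone b → (⋂ n, Set.Ioo (a n) (b n)) = {x₀} →
    Tendsto (fun n => holderExponentOn g (Set.Ioo (a n) (b n))) atTop (𝓝 e)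

/-! ### Modular forms of real weight with a multiplier system -/

/-- The factor `c z + d`. -/
def cocycleFactor (γ : SL(2, ℤ)) (z : UpperHalfPlane) : ℂ :=
  ((γ 1 0 : ℤ) : ℂ) * (z : ℂ) + ((γ 1 1 : ℤ) : ℂ)

/-- `f` is a modular form of weight `r` for `Γ` with multipliers `μ`. Powers are principal
(`-π < arg ≤ π`). The growth condition near the real line forces holomorphy at the cusps. -/
structure IsModularFormOfWeight (f : UpperHalfPlane → ℂ) (r : ℝ) (Γ : Subgroup SL(2, ℤ))
    (μ : Γ → ℂ) : Prop where
  holo : DifferentiableOn ℂ (f ∘ UpperHalfPlane.ofComplex) {z : ℂ | 0 < z.im}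
  norm_multiplier : ∀ γ : Γ, ‖μ γ‖ = 1
  transform : ∀ (γ : Γ) (z : UpperHalfPlane),
    f ((γ : SL(2, ℤ)) • z) = μ γ * cocycleFactor γ z ^ (r : ℂ) * f z
  growth : ∃ A C δ : ℝ, 0 < δ ∧ ∀ z : UpperHalfPlane, z.im < δ → ‖f z‖ ≤ C * z.im ^ (-A)

/-- The slash operator `f|_γ (z) = f(γ z) / (c z + d)^r`. -/
def slashReal (f : UpperHalfPlane → ℂ) (r : ℝ) (γ : SL(2, ℤ)) (z : UpperHalfPlane) : ℂ :=
  f (γ • z) / cocycleFactor γ z ^ (r : ℂ)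

/-- The cusp `γ(∞) ∈ ℚ ∪ {∞}`. -/
def cuspOf (γ : SL(2, ℤ)) : OnePoint ℚ :=
  Matrix.SpecialLinearGroup.mapGL ℚ γ • (OnePoint.infty : OnePoint ℚ)

/-- The width of the cusp `𝔞`: the order of the stabilizer of `𝔞` in `SL(2, ℤ)` modulo `Γ`.
Matrices are identified up to sign, as Möbius transformations. -/
def cuspWidth (Γ : Subgroup SL(2, ℤ)) (𝔞 : OnePoint ℚ) : ℕ :=
  (Γ ⊔ Subgroup.zpowers (-1 : SL(2, ℤ))).relIndex
    ((MulAction.stabilizer (GL (Fin 2) ℚ) 𝔞).comap (Matrix.SpecialLinearGroup.mapGL ℚ))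

/-- The cusp parameter `κ ∈ [0, 1)` at the cusp `γ(∞)` of width `m`: the number (unique when
`f ≠ 0`) such that `f|_γ (z + m) = e^{2πiκ} f|_γ (z)`. -/
def cuspParameter (f : UpperHalfPlane → ℂ) (r : ℝ) (Γ : Subgroup SL(2, ℤ)) (γ : SL(2, ℤ)) : ℝ :=
  sInf {κ : ℝ | 0 ≤ κ ∧ κ < 1 ∧ ∀ z : UpperHalfPlane,
    slashReal f r γ ((cuspWidth Γ (cuspOf γ) : ℝ) +ᵥ z) =
      Complex.exp (2 * Real.pi * Complex.I * κ) * slashReal f r γ z}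

/-- The Fourier coefficients `aₙ` in `f|_γ (m z) = ∑_{n ≥ 0} aₙ e^{2πi(n+κ)z}`, where `m` is the
width and `κ` the parameter of the cusp `γ(∞)`; they are computed on the line `Im z = 1`. -/
def cuspCoeff (f : UpperHalfPlane → ℂ) (r : ℝ) (Γ : Subgroup SL(2, ℤ)) (γ : SL(2, ℤ)) (n : ℕ) :
    ℂ :=
  ∫ x in (0 : ℝ)..1,
    slashReal f r γ (UpperHalfPlane.ofComplex
        ((cuspWidth Γ (cuspOf γ) : ℂ) * ((x : ℂ) + Complex.I))) *
      Complex.exp (-(2 * Real.pi * Complex.I * (n + cuspParameter f r Γ γ) *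
        ((x : ℂ) + Complex.I)))

/-- `f` is cuspidal at `𝔞`: `κ > 0` or `a₀ = 0` at `𝔞 = γ(∞)` (this does not depend on `γ`). -/
def IsCuspidalAt (f : UpperHalfPlane → ℂ) (r : ℝ) (Γ : Subgroup SL(2, ℤ)) (𝔞 : OnePoint ℚ) :
    Prop :=
  ∀ γ : SL(2, ℤ), cuspOf γ = 𝔞 → 0 < cuspParameter f r Γ γ ∨ cuspCoeff f r Γ γ 0 = 0

/-- `f` is a cusp form: it is cuspidal at every cusp. -/
def IsCuspFormOn (f : UpperHalfPlane → ℂ) (r : ℝ) (Γ : Subgroup SL(2, ℤ)) : Prop :=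
  ∀ 𝔞 : OnePoint ℚ, IsCuspidalAt f r Γ 𝔞

open Classical in
/-- `α₀ = r/2` for cusp forms and `α₀ = r` otherwise. -/
def alphaZero (f : UpperHalfPlane → ℂ) (r : ℝ) (Γ : Subgroup SL(2, ℤ)) : ℝ :=
  if IsCuspFormOn f r Γ then r / 2 else r

/-! ### Fractional integrals -/

/-- Partial sums over `n < N`, `n + κ > 0`, of the series
`∑ aₙ (n+κ)^{-α} e^{2πi(n+κ)x/m}` with `aₙ`, `κ`, `m` taken at the cusp `∞`. -/
def fracIntegralPartialSum (f : UpperHalfPlane → ℂ) (r : ℝ) (Γ : Subgroup SL(2, ℤ)) (α : ℝ)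
    (N : ℕ) (x : ℝ) : ℂ :=
  ∑ n ∈ Finset.range N,
    if 0 < (n : ℝ) + cuspParameter f r Γ 1 then
      cuspCoeff f r Γ 1 n / ((((n : ℝ) + cuspParameter f r Γ 1) ^ α : ℝ) : ℂ) *
        Complex.exp (2 * Real.pi * Complex.I * (n + cuspParameter f r Γ 1) *
          ((x : ℂ) / (cuspWidth Γ OnePoint.infty : ℂ)))
    else 0

/-- The `α`-fractional integral `f_α`, the sum (limit of partial sums, as the convergence may be
only conditional) of the series above. -/
def fracIntegral (f : UpperHalfPlane → ℂ) (r : ℝ) (Γ : Subgroup SL(2, ℤ)) (α : ℝ) (x : ℝ) : ℂ :=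
  limUnder atTop fun N : ℕ => fracIntegralPartialSum f r Γ α N x

/-- The integrand of `∫_{(x)} (z - x)^{α-1} f'(z) dz`, with `z = x + i t` and `dz = i dt`. -/
def rayIntegrand (f : UpperHalfPlane → ℂ) (α x t : ℝ) : ℂ :=
  (Complex.I * t) ^ ((α - 1 : ℝ) : ℂ) *
    deriv (f ∘ UpperHalfPlane.ofComplex) ((x : ℂ) + Complex.I * t) * Complex.I

/-- `(2π)^α / ((i m)^α Γ(α)) ∫_{(x)} (z - x)^{α-1} f'(z) dz`, where `m` is the width of `∞`. -/
def rayDerivative (f : UpperHalfPlane → ℂ) (Γ : Subgroup SL(2, ℤ)) (α x : ℝ) : ℂ :=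
  (((2 * Real.pi) ^ α : ℝ) : ℂ) /
      ((Complex.I * (cuspWidth Γ OnePoint.infty : ℂ)) ^ (α : ℂ) * ((Real.Gamma α : ℝ) : ℂ)) *
    ∫ t in Set.Ioi (0 : ℝ), rayIntegrand f α x t

end

set_option autoImplicit false

open MeasureTheory
open scoped FourierTransform

/-! Let F be f minus its constant term at ∞. By the Gamma integral, f_α is a positive constant times
the ray integral G(x) = ∫₀^∞ t^{α-1} F(x+it) dt, which makes sense for α > α₀ because F = O((Im
z)^{-N}) for every N ≥ α₀. Everything then reduces to comparing the regularity of G at a real point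
with the growth of F near that point.

Smallness of F gives smoothness of G. If |F(z)+a| ≤ C|z-x|^A (Im z)^{-B} with B < α, the Taylor
remainder of F along horizontal lines is integrated over t ≤ |h| and t > |h| separately, and G
acquires a Taylor expansion at x with error |h|^{α+A-B} (`exists_rayIntegral_taylor_bound`). The
choice A = 0 yields the global exponent α-α₀. At a cuspidal rational point the decay at i∞ is
carried over by a matrix, giving A = 2M-r and B = M for all M ≥ α₀. Letting M tend to α gives the
pointwise exponent 2α-r.

Largeness of F gives roughness of G. The kernel (i(t-z))^{-(α+1)} reproduces F: integrating G
against it gives (2π/α)F(z), while the conjugate of G is annihilated because its frequencies are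
negative. Hence G, Re G and Im G can be treated together. If g^(k) is close to a polynomial near x,
then integration by parts, a contour shift and direct estimates bound F near x
(`exists_pointwise_growth_bound`, `exists_uniform_growth_bound`). These bounds clash with two facts.
Where f is not cuspidal, |F| ≥ c y^{-r} on the vertical ray, which caps the exponent at α-r. At
every rational x, the values of f|_γ along w₀ + Nm have constant modulus, so |F| ≥ c|z-x|^{-r} along
a sequence with Im z proportional to |z-x|². This caps the pointwise exponent at 2α-r and, for
uniform Hölder conditions, the local one at α-r/2. If f is not a cusp form, points of the first kind
lie in every neighbourhood of every rational and govern the local exponents.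

The size of f comes from the invariance of |f(z)|(Im z)^{r/2} under Γ, the finiteness of the index
and the q-expansions at the cusps. Convergence of the series, possibly only conditional, follows
from a Dini argument for the Hölder continuous function G. -/

/-- The integral `∫₀^∞ t^{α-1} G(x + i t) dt` along the vertical ray from `x`. -/
noncomputable def rayIntegral (α : ℝ) (G : ℂ → ℂ) (x : ℝ) : ℂ :=
  ∫ t in Set.Ioi (0 : ℝ), ((t ^ (α - 1) : ℝ) : ℂ) * G ((x : ℂ) + Complex.I * t)

/-- `G(z) = O((Im z)^{-N})` on the upper half-plane for every `N ≥ ρ`. -/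
def VerticalDecay (G : ℂ → ℂ) (ρ : ℝ) : Prop :=
  ∀ N : ℝ, ρ ≤ N → ∃ C : ℝ, ∀ z : ℂ, 0 < z.im → ‖G z‖ ≤ C * z.im ^ (-N)

/-! ### Cauchy estimates with weights in the upper half-plane -/

theorem isOpen_upperHalfSet : IsOpen {z : ℂ | 0 < z.im} :=
  isOpen_lt continuous_const Complex.continuous_im

theorem ray_im (x t : ℝ) : ((x : ℂ) + Complex.I * t).im = t := by simp

/-- The constant 2^|A| serves both signs of A. This lets the weights |z-x₀|^A and (Im z)^{-B} be
frozen wherever their bases vary by a factor at most 2. -/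
theorem rpow_le_two_rpow_abs_mul {u v : ℝ} (hv : 0 < v) (h1 : v / 2 ≤ u) (h2 : u ≤ 2 * v) (A : ℝ) :
    u ^ A ≤ 2 ^ |A| * v ^ A := by
  have hu : 0 < u := by linarith
  rcases le_total 0 A with hA | hA
  · rw [abs_of_nonneg hA, ← Real.mul_rpow (by norm_num) hv.le]
    exact Real.rpow_le_rpow hu.le h2 hA
  · rw [abs_of_nonpos hA]
    have h3 : u ^ A ≤ (v / 2) ^ A := Real.rpow_le_rpow_of_nonpos (by positivity) h1 hA
    refine h3.trans (le_of_eq ?_)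
    rw [Real.div_rpow hv.le (by norm_num), Real.rpow_neg (by norm_num)]
    field_simp

/-- Cauchy's estimate on the ball of radius Im z / 2. Since x₀ is real, Im z ≤ |z-x₀|, so both
weights vary by a bounded factor on this ball, and differentiation costs exactly one power of Im z.
-/
theorem norm_deriv_le_of_weighted_bound {G : ℂ → ℂ} (hG : DifferentiableOn ℂ G {z : ℂ | 0 < z.im})
    {A B C x₀ : ℝ}
    (hb : ∀ z : ℂ, 0 < z.im → ‖G z‖ ≤ C * ‖z - x₀‖ ^ A * z.im ^ (-B)) {z : ℂ} (hz : 0 < z.im) :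
    ‖deriv G z‖ ≤ (C * 2 ^ |A| * 2 ^ |B| * 2) * ‖z - x₀‖ ^ A * z.im ^ (-(B + 1)) := by
  have hC : 0 ≤ C := by
    by_contra hC
    have h1 := (norm_nonneg _).trans (hb z hz)
    have h0 : 0 < ‖z - x₀‖ := by
      rw [norm_pos_iff, sub_ne_zero]
      rintro rfl
      simp at hz
    have h2 : 0 < ‖z - x₀‖ ^ A * z.im ^ (-B) :=
      mul_pos (Real.rpow_pos_of_pos h0 _) (Real.rpow_pos_of_pos hz _)
    nlinarith
  have him : z.im ≤ ‖z - x₀‖ := by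
    have := Complex.abs_im_le_norm (z - x₀)
    simp only [Complex.sub_im, Complex.ofReal_im, sub_zero] at this
    exact (le_abs_self _).trans this
  have hr : 0 < z.im / 2 := by positivity
  have hw : ∀ w ∈ Metric.closedBall z (z.im / 2), z.im / 2 ≤ w.im ∧ w.im ≤ 2 * z.im := by
    intro w hw
    rw [Metric.mem_closedBall, dist_eq_norm] at hw
    have := (Complex.abs_im_le_norm (w - z)).trans hw
    rw [Complex.sub_im, abs_le] at this
    constructor <;> linarith [this.1, this.2]
  have hsub : Metric.closedBall z (z.im / 2) ⊆ {z : ℂ | 0 < z.im} := fun w h => by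
    have := (hw w h).1
    simp only [Set.mem_ofPred_eq]
    linarith
  have hd : DiffContOnCl ℂ G (Metric.ball z (z.im / 2)) :=
    DifferentiableOn.diffContOnCl ((hG.mono hsub).mono Metric.closure_ball_subset_closedBall)
  have key := Complex.norm_deriv_le_of_forall_mem_sphere_norm_le hr hd
    (C := C * (2 ^ |A| * ‖z - x₀‖ ^ A) * (2 ^ |B| * z.im ^ (-B))) (by
      intro w hws
      have hwb := Metric.sphere_subset_closedBall hws
      have h1 := hw w hwb
      have hn : ‖w - z‖ ≤ z.im / 2 := by
        rwa [Metric.mem_closedBall, dist_eq_norm] at hwb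
      have h2 : ‖w - x₀‖ ≤ 2 * ‖z - x₀‖ := by
        calc ‖w - x₀‖ = ‖(w - z) + (z - x₀)‖ := by ring_nf
          _ ≤ ‖w - z‖ + ‖z - x₀‖ := norm_add_le _ _
          _ ≤ 2 * ‖z - x₀‖ := by linarith
      have h3 : ‖z - x₀‖ / 2 ≤ ‖w - x₀‖ := by
        have : ‖z - x₀‖ ≤ ‖z - w‖ + ‖w - x₀‖ := by
          calc ‖z - x₀‖ = ‖(z - w) + (w - x₀)‖ := by ring_nf
            _ ≤ _ := norm_add_le _ _
        rw [norm_sub_rev z w] at this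
        linarith
      have h4 := rpow_le_two_rpow_abs_mul (hz.trans_le him) h3 h2 A
      have h5 := rpow_le_two_rpow_abs_mul hz h1.1 h1.2 (-B)
      rw [abs_neg] at h5
      refine (hb w (hsub hwb)).trans ?_
      have : 0 ≤ w.im := (hsub hwb : 0 < w.im).le
      gcongr)
  refine key.trans (le_of_eq ?_)
  rw [show -(B + 1) = -B - 1 by ring, Real.rpow_sub hz, Real.rpow_one]
  field_simp

theorem differentiableOn_iteratedDeriv_upperHalf {G : ℂ → ℂ}
    (hG : DifferentiableOn ℂ G {z : ℂ | 0 < z.im}) (k : ℕ) :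
    DifferentiableOn ℂ (iteratedDeriv k G) {z : ℂ | 0 < z.im} := by
  induction k with
  | zero => simpa using hG
  | succ k ih =>
    rw [iteratedDeriv_succ]
    exact ih.deriv isOpen_upperHalfSet

/-- The constant K is chosen before the base point, so estimates known uniformly over a set S of
base points stay uniform. -/
theorem norm_iteratedDeriv_le_of_weighted_bound {G : ℂ → ℂ}
    (hG : DifferentiableOn ℂ G {z : ℂ | 0 < z.im}) {A B C : ℝ} {S : Set ℝ}
    (hb : ∀ x₀ ∈ S, ∀ z : ℂ, 0 < z.im → ‖G z‖ ≤ C * ‖z - x₀‖ ^ A * z.im ^ (-B)) (k : ℕ) :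
    ∃ K : ℝ, ∀ x₀ ∈ S, ∀ z : ℂ, 0 < z.im →
      ‖iteratedDeriv k G z‖ ≤ K * ‖z - x₀‖ ^ A * z.im ^ (-(B + k)) := by
  induction k with
  | zero => exact ⟨C, by simpa using hb⟩
  | succ k ih =>
    obtain ⟨K, hK⟩ := ih
    refine ⟨K * 2 ^ |A| * 2 ^ |B + k| * 2, fun x₀ hx z hz => ?_⟩
    rw [iteratedDeriv_succ]
    have := norm_deriv_le_of_weighted_bound (differentiableOn_iteratedDeriv_upperHalf hG k)
      (hK x₀ hx) hz
    rwa [show -(B + k + 1 : ℝ) = -(B + (k + 1 : ℕ)) by push_cast; ring] at this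

theorem VerticalDecay.iteratedDeriv {G : ℂ → ℂ} {ρ : ℝ} (h : VerticalDecay G ρ)
    (hG : DifferentiableOn ℂ G {z : ℂ | 0 < z.im}) (k : ℕ) :
    VerticalDecay (iteratedDeriv k G) (ρ + k) := by
  intro N hN
  obtain ⟨C, hC⟩ := h (N - k) (by linarith)
  -- With A = 0 the base point plays no role, so any single real point will do.
  obtain ⟨K, hK⟩ := norm_iteratedDeriv_le_of_weighted_bound hG (A := 0) (B := N - k) (C := C)
    (S := {0}) (by simpa using hC) k
  refine ⟨K, fun z hz => ?_⟩
  have := hK 0 rfl z hz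
  simpa using this

/-! ### Ray integrals: domination and differentiation -/

theorem VerticalDecay.exists_bound {G : ℂ → ℂ} {ρ α : ℝ} (h : VerticalDecay G ρ) (h0 : 0 ≤ ρ)
    (hρ : ρ < α) :
    ∃ b : ℝ → ℝ, IntegrableOn b (Set.Ioi 0) ∧ ∀ t : ℝ, 0 < t → ∀ z : ℂ, t ≤ z.im →
      ‖((t ^ (α - 1) : ℝ) : ℂ) * G z‖ ≤ b t := by
  obtain ⟨C₁, h₁⟩ := h ρ le_rfl
  obtain ⟨C₂, h₂⟩ := h (α + 1) (by linarith)
  have aux : ∀ {C N : ℝ}, 0 ≤ N → (∀ z : ℂ, 0 < z.im → ‖G z‖ ≤ C * z.im ^ (-N)) → ∀ t : ℝ, 0 < t →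
      ∀ z : ℂ, t ≤ z.im → ‖((t ^ (α - 1) : ℝ) : ℂ) * G z‖ ≤ |C| * t ^ (α - 1 - N) := by
    intro C N hN hC t ht z hz
    have hz0 : 0 < z.im := ht.trans_le hz
    rw [norm_mul, Complex.norm_real, Real.norm_of_nonneg (by positivity), sub_eq_add_neg (α - 1),
      Real.rpow_add ht]
    have h3 : z.im ^ (-N) ≤ t ^ (-N) := Real.rpow_le_rpow_of_nonpos ht hz (by linarith)
    have h4 : C * z.im ^ (-N) ≤ |C| * t ^ (-N) := by
      have := le_abs_self C
      have h5 : 0 ≤ z.im ^ (-N) := by positivity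
      calc C * z.im ^ (-N) ≤ |C| * z.im ^ (-N) := by gcongr
        _ ≤ _ := by gcongr
    calc t ^ (α - 1) * ‖G z‖ ≤ t ^ (α - 1) * (|C| * t ^ (-N)) := by
          gcongr
          exact (hC z hz0).trans h4
      _ = _ := by ring
  -- The exponent ρ < α makes the majorant integrable at 0, the exponent α+1 at infinity. Since
  -- y^{-N} decreases in y, the majorant covers all points of height at least t, hence also rays
  -- shifted upwards.
  refine ⟨fun t => if t ≤ 1 then |C₁| * t ^ (α - 1 - ρ) else |C₂| * t ^ (α - 1 - (α + 1)), ?_, ?_⟩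
  · rw [← Set.Ioc_union_Ioi_eq_Ioi (zero_le_one' ℝ)]
    refine IntegrableOn.union ?_ ?_
    · have : IntegrableOn (fun t : ℝ => |C₁| * t ^ (α - 1 - ρ)) (Set.Ioc 0 1) := by
        refine Integrable.const_mul ?_ _
        exact (intervalIntegrable_iff_integrableOn_Ioc_of_le zero_le_one).1
          (intervalIntegral.intervalIntegrable_rpow' (by linarith))
      exact this.congr_fun (fun t ht => by simp [ht.2]) measurableSet_Ioc
    · have : IntegrableOn (fun t : ℝ => |C₂| * t ^ (α - 1 - (α + 1))) (Set.Ioi 1) := by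
        refine Integrable.const_mul ?_ _
        exact integrableOn_Ioi_rpow_of_lt (by linarith) one_pos
      exact this.congr_fun (fun t ht => by simp [not_le.2 (Set.mem_Ioi.1 ht)]) measurableSet_Ioi
  · intro t ht z hz
    dsimp only
    split_ifs
    · exact aux h0 h₁ t ht z hz
    · exact aux (by linarith) h₂ t ht z hz

theorem continuousOn_ray {G : ℂ → ℂ} (hG : ContinuousOn G {z : ℂ | 0 < z.im}) (α x y : ℝ)
    (hy : 0 ≤ y) :
    ContinuousOn (fun t : ℝ => ((t ^ (α - 1) : ℝ) : ℂ) * G ((x : ℂ) + Complex.I * y + Complex.I * t))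
      (Set.Ioi 0) := by
  refine ContinuousOn.mul ?_ ?_
  · refine Complex.continuous_ofReal.comp_continuousOn ?_
    exact fun t ht => (Real.continuousAt_rpow_const _ _ (Or.inl (ne_of_gt ht))).continuousWithinAt
  · refine hG.comp (by fun_prop) ?_
    intro t ht
    have : 0 < t := ht
    simp
    linarith

theorem integrableOn_ray {G : ℂ → ℂ} {ρ α : ℝ} (hG : ContinuousOn G {z : ℂ | 0 < z.im})
    (h : VerticalDecay G ρ) (h0 : 0 ≤ ρ) (hρ : ρ < α) (x : ℝ) :
    IntegrableOn (fun t : ℝ => ((t ^ (α - 1) : ℝ) : ℂ) * G ((x : ℂ) + Complex.I * t))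
      (Set.Ioi 0) := by
  obtain ⟨b, hb, hbd⟩ := h.exists_bound h0 hρ
  have hc := continuousOn_ray hG α x 0 le_rfl
  simp only [Complex.ofReal_zero, mul_zero, add_zero] at hc
  refine Integrable.mono' hb (hc.aestronglyMeasurable measurableSet_Ioi) ?_
  refine (ae_restrict_iff' measurableSet_Ioi).2 (Eventually.of_forall fun t ht => ?_)
  exact hbd t ht _ (by simp)

theorem exists_norm_rayIntegral_le {G : ℂ → ℂ} {ρ α : ℝ}
    (h : VerticalDecay G ρ) (h0 : 0 ≤ ρ) (hρ : ρ < α) :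
    ∃ C : ℝ, ∀ x : ℝ, ‖rayIntegral α G x‖ ≤ C := by
  obtain ⟨b, hb, hbd⟩ := h.exists_bound h0 hρ
  refine ⟨∫ t in Set.Ioi 0, b t, fun x => norm_integral_le_of_norm_le hb ?_⟩
  refine (ae_restrict_iff' measurableSet_Ioi).2 (Eventually.of_forall fun t ht => ?_)
  exact hbd t ht _ (by simp)

theorem hasDerivAt_ray {G : ℂ → ℂ} (hG : DifferentiableOn ℂ G {z : ℂ | 0 < z.im}) {t : ℝ}
    (ht : 0 < t) (x : ℝ) :
    HasDerivAt (fun ξ : ℝ => G ((ξ : ℂ) + Complex.I * t)) (deriv G ((x : ℂ) + Complex.I * t)) x := by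
  have h1 : HasDerivAt G (deriv G ((x : ℂ) + Complex.I * t)) ((x : ℂ) + Complex.I * t) :=
    (hG.differentiableAt (isOpen_upperHalfSet.mem_nhds (by simpa using ht))).hasDerivAt
  have h2 : HasDerivAt (fun w : ℂ => w + Complex.I * t) 1 (x : ℂ) := (hasDerivAt_id _).add_const _
  have h3 := HasDerivAt.comp (x : ℂ) h1 h2
  simpa using h3.comp_ofReal

/-- Passing from G to its derivative raises the decay exponent from ρ to ρ+1. Domination of the
differentiated integrand therefore needs ρ+1 < α. -/
theorem hasDerivAt_rayIntegral {G : ℂ → ℂ} {ρ α : ℝ}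
    (hG : DifferentiableOn ℂ G {z : ℂ | 0 < z.im}) (h : VerticalDecay G ρ) (h0 : 0 ≤ ρ)
    (hρ : ρ + 1 < α) (x : ℝ) :
    HasDerivAt (rayIntegral α G) (rayIntegral α (deriv G) x) x := by
  have hd := h.iteratedDeriv hG 1
  simp only [iteratedDeriv_one, Nat.cast_one] at hd
  obtain ⟨b, hb, hbd⟩ := hd.exists_bound (α := α) (by linarith) hρ
  have hG' : DifferentiableOn ℂ (deriv G) {z : ℂ | 0 < z.im} := hG.deriv isOpen_upperHalfSet
  refine (hasDerivAt_integral_of_dominated_loc_of_deriv_le (bound := b) (s := Set.univ)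
    (F := fun (x : ℝ) (t : ℝ) => ((t ^ (α - 1) : ℝ) : ℂ) * G ((x : ℂ) + Complex.I * t))
    (F' := fun (x : ℝ) (t : ℝ) => ((t ^ (α - 1) : ℝ) : ℂ) * deriv G ((x : ℂ) + Complex.I * t))
    Filter.univ_mem ?_ ?_ ?_ ?_ hb ?_).2
  · exact Eventually.of_forall fun x =>
      (integrableOn_ray hG.continuousOn h h0 (by linarith) x).aestronglyMeasurable
  · exact integrableOn_ray hG.continuousOn h h0 (by linarith) x
  · exact (integrableOn_ray hG'.continuousOn hd (by linarith) hρ x).aestronglyMeasurable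
  · refine (ae_restrict_iff' measurableSet_Ioi).2 (Eventually.of_forall fun t ht y _ => ?_)
    exact hbd t ht _ (by simp)
  · refine (ae_restrict_iff' measurableSet_Ioi).2 (Eventually.of_forall fun t ht y _ => ?_)
    exact (hasDerivAt_ray hG ht y).const_mul _

/-! ### Taylor expansion of ray integrals -/

/-- Taylor's formula for a sequence of functions each of which is the derivative of the preceding. -/
theorem norm_sub_taylor_le {D : ℕ → ℝ → ℂ} (hD : ∀ j ξ, HasDerivAt (D j) (D (j + 1) ξ) ξ) (n : ℕ)
    {M H : ℝ} (hM : ∀ ξ, |ξ| ≤ H → ‖D (n + 1) ξ‖ ≤ M) {h : ℝ} (hh : |h| ≤ H) :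
    ‖D 0 h - ∑ j ∈ Finset.range (n + 1), (((h ^ j / j.factorial : ℝ)) : ℂ) * D j 0‖
      ≤ M * |h| ^ (n + 1) := by
  have mv : ∀ (E E' : ℝ → ℂ) (B : ℝ) (h : ℝ), (∀ ξ, HasDerivAt E (E' ξ) ξ) →
      (∀ ξ, |ξ| ≤ |h| → ‖E' ξ‖ ≤ B) → ‖E h - E 0‖ ≤ B * |h| := by
    intro E E' B h hE hB
    have := Convex.norm_image_sub_le_of_norm_hasDerivWithin_le (s := Set.uIcc 0 h) (f := E) (f' := E')
      (C := B) (fun ξ _ => (hE ξ).hasDerivWithinAt) (fun ξ hξ => hB ξ ?_) (convex_uIcc 0 h)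
      Set.left_mem_uIcc Set.right_mem_uIcc
    · simpa using this
    · have := Set.abs_sub_left_of_mem_uIcc hξ
      simpa using this
  induction n generalizing D h with
  | zero =>
    simpa using mv (D 0) (D 1) M h (hD 0) (fun ξ hξ => hM ξ (hξ.trans hh))
  | succ n ih =>
    have hder : ∀ ξ : ℝ, HasDerivAt (fun h : ℝ => D 0 h -
        ∑ j ∈ Finset.range (n + 2), (((h ^ j / j.factorial : ℝ)) : ℂ) * D j 0)
        (D 1 ξ - ∑ j ∈ Finset.range (n + 1), (((ξ ^ j / j.factorial : ℝ)) : ℂ) * D (j + 1) 0) ξ := by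
      intro ξ
      refine (hD 0 ξ).sub ?_
      have : HasDerivAt (fun h : ℝ => ∑ j ∈ Finset.range (n + 2),
          (((h ^ j / j.factorial : ℝ)) : ℂ) * D j 0)
          (∑ j ∈ Finset.range (n + 2), (((j * ξ ^ (j - 1) / j.factorial : ℝ)) : ℂ) * D j 0) ξ := by
        refine HasDerivAt.fun_sum fun j _ => ?_
        refine HasDerivAt.mul_const ?_ _
        exact ((hasDerivAt_pow j ξ).div_const _).ofReal_comp
      refine this.congr_deriv ?_
      rw [Finset.sum_range_succ' _ (n + 1)]
      simp only [Nat.cast_zero, zero_mul, zero_div, Complex.ofReal_zero, add_zero]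
      refine Finset.sum_congr rfl fun j _ => ?_
      congr 2
      rw [Nat.factorial_succ, Nat.add_sub_cancel]
      push_cast
      field_simp
    have hM0 : 0 ≤ M := (norm_nonneg _).trans (hM h hh)
    -- The derivative of the remainder is the remainder of lower order for the shifted sequence, and
    -- the mean value inequality adds the factor |h|. The gain of 1/(n+1)! in the sharp formula is
    -- not needed.
    have := mv _ _ (M * |h| ^ (n + 1)) h hder (fun ξ hξ => by
      refine (ih (D := fun j => D (j + 1)) (fun j ξ => hD (j + 1) ξ) hM (hξ.trans hh)).trans ?_
      gcongr)
    have h0 : (D 0 0 - ∑ j ∈ Finset.range (n + 2), (((0 : ℝ) ^ j / j.factorial : ℝ) : ℂ) * D j 0)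
        = 0 := by
      rw [Finset.sum_range_succ']
      simp
    rw [h0, sub_zero] at this
    refine this.trans (le_of_eq (by ring))

theorem iteratedDeriv_add_const_succ (F : ℂ → ℂ) (a : ℂ) (n : ℕ) :
    iteratedDeriv (n + 1) (fun z => F z + a) = iteratedDeriv (n + 1) F := by
  rw [iteratedDeriv_succ', iteratedDeriv_succ']
  congr 1
  ext z
  simp

theorem setIntegral_Ioc_rpow {h e : ℝ} (hh : 0 ≤ h) (he : -1 < e) :
    IntegrableOn (fun t : ℝ => t ^ e) (Set.Ioc 0 h) ∧
      ∫ t in Set.Ioc 0 h, t ^ e = h ^ (e + 1) / (e + 1) := by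
  refine ⟨(intervalIntegrable_iff_integrableOn_Ioc_of_le hh).1
    (intervalIntegral.intervalIntegrable_rpow' he), ?_⟩
  rw [← intervalIntegral.integral_of_le hh, integral_rpow (Or.inl he),
    Real.zero_rpow (by linarith), sub_zero]

/-- Taylor expansion of a ray integral at points near which the function is small. -/
theorem exists_rayIntegral_taylor_bound {F : ℂ → ℂ} (hF : DifferentiableOn ℂ F {z : ℂ | 0 < z.im})
    {ρ α : ℝ} (hdec : VerticalDecay F ρ) (h0 : 0 ≤ ρ) (hρ : ρ < α) {A B C s : ℝ} {a : ℂ} {n : ℕ}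
    {S : Set ℝ}
    (hb : ∀ x₀ ∈ S, ∀ z : ℂ, 0 < z.im → ‖F z + a‖ ≤ C * ‖z - x₀‖ ^ A * z.im ^ (-B))
    (hB : B < α) (hs : s = α + A - B) (hns : (n : ℝ) < s) (hsn : s < n + 1) :
    (∀ x₀ ∈ S, ∀ j ≤ n, IntegrableOn
      (fun t : ℝ => ((t ^ (α - 1) : ℝ) : ℂ) * iteratedDeriv j F ((x₀ : ℂ) + Complex.I * t))
      (Set.Ioi 0)) ∧
    ∃ K : ℝ, ∀ x₀ ∈ S, ∀ h : ℝ, ‖rayIntegral α F (x₀ + h) - ∑ j ∈ Finset.range (n + 1),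
      ((h ^ j / j.factorial : ℝ) : ℂ) * rayIntegral α (iteratedDeriv j F) x₀‖ ≤ K * |h| ^ s := by
  have hFa : DifferentiableOn ℂ (fun z => F z + a) {z : ℂ | 0 < z.im} := hF.add_const a
  choose! K hK using fun k => norm_iteratedDeriv_le_of_weighted_bound hFa hb k
  have hK0 : ∀ x₀ ∈ S, ∀ k, 0 ≤ K k := by
    intro x₀ hx k
    have h1 := (norm_nonneg _).trans (hK k x₀ hx ((x₀ : ℂ) + Complex.I) (by simp))
    simpa using h1
  -- bound on the vertical ray
  have hvert : ∀ x₀ ∈ S, ∀ k, ∀ t : ℝ, 0 < t →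
      ‖iteratedDeriv k (fun z => F z + a) ((x₀ : ℂ) + Complex.I * t)‖ ≤ K k * t ^ (A - B - k) := by
    intro x₀ hx k t ht
    have h1 := hK k x₀ hx ((x₀ : ℂ) + Complex.I * t) (by simpa using ht)
    rw [ray_im, add_sub_cancel_left, norm_mul, Complex.norm_I, one_mul, Complex.norm_real,
      Real.norm_of_nonneg ht.le, mul_assoc, ← Real.rpow_add ht] at h1
    convert h1 using 3
    ring
  -- For j = 0 the decay of F itself is used, since F + a need not be integrable at infinity. For j
  -- ≥ 1 the constant a has disappeared: near 0 the integrand has exponent α-1+A-B-j > -1 because j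
  -- ≤ n < s, and at infinity a decay exponent of at least α+1 applies.
  have hint : ∀ x₀ ∈ S, ∀ j ≤ n, IntegrableOn
      (fun t : ℝ => ((t ^ (α - 1) : ℝ) : ℂ) * iteratedDeriv j F ((x₀ : ℂ) + Complex.I * t))
      (Set.Ioi 0) := by
    intro x₀ hx j hj
    rcases j with _ | j
    · simpa using integrableOn_ray hF.continuousOn hdec h0 hρ x₀
    have hjn : ((j + 1 : ℕ) : ℝ) ≤ n := by exact_mod_cast hj
    have hcont := continuousOn_ray (differentiableOn_iteratedDeriv_upperHalf hF (j + 1)).continuousOn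
      α x₀ 0 le_rfl
    simp only [Complex.ofReal_zero, mul_zero, add_zero] at hcont
    obtain ⟨C₂, h₂⟩ := (hdec.iteratedDeriv hF (j + 1)) (max (α + 1) (ρ + (j + 1 : ℕ)))
      (le_max_right _ _)
    rw [← Set.Ioc_union_Ioi_eq_Ioi (zero_le_one' ℝ)]
    refine IntegrableOn.union ?_ ?_
    · refine Integrable.mono' (((setIntegral_Ioc_rpow zero_le_one
        (e := α - 1 + (A - B - (j + 1 : ℕ))) (by linarith)).1).const_mul (K (j + 1)))
        ((hcont.mono Set.Ioc_subset_Ioi_self).aestronglyMeasurable measurableSet_Ioc) ?_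
      refine (ae_restrict_iff' measurableSet_Ioc).2 (Eventually.of_forall fun t ht => ?_)
      have := hvert x₀ hx (j + 1) t ht.1
      rw [iteratedDeriv_add_const_succ] at this
      have ht0 := ht.1
      rw [norm_mul, Complex.norm_real, Real.norm_of_nonneg (by positivity), Real.rpow_add ht.1]
      calc _ ≤ t ^ (α - 1) * (K (j + 1) * t ^ (A - B - (j + 1 : ℕ))) := by gcongr
        _ = _ := by ring
    · refine Integrable.mono' ((integrableOn_Ioi_rpow_of_lt
        (a := α - 1 - max (α + 1) (ρ + (j + 1 : ℕ)))
        (by linarith [le_max_left (α + 1) (ρ + (j + 1 : ℕ))]) one_pos).const_mul C₂)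
        ((hcont.mono (Set.Ioi_subset_Ioi zero_le_one)).aestronglyMeasurable measurableSet_Ioi) ?_
      refine (ae_restrict_iff' measurableSet_Ioi).2 (Eventually.of_forall fun t ht => ?_)
      have ht0 : (0 : ℝ) < t := one_pos.trans ht
      have := h₂ ((x₀ : ℂ) + Complex.I * t) (by simpa using ht0)
      rw [ray_im] at this
      rw [norm_mul, Complex.norm_real, Real.norm_of_nonneg (by positivity), sub_eq_add_neg (α - 1),
        Real.rpow_add ht0]
      calc _ ≤ t ^ (α - 1) * (C₂ * t ^ (-max (α + 1) (ρ + (j + 1 : ℕ)))) := by gcongr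
        _ = _ := by ring
  refine ⟨hint, ?_⟩
  have hAB : -1 < α - 1 - B := by linarith
  refine ⟨K 0 * 2 ^ |A| / (α - B) + (∑ j ∈ Finset.range (n + 1), K j / (s - j))
    + K (n + 1) * 2 ^ |A| / (n + 1 - s), fun x₀ hx h => ?_⟩
  rcases eq_or_ne h 0 with rfl | hh
  · rw [Finset.sum_range_succ']
    simp only [iteratedDeriv_zero, add_zero, abs_zero, pow_succ, mul_zero, zero_div,
      Complex.ofReal_zero, zero_mul, Finset.sum_const_zero, pow_zero, Nat.factorial_zero,
      Nat.cast_one, div_one, Complex.ofReal_one, one_mul, zero_add, sub_self, norm_zero]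
    rw [Real.zero_rpow (by have : (0 : ℝ) ≤ n := Nat.cast_nonneg n; linarith), mul_zero]
  have hpos : 0 < |h| := abs_pos.2 hh
  -- R(t) is the Taylor remainder at height t. For t ≤ |h| all its terms are estimated separately,
  -- with |h| ≤ |z-x₀| ≤ 2|h| at the displaced point. For t > |h| Taylor's formula is used, with t ≤
  -- |z-x₀| ≤ 2t on the whole segment.
  set R : ℝ → ℂ := fun t => F (((x₀ + h : ℝ) : ℂ) + Complex.I * t) - ∑ j ∈ Finset.range (n + 1),
      ((h ^ j / j.factorial : ℝ) : ℂ) * iteratedDeriv j F ((x₀ : ℂ) + Complex.I * t) with hR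
  -- The constant a cancels between the value and the zeroth Taylor term, so the weighted bound on F
  -- + a may be used throughout.
  have hRa : ∀ t, R t = (F (((x₀ + h : ℝ) : ℂ) + Complex.I * t) + a) -
      ∑ j ∈ Finset.range (n + 1), ((h ^ j / j.factorial : ℝ) : ℂ) *
        iteratedDeriv j (fun z => F z + a) ((x₀ : ℂ) + Complex.I * t) := by
    intro t
    simp only [hR]
    rw [Finset.sum_range_succ', Finset.sum_range_succ']
    simp only [iteratedDeriv_add_const_succ, iteratedDeriv_zero]
    simp
    ring
  have hIh := integrableOn_ray hF.continuousOn hdec h0 hρ (x₀ + h)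
  have hIsum : IntegrableOn (fun t : ℝ => ∑ j ∈ Finset.range (n + 1),
      ((h ^ j / j.factorial : ℝ) : ℂ) *
        (((t ^ (α - 1) : ℝ) : ℂ) * iteratedDeriv j F ((x₀ : ℂ) + Complex.I * t))) (Set.Ioi 0) :=
    integrable_finsetSum _ fun j hj =>
      (hint x₀ hx j (by have := Finset.mem_range.1 hj; omega)).const_mul _
  have hReq : (fun t : ℝ => ((t ^ (α - 1) : ℝ) : ℂ) * R t) = fun t =>
      ((t ^ (α - 1) : ℝ) : ℂ) * F (((x₀ + h : ℝ) : ℂ) + Complex.I * t) -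
        ∑ j ∈ Finset.range (n + 1), ((h ^ j / j.factorial : ℝ) : ℂ) *
        (((t ^ (α - 1) : ℝ) : ℂ) * iteratedDeriv j F ((x₀ : ℂ) + Complex.I * t)) := by
    ext t
    simp only [hR]
    rw [mul_sub, Finset.mul_sum]
    congr 1
    exact Finset.sum_congr rfl fun j _ => by ring
  have hIR : IntegrableOn (fun t : ℝ => ((t ^ (α - 1) : ℝ) : ℂ) * R t) (Set.Ioi 0) := by
    rw [hReq]
    exact hIh.sub hIsum
  have hmain : rayIntegral α F (x₀ + h) - ∑ j ∈ Finset.range (n + 1),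
      ((h ^ j / j.factorial : ℝ) : ℂ) * rayIntegral α (iteratedDeriv j F) x₀ =
      ∫ t in Set.Ioi (0 : ℝ), ((t ^ (α - 1) : ℝ) : ℂ) * R t := by
    rw [hReq, integral_sub hIh hIsum, integral_finsetSum]
    · simp only [integral_const_mul]
      rfl
    · exact fun j hj => (hint x₀ hx j (by have := Finset.mem_range.1 hj; omega)).const_mul _
  rw [hmain, ← Set.Ioc_union_Ioi_eq_Ioi hpos.le, setIntegral_union (Set.Ioc_disjoint_Ioi le_rfl)
    measurableSet_Ioi (hIR.mono_set Set.Ioc_subset_Ioi_self)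
    (hIR.mono_set (Set.Ioi_subset_Ioi hpos.le))]
  -- points of the segment
  have hdist : ∀ ξ t : ℝ, 0 < t → ‖((x₀ + ξ : ℝ) : ℂ) + Complex.I * t - x₀‖ ≤ |ξ| + t ∧
      t ≤ ‖((x₀ + ξ : ℝ) : ℂ) + Complex.I * t - x₀‖ ∧
      |ξ| ≤ ‖((x₀ + ξ : ℝ) : ℂ) + Complex.I * t - x₀‖ := by
    intro ξ t ht
    have he : ((x₀ + ξ : ℝ) : ℂ) + Complex.I * t - x₀ = ξ + Complex.I * t := by push_cast; ring
    rw [he]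
    refine ⟨?_, ?_, ?_⟩
    · refine (norm_add_le _ _).trans (le_of_eq ?_)
      simp [abs_of_pos ht]
    · have := Complex.abs_im_le_norm ((ξ : ℂ) + Complex.I * t)
      simpa [abs_of_pos ht] using this
    · have := Complex.abs_re_le_norm ((ξ : ℂ) + Complex.I * t)
      simpa using this
  have hsmall : ‖∫ t in Set.Ioc 0 |h|, ((t ^ (α - 1) : ℝ) : ℂ) * R t‖ ≤
      (K 0 * 2 ^ |A| / (α - B) + (∑ j ∈ Finset.range (n + 1), K j / (s - j))) * |h| ^ s := by
    have hi1 := setIntegral_Ioc_rpow hpos.le hAB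
    have hi2 : ∀ j ∈ Finset.range (n + 1), -1 < α - 1 + (A - B - j) := by
      intro j hj
      have : (j : ℝ) ≤ n := by exact_mod_cast Nat.lt_succ_iff.1 (Finset.mem_range.1 hj)
      linarith
    have hbound : ∀ t ∈ Set.Ioc 0 |h|, ‖((t ^ (α - 1) : ℝ) : ℂ) * R t‖ ≤
        K 0 * 2 ^ |A| * |h| ^ A * t ^ (α - 1 - B) +
          ∑ j ∈ Finset.range (n + 1), K j * |h| ^ j * t ^ (α - 1 + (A - B - j)) := by
      intro t ht
      have ht0 := ht.1
      have e1 : ‖F (((x₀ + h : ℝ) : ℂ) + Complex.I * t) + a‖ ≤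
          K 0 * (2 ^ |A| * |h| ^ A) * t ^ (-B) := by
        have h1 := hK 0 x₀ hx (((x₀ + h : ℝ) : ℂ) + Complex.I * t) (by simpa using ht0)
        rw [ray_im] at h1
        simp only [iteratedDeriv_zero, Nat.cast_zero, add_zero] at h1
        refine h1.trans ?_
        have h2 := hdist h t ht0
        have h3 := rpow_le_two_rpow_abs_mul hpos (by linarith [h2.2.2]) (by linarith [h2.1, ht.2]) A
          (u := ‖((x₀ + h : ℝ) : ℂ) + Complex.I * t - x₀‖)
        have := hK0 x₀ hx 0
        gcongr
      have e2 : ∀ j ∈ Finset.range (n + 1), ‖((h ^ j / j.factorial : ℝ) : ℂ) *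
          iteratedDeriv j (fun z => F z + a) ((x₀ : ℂ) + Complex.I * t)‖ ≤
          |h| ^ j * (K j * t ^ (A - B - j)) := by
        intro j _
        rw [norm_mul, Complex.norm_real, norm_div, norm_pow, Real.norm_eq_abs, Real.norm_natCast]
        refine mul_le_mul ?_ (hvert x₀ hx j t ht0) (norm_nonneg _) (by positivity)
        exact div_le_self (by positivity) (by exact_mod_cast Nat.one_le_of_lt j.factorial_pos)
      rw [norm_mul, Complex.norm_real, Real.norm_of_nonneg (by positivity), hRa]
      calc _ ≤ t ^ (α - 1) * (K 0 * (2 ^ |A| * |h| ^ A) * t ^ (-B) +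
            ∑ j ∈ Finset.range (n + 1), |h| ^ j * (K j * t ^ (A - B - j))) := by
            gcongr
            exact (norm_sub_le _ _).trans (add_le_add e1 ((norm_sum_le _ _).trans
              (Finset.sum_le_sum e2)))
        _ = _ := by
            rw [mul_add, Finset.mul_sum, sub_eq_add_neg (α - 1) B, Real.rpow_add ht0]
            congr 1
            · ring
            · refine Finset.sum_congr rfl fun j _ => ?_
              rw [Real.rpow_add ht0]
              ring
    have hgi : IntegrableOn (fun t : ℝ => K 0 * 2 ^ |A| * |h| ^ A * t ^ (α - 1 - B) +
          ∑ j ∈ Finset.range (n + 1), K j * |h| ^ j * t ^ (α - 1 + (A - B - j)))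
          (Set.Ioc 0 |h|) :=
      (hi1.1.const_mul _).add (integrable_finsetSum _ fun j hj =>
        ((setIntegral_Ioc_rpow hpos.le (hi2 j hj)).1).const_mul _)
    refine (norm_integral_le_of_norm_le hgi ((ae_restrict_iff' measurableSet_Ioc).2
      (Eventually.of_forall hbound))).trans (le_of_eq ?_)
    rw [integral_add (hi1.1.const_mul _) (integrable_finsetSum _ fun j hj =>
        ((setIntegral_Ioc_rpow hpos.le (hi2 j hj)).1).const_mul _), integral_const_mul, hi1.2,
      integral_finsetSum _ (fun j hj =>
        ((setIntegral_Ioc_rpow hpos.le (hi2 j hj)).1).const_mul _), add_mul, Finset.sum_mul]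
    congr 1
    · rw [show α - 1 - B + 1 = α - B by ring, hs, show α + A - B = A + (α - B) by ring,
        Real.rpow_add hpos]
      ring
    · refine Finset.sum_congr rfl fun j hj => ?_
      rw [integral_const_mul, (setIntegral_Ioc_rpow hpos.le (hi2 j hj)).2,
        show α - 1 + (A - B - j) + 1 = s - j by rw [hs]; ring, Real.rpow_sub hpos,
        Real.rpow_natCast]
      field_simp
  have hlarge : ‖∫ t in Set.Ioi |h|, ((t ^ (α - 1) : ℝ) : ℂ) * R t‖ ≤
      K (n + 1) * 2 ^ |A| / (n + 1 - s) * |h| ^ s := by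
    have hbound : ∀ t ∈ Set.Ioi |h|, ‖((t ^ (α - 1) : ℝ) : ℂ) * R t‖ ≤
        K (n + 1) * 2 ^ |A| * |h| ^ (n + 1) * t ^ (s - n - 2) := by
      intro t ht
      have ht0 : 0 < t := hpos.trans ht
      have hT := norm_sub_taylor_le (n := n) (h := h) (H := |h|)
        (D := fun j ξ => iteratedDeriv j (fun z => F z + a) (((x₀ + ξ : ℝ) : ℂ) + Complex.I * t))
        (M := K (n + 1) * (2 ^ |A| * t ^ A) * t ^ (-(B + (n + 1 : ℕ)))) (by
          intro j ξ
          have h1 := hasDerivAt_ray (differentiableOn_iteratedDeriv_upperHalf hFa j) ht0 (x₀ + ξ)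
          rw [← iteratedDeriv_succ] at h1
          exact h1.comp_const_add x₀ ξ) (by
          intro ξ hξ
          have h1 := hK (n + 1) x₀ hx (((x₀ + ξ : ℝ) : ℂ) + Complex.I * t) (by simpa using ht0)
          rw [ray_im] at h1
          refine h1.trans ?_
          have h2 := hdist ξ t ht0
          have ht' : |h| < t := ht
          have h3 := rpow_le_two_rpow_abs_mul ht0 (by linarith [h2.2.1]) (by linarith [h2.1]) A
            (u := ‖((x₀ + ξ : ℝ) : ℂ) + Complex.I * t - x₀‖)
          have := hK0 x₀ hx (n + 1)
          gcongr) le_rfl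
      simp only [iteratedDeriv_zero, add_zero] at hT
      rw [← hRa] at hT
      rw [norm_mul, Complex.norm_real, Real.norm_of_nonneg (by positivity)]
      calc _ ≤ t ^ (α - 1) * (K (n + 1) * (2 ^ |A| * t ^ A) * t ^ (-(B + (n + 1 : ℕ))) *
            |h| ^ (n + 1)) := by gcongr
        _ = _ := by
          rw [show s - n - 2 = (α - 1) + A + (-(B + (n + 1 : ℕ))) by rw [hs]; push_cast; ring,
            Real.rpow_add ht0, Real.rpow_add ht0]
          ring
    -- Integrability at infinity uses s < n+1 and that of the lower piece used n < s, which is why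
    -- integral values of s are excluded.
    have hgi := integrableOn_Ioi_rpow_of_lt (a := s - n - 2) (by linarith) hpos
    refine (norm_integral_le_of_norm_le (hgi.const_mul _) ((ae_restrict_iff' measurableSet_Ioi).2
      (Eventually.of_forall hbound))).trans (le_of_eq ?_)
    rw [integral_const_mul, integral_Ioi_rpow_of_lt (by linarith) hpos,
      show s - n - 2 + 1 = s - ((n + 1 : ℕ) : ℝ) by push_cast; ring, Real.rpow_sub hpos,
      Real.rpow_natCast]
    have : (n : ℝ) + 1 - s ≠ 0 := by linarith
    have : s - (n + 1 : ℕ) ≠ 0 := by push_cast; linarith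
    push_cast at *
    rw [show s - (n + 1 : ℝ) = -(n + 1 - s) by ring]
    field_simp
  calc _ ≤ _ + _ := norm_add_le _ _
    _ ≤ _ := add_le_add hsmall hlarge
    _ = _ := by ring

/-! ### The reproducing kernel and its Fourier transform -/

/-- The kernel `(i (t - z))^{-(β+1)}`. -/
noncomputable def cauchyKernel (β : ℝ) (z : ℂ) (t : ℝ) : ℂ :=
  (Complex.I * ((t : ℂ) - z)) ^ ((-(β + 1) : ℝ) : ℂ)

theorem kernel_arg_re (z w : ℂ) : (Complex.I * (w - z)).re = z.im - w.im := by
  simp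

theorem norm_cauchyKernel (β : ℝ) (z : ℂ) (t : ℝ) :
    ‖cauchyKernel β z t‖ = ‖(t : ℂ) - z‖ ^ (-(β + 1)) := by
  rw [cauchyKernel, Complex.norm_cpow_real, norm_mul, Complex.norm_I, one_mul]

/-- The factor i puts the base of the power in the right half-plane, where the principal branch is
holomorphic. -/
theorem kernel_arg_mem_slitPlane {z : ℂ} (hz : 0 < z.im) (t : ℝ) :
    Complex.I * ((t : ℂ) - z) ∈ Complex.slitPlane :=
  Or.inl (by rw [kernel_arg_re]; simpa using hz)

theorem hasDerivAt_cauchyKernel (β : ℝ) {z : ℂ} (hz : 0 < z.im) (t : ℝ) :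
    HasDerivAt (cauchyKernel β z) (-(β + 1) * Complex.I * cauchyKernel (β + 1) z t) t := by
  have h1 : HasDerivAt (fun w : ℂ => Complex.I * (w - z)) (Complex.I * 1) (t : ℂ) :=
    ((hasDerivAt_id _).sub_const z).const_mul _
  have h2 := h1.cpow_const (c := ((-(β + 1) : ℝ) : ℂ)) (kernel_arg_mem_slitPlane hz t)
  refine h2.comp_ofReal.congr_deriv ?_
  rw [cauchyKernel, show ((-(β + 1) : ℝ) : ℂ) - 1 = ((-(β + 1 + 1) : ℝ) : ℂ) by push_cast; ring]
  push_cast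
  ring

theorem continuous_cauchyKernel (β : ℝ) {z : ℂ} (hz : 0 < z.im) : Continuous (cauchyKernel β z) :=
  continuous_iff_continuousAt.2 fun t => (hasDerivAt_cauchyKernel β hz t).continuousAt

/-- The substitution t = Re z + (Im z)u reduces the integral to z = i, and scaling produces (Im
z)^{-β}. -/
theorem exists_integral_norm_sub_rpow_le {β : ℝ} (hβ : 0 < β) :
    ∃ K : ℝ, 0 ≤ K ∧ ∀ z : ℂ, 0 < z.im →
      Integrable (fun t : ℝ => ‖(t : ℂ) - z‖ ^ (-(β + 1))) ∧
      ∫ t : ℝ, ‖(t : ℂ) - z‖ ^ (-(β + 1)) ≤ K * z.im ^ (-β) := by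
  have h0 : Integrable (fun u : ℝ => ‖(u : ℂ) - Complex.I‖ ^ (-(β + 1))) := by
    have h1 := integrable_rpow_neg_one_add_norm_sq (E := ℝ) (μ := volume) (r := β + 1)
      (by simp; linarith)
    refine h1.congr (Eventually.of_forall fun u => ?_)
    have : ‖(u : ℂ) - Complex.I‖ = (1 + ‖u‖ ^ 2) ^ (1 / 2 : ℝ) := by
      rw [← Real.sqrt_eq_rpow, Complex.norm_def, Complex.normSq_apply]
      congr 1
      simp
      ring
    simp only [this]
    rw [← Real.rpow_mul (by positivity)]
    congr 1
    ring
  refine ⟨∫ u : ℝ, ‖(u : ℂ) - Complex.I‖ ^ (-(β + 1)), integral_nonneg fun u => by positivity,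
    fun z hz => ?_⟩
  have hscale : ∀ t : ℝ, ‖(t : ℂ) - z‖ ^ (-(β + 1)) =
      z.im ^ (-(β + 1)) * ‖(((t - z.re) / z.im : ℝ) : ℂ) - Complex.I‖ ^ (-(β + 1)) := by
    intro t
    rw [← Real.mul_rpow hz.le (norm_nonneg _)]
    congr 1
    have hn : ∀ w : ℂ, z.im * ‖w‖ = ‖(z.im : ℂ) * w‖ := fun w => by
      rw [norm_mul, Complex.norm_real, Real.norm_of_nonneg hz.le]
    rw [hn]
    congr 1
    apply Complex.ext
    · simp
      field_simp
    · simp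
  have hcomp : Integrable (fun t : ℝ => ‖(((t - z.re) / z.im : ℝ) : ℂ) - Complex.I‖ ^ (-(β + 1))) :=
    (h0.comp_div hz.ne').comp_sub_right z.re
  refine ⟨(hcomp.const_mul (z.im ^ (-(β + 1)))).congr (Eventually.of_forall fun t => (hscale t).symm),
    ?_⟩
  simp_rw [hscale]
  rw [integral_const_mul, integral_sub_right_eq_self
    (fun t : ℝ => ‖((t / z.im : ℝ) : ℂ) - Complex.I‖ ^ (-(β + 1))) z.re,
    Measure.integral_comp_div (fun t : ℝ => ‖((t : ℝ) : ℂ) - Complex.I‖ ^ (-(β + 1))) z.im,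
    abs_of_pos hz, smul_eq_mul, ← mul_assoc, neg_add, Real.rpow_add hz, Real.rpow_neg_one]
  field_simp
  exact le_rfl

theorem integrable_cauchyKernel {β : ℝ} (hβ : 0 < β) {z : ℂ} (hz : 0 < z.im) :
    Integrable (cauchyKernel β z) := by
  obtain ⟨K, -, hK⟩ := exists_integral_norm_sub_rpow_le hβ
  refine (hK z hz).1.mono' (continuous_cauchyKernel β hz).aestronglyMeasurable
    (Eventually.of_forall fun t => ?_)
  rw [norm_cauchyKernel]

theorem integrable_mul_cauchyKernel {β : ℝ} (hβ : 0 < β) {g : ℝ → ℂ} (hg : Continuous g) {Mg : ℝ}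
    (hM : ∀ t, ‖g t‖ ≤ Mg) {z : ℂ} (hz : 0 < z.im) :
    Integrable (fun t => g t * cauchyKernel β z t) :=
  (integrable_cauchyKernel hβ hz).bdd_mul hg.aestronglyMeasurable (Eventually.of_forall hM)

/-- The Laplace transform of `v ^ (a-1)` on the right half-plane. -/
theorem integral_rpow_mul_cexp_neg {a : ℝ} (ha : 0 < a) {r : ℂ} (hr : 0 < r.re) :
    IntegrableOn (fun v : ℝ => ((v ^ (a - 1) : ℝ) : ℂ) * Complex.exp (-(r * v))) (Set.Ioi 0) ∧
    ∫ v in Set.Ioi (0 : ℝ), ((v ^ (a - 1) : ℝ) : ℂ) * Complex.exp (-(r * v)) =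
      r ^ ((-a : ℝ) : ℂ) * Real.Gamma a := by
  have hbase : ∀ {s b : ℝ}, -1 < s → 0 < b →
      IntegrableOn (fun v : ℝ => v ^ s * Real.exp (-(b * v))) (Set.Ioi 0) := by
    intro s b hs hb
    refine (integrableOn_rpow_mul_exp_neg_mul_rpow hs one_pos hb).congr_fun (fun v _ => ?_)
      measurableSet_Ioi
    simp
  have hnorm : ∀ (s : ℝ) (r : ℂ) (v : ℝ), 0 < v → ‖((v ^ s : ℝ) : ℂ) * Complex.exp (-(r * v))‖ =
      v ^ s * Real.exp (-(r.re * v)) := by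
    intro s r v hv
    rw [norm_mul, Complex.norm_real, Real.norm_of_nonneg (by positivity), Complex.norm_exp]
    simp
  have hmeas : ∀ (s : ℝ) (r : ℂ), AEStronglyMeasurable
      (fun v : ℝ => ((v ^ s : ℝ) : ℂ) * Complex.exp (-(r * v))) (volume.restrict (Set.Ioi 0)) := by
    intro s r
    refine Measurable.aestronglyMeasurable ?_
    fun_prop
  have hint : ∀ {s : ℝ} {r : ℂ}, -1 < s → 0 < r.re → IntegrableOn
      (fun v : ℝ => ((v ^ s : ℝ) : ℂ) * Complex.exp (-(r * v))) (Set.Ioi 0) := by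
    intro s r hs hr
    refine Integrable.mono' (hbase hs hr) (hmeas s r) ?_
    exact (ae_restrict_iff' measurableSet_Ioi).2 (Eventually.of_forall fun v hv =>
      (hnorm s r v hv).le)
  refine ⟨hint (by linarith) hr, ?_⟩
  -- Both sides are holomorphic on the right half-plane and agree on the positive reals by the real
  -- Gamma integral, so the identity theorem applies.
  set J : ℂ → ℂ := fun r => ∫ v in Set.Ioi (0 : ℝ), ((v ^ (a - 1) : ℝ) : ℂ) * Complex.exp (-(r * v))
    with hJ
  set U : Set ℂ := {r : ℂ | 0 < r.re} with hU
  have hUo : IsOpen U := isOpen_lt continuous_const Complex.continuous_re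
  have hJd : DifferentiableOn ℂ J U := by
    intro r₀ hr₀
    have hr₀' : 0 < r₀.re := hr₀
    refine DifferentiableAt.differentiableWithinAt ?_
    refine (hasDerivAt_integral_of_dominated_loc_of_deriv_le
      (F := fun (r : ℂ) (v : ℝ) => ((v ^ (a - 1) : ℝ) : ℂ) * Complex.exp (-(r * v)))
      (F' := fun (r : ℂ) (v : ℝ) => ((v ^ (a - 1) : ℝ) : ℂ) * (Complex.exp (-(r * v)) * -v))
      (s := {r : ℂ | r₀.re / 2 < r.re})
      (bound := fun v : ℝ => v ^ a * Real.exp (-(r₀.re / 2 * v)))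
      ((isOpen_lt continuous_const Complex.continuous_re).mem_nhds (by
        simp only [Set.mem_ofPred_eq]; linarith))
      (Eventually.of_forall fun r => hmeas _ r) (hint (by linarith) hr₀') ?_ ?_
      (hbase (by linarith) (by linarith)) ?_).2.differentiableAt
    · refine Measurable.aestronglyMeasurable ?_
      fun_prop
    · refine (ae_restrict_iff' measurableSet_Ioi).2 (Eventually.of_forall fun v hv r hr => ?_)
      have hv0 : 0 < v := hv
      have hr' : r₀.re / 2 < r.re := hr
      rw [← mul_assoc, norm_mul, hnorm _ _ _ hv0, norm_neg, Complex.norm_real,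
        Real.norm_of_nonneg hv0.le, Real.rpow_sub_one hv0.ne']
      calc _ = v ^ a * Real.exp (-(r.re * v)) := by field_simp
        _ ≤ _ := by gcongr
    · refine Eventually.of_forall fun v r _ => ?_
      refine HasDerivAt.const_mul _ ?_
      have : HasDerivAt (fun r : ℂ => -(r * v)) (-v) r := by
        simpa using ((hasDerivAt_id r).mul_const (v : ℂ)).fun_neg
      exact this.cexp
  have hRd : DifferentiableOn ℂ (fun r : ℂ => r ^ ((-a : ℝ) : ℂ) * Real.Gamma a) U := by
    intro r hr
    refine DifferentiableAt.differentiableWithinAt ?_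
    refine DifferentiableAt.mul_const ?_ _
    exact differentiableAt_id.cpow_const (Or.inl hr)
  have hreal : ∀ x : ℝ, 0 < x → J x = (x : ℂ) ^ ((-a : ℝ) : ℂ) * Real.Gamma a := by
    intro x hx
    have h1 := Complex.integral_cpow_mul_exp_neg_mul_Ioi (a := a) (r := x) (by simpa using ha) hx
    rw [one_div, Complex.inv_cpow _ _ (by rw [Complex.arg_ofReal_of_nonneg hx.le]; exact
      Real.pi_ne_zero.symm), ← Complex.cpow_neg, Complex.Gamma_ofReal] at h1
    rw [Complex.ofReal_neg, ← h1]
    refine setIntegral_congr_fun measurableSet_Ioi fun v hv => ?_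
    have hv0 : (0 : ℝ) ≤ v := (Set.mem_Ioi.1 hv).le
    rw [Complex.ofReal_cpow hv0]
    push_cast
    rfl
  have hpre : IsPreconnected U := (convex_halfSpace_re_gt 0).isPreconnected
  have hfreq : ∃ᶠ r in 𝓝[≠] (1 : ℂ), J r = r ^ ((-a : ℝ) : ℂ) * Real.Gamma a := by
    have ht : Tendsto (fun x : ℝ => (x : ℂ)) (𝓝[≠] (1 : ℝ)) (𝓝[≠] (1 : ℂ)) := by
      refine tendsto_nhdsWithin_iff.2 ⟨?_, ?_⟩
      · have : ContinuousAt (fun x : ℝ => (x : ℂ)) 1 := Complex.continuous_ofReal.continuousAt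
        simpa using this.tendsto.mono_left nhdsWithin_le_nhds
      · filter_upwards [self_mem_nhdsWithin] with x hx
        simpa using hx
    refine ht.frequently (Eventually.frequently ?_)
    filter_upwards [nhdsWithin_le_nhds (lt_mem_nhds (zero_lt_one' ℝ))] with x hx
    exact hreal x hx
  exact (hJd.analyticOnNhd hUo).eqOn_of_preconnected_of_frequently_eq (hRd.analyticOnNhd hUo) hpre
    (by simp [hU] : (1 : ℂ) ∈ U) hfreq hr

/-- The Fourier transform of the kernel. -/
theorem integral_exp_mul_cauchyKernel {α : ℝ} (hα : 0 < α) {z : ℂ} (hz : 0 < z.im) (l : ℝ) :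
    ∫ t : ℝ, Complex.exp (Complex.I * l * t) * cauchyKernel α z t =
      if 0 < l then ((2 * Real.pi * l ^ α / Real.Gamma (α + 1) : ℝ) : ℂ) * Complex.exp (Complex.I * l * z)
      else 0 := by
  have hπ := Real.pi_pos
  -- By the Laplace transform the kernel is a constant multiple of the Fourier transform of ψ, which
  -- is continuous at 0 because α > 0. Fourier inversion at l/(2π) then gives the claim, with value
  -- 0 for l ≤ 0 since ψ lives on v > 0.
  set ψ : ℝ → ℂ := fun v => if 0 < v then ((v ^ α : ℝ) : ℂ) *
    Complex.exp (2 * Real.pi * Complex.I * v * z) else 0 with hψ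
  have hψc : Continuous ψ := by
    have h1 : ψ = fun v : ℝ => (((max v 0) ^ α : ℝ) : ℂ) *
        Complex.exp (2 * Real.pi * Complex.I * v * z) := by
      ext v
      simp only [hψ]
      split_ifs with hv
      · rw [max_eq_left hv.le]
      · rw [max_eq_right (not_lt.1 hv), Real.zero_rpow hα.ne']
        simp
    rw [h1]
    refine Continuous.mul (Complex.continuous_ofReal.comp ?_) (by fun_prop)
    exact (continuous_id.max continuous_const).rpow_const fun _ => Or.inr hα.le
  have hre : ∀ t : ℝ, 0 < (2 * Real.pi * (Complex.I * ((t : ℂ) - z))).re := by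
    intro t
    have : (2 * Real.pi * (Complex.I * ((t : ℂ) - z))).re = 2 * Real.pi * z.im := by
      rw [show (2 * Real.pi * (Complex.I * ((t : ℂ) - z))) =
        ((2 * Real.pi : ℝ) : ℂ) * (Complex.I * ((t : ℂ) - z)) by push_cast; ring,
        Complex.re_ofReal_mul, kernel_arg_re]
      simp
    rw [this]
    positivity
  have hψind : ∀ t : ℝ, (fun v : ℝ => Complex.exp (↑(-2 * Real.pi * v * t) * Complex.I) • ψ v) =
      (Set.Ioi (0 : ℝ)).indicator (fun v : ℝ => ((v ^ (α + 1 - 1) : ℝ) : ℂ) *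
        Complex.exp (-((2 * Real.pi * (Complex.I * ((t : ℂ) - z))) * v))) := by
    intro t
    ext v
    simp only [hψ, Set.indicator, Set.mem_Ioi]
    split_ifs with hv
    · rw [add_sub_cancel_right, smul_eq_mul, mul_left_comm, ← Complex.exp_add]
      congr 2
      push_cast
      ring
    · simp
  have hF : ∀ t : ℝ, 𝓕 ψ t = ((2 * Real.pi) ^ (-(α + 1)) * Real.Gamma (α + 1) : ℝ) *
      cauchyKernel α z t := by
    intro t
    rw [Real.fourier_real_eq_integral_exp_smul, hψind, integral_indicator measurableSet_Ioi,
      (integral_rpow_mul_cexp_neg (by linarith) (hre t)).2, cauchyKernel]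
    have hne : Complex.I * ((t : ℂ) - z) ≠ 0 :=
      Complex.slitPlane_ne_zero (kernel_arg_mem_slitPlane hz t)
    have h2π : (0 : ℝ) < 2 * Real.pi := by positivity
    rw [show (2 * Real.pi * (Complex.I * ((t : ℂ) - z))) =
        ((2 * Real.pi : ℝ) : ℂ) * (Complex.I * ((t : ℂ) - z)) by push_cast; ring,
      Complex.cpow_def_of_ne_zero (mul_ne_zero (by exact_mod_cast h2π.ne') hne),
      Complex.log_ofReal_mul h2π hne, add_mul, Complex.exp_add, Complex.cpow_def_of_ne_zero hne,
      Complex.ofReal_mul, Complex.ofReal_cpow h2π.le,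
      Complex.cpow_def_of_ne_zero (by exact_mod_cast h2π.ne'), Complex.ofReal_log h2π.le]
    ring
  have hψi : Integrable ψ := by
    have := hψind 0
    simp only [mul_zero, Complex.ofReal_zero, zero_mul, Complex.exp_zero, one_smul] at this
    have h2 := hre 0
    rw [Complex.ofReal_zero] at h2
    rw [show ψ = fun v => ψ v from rfl, this]
    exact ((integral_rpow_mul_cexp_neg (by linarith) h2).1).integrable_indicator measurableSet_Ioi
  have hFi : Integrable (𝓕 ψ) := by
    rw [show 𝓕 ψ = fun t => ((2 * Real.pi) ^ (-(α + 1)) * Real.Gamma (α + 1) : ℝ) *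
      cauchyKernel α z t from funext hF]
    exact (integrable_cauchyKernel hα hz).const_mul _
  have hinv := congr_fun (hψc.fourierInv_fourier_eq hψi hFi) (l / (2 * Real.pi))
  rw [Real.fourierInv_eq'] at hinv
  have hG : 0 < Real.Gamma (α + 1) := Real.Gamma_pos_of_pos (by linarith)
  have hc : (0 : ℝ) < (2 * Real.pi) ^ (-(α + 1)) * Real.Gamma (α + 1) := by positivity
  have hLHS : ∫ v : ℝ, Complex.exp (↑(2 * Real.pi * inner ℝ v (l / (2 * Real.pi))) * Complex.I) • 𝓕 ψ v
      = (((2 * Real.pi) ^ (-(α + 1)) * Real.Gamma (α + 1) : ℝ) : ℂ) *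
        ∫ t : ℝ, Complex.exp (Complex.I * l * t) * cauchyKernel α z t := by
    rw [← integral_const_mul]
    congr 1
    ext v
    rw [hF, smul_eq_mul, mul_left_comm]
    congr 3
    simp
    field_simp
  rw [hLHS] at hinv
  have hsol : ∫ t : ℝ, Complex.exp (Complex.I * l * t) * cauchyKernel α z t =
      (((2 * Real.pi) ^ (-(α + 1)) * Real.Gamma (α + 1) : ℝ) : ℂ)⁻¹ * ψ (l / (2 * Real.pi)) := by
    rw [← hinv, ← mul_assoc, inv_mul_cancel₀ (by exact_mod_cast hc.ne'), one_mul]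
  rw [hsol]
  simp only [hψ]
  by_cases hl : 0 < l
  · rw [if_pos (by positivity), if_pos hl, ← mul_assoc, ← Complex.ofReal_inv, ← Complex.ofReal_mul]
    congr 2
    · rw [Real.div_rpow hl.le (by positivity), Real.rpow_neg (by positivity),
        Real.rpow_add_one (by positivity)]
      field_simp
    · push_cast
      field_simp
  · rw [if_neg (by rw [not_lt] at hl ⊢; exact div_nonpos_of_nonpos_of_nonneg hl (by positivity)),
      if_neg hl, mul_zero]

/-! ### Local regularity bounds the growth of the transform -/

theorem hasDerivAt_iteratedDeriv_of_contDiffOn {g : ℝ → ℂ} {U : Set ℝ} (hU : IsOpen U) {k : ℕ}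
    (hg : ContDiffOn ℝ k g U) {j : ℕ} (hj : j < k) {t : ℝ} (ht : t ∈ U) :
    HasDerivAt (iteratedDeriv j g) (iteratedDeriv (j + 1) g t) t := by
  have h1 : DifferentiableOn ℝ (iteratedDerivWithin j g U) U :=
    hg.differentiableOn_iteratedDerivWithin (by exact_mod_cast hj) hU.uniqueDiffOn
  have h2 : DifferentiableAt ℝ (iteratedDeriv j g) t := by
    refine ((h1 t ht).differentiableAt (hU.mem_nhds ht)).congr_of_eventuallyEq ?_
    filter_upwards [hU.mem_nhds ht] with x hx
    rw [iteratedDerivWithin_of_isOpen hU hx]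
  rw [iteratedDeriv_succ]
  exact h2.hasDerivAt

theorem continuousOn_iteratedDeriv_of_contDiffOn {g : ℝ → ℂ} {U : Set ℝ} (hU : IsOpen U) {k : ℕ}
    (hg : ContDiffOn ℝ k g U) {j : ℕ} (hj : j ≤ k) : ContinuousOn (iteratedDeriv j g) U :=
  (hg.continuousOn_iteratedDerivWithin (by exact_mod_cast hj) hU.uniqueDiffOn).congr
    fun x hx => (iteratedDerivWithin_of_isOpen hU hx).symm

/-- The part of the integral against the kernel away from `x₀` is bounded near `x₀`. -/
theorem exists_tail_bound {α : ℝ} (hα : 0 < α) {g : ℝ → ℂ} (hg : Continuous g) {Mg : ℝ}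
    (hM : ∀ t, ‖g t‖ ≤ Mg) (x₀ : ℝ) {δ : ℝ} (hδ : 0 < δ) :
    ∃ C : ℝ, ∀ z : ℂ, 0 < z.im → ‖z - x₀‖ ≤ δ / 2 →
      ‖(∫ t : ℝ, g t * cauchyKernel α z t) -
        ∫ t in (x₀ - δ)..(x₀ + δ), g t * cauchyKernel α z t‖ ≤ C := by
  obtain ⟨K, -, hK⟩ := exists_integral_norm_sub_rpow_le hα
  -- A fixed comparison point. If |t-x₀| ≥ δ and |z-x₀| ≤ δ/2, then |t-z| ≥ |t-x₀|/2 and |t-z₁| ≤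
  -- 2|t-x₀|, so the tail is dominated by an integrable function independent of z.
  set z₁ : ℂ := x₀ + Complex.I * δ with hz₁
  have hz₁im : 0 < z₁.im := by simpa [hz₁] using hδ
  have hI := (hK z₁ hz₁im).1
  have hMg : 0 ≤ Mg := (norm_nonneg _).trans (hM 0)
  refine ⟨∫ t : ℝ, Mg * (4 ^ (α + 1) * ‖(t : ℂ) - z₁‖ ^ (-(α + 1))), fun z hz hzx => ?_⟩
  have hi := integrable_mul_cauchyKernel hα hg hM hz
  rw [intervalIntegral.integral_of_le (by linarith),
    ← integral_add_compl (measurableSet_Ioc (a := x₀ - δ) (b := x₀ + δ)) hi, add_sub_cancel_left]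
  refine (norm_integral_le_of_norm_le (((hI.const_mul (4 ^ (α + 1))).const_mul Mg).integrableOn)
    ((ae_restrict_iff' measurableSet_Ioc.compl).2 (Eventually.of_forall fun t ht => ?_))).trans ?_
  · rw [norm_mul, norm_cauchyKernel]
    have htd : δ ≤ |t - x₀| := by
      by_contra h
      rw [not_le, abs_lt] at h
      exact ht ⟨by linarith, by linarith⟩
    have h1 : |t - x₀| ≤ ‖(t : ℂ) - z‖ + ‖z - x₀‖ := by
      calc |t - x₀| = ‖((t : ℂ) - z) + (z - x₀)‖ := by
            rw [sub_add_sub_cancel, ← Complex.ofReal_sub, Complex.norm_real, Real.norm_eq_abs]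
        _ ≤ _ := norm_add_le _ _
    have h2 : ‖(t : ℂ) - z₁‖ ≤ |t - x₀| + δ := by
      calc ‖(t : ℂ) - z₁‖ = ‖((t - x₀ : ℝ) : ℂ) - Complex.I * δ‖ := by
            rw [hz₁]; push_cast; ring_nf
        _ ≤ _ := norm_sub_le _ _
        _ = _ := by
          rw [norm_mul, Complex.norm_I, one_mul, Complex.norm_real, Complex.norm_real,
            Real.norm_eq_abs, Real.norm_of_nonneg hδ.le]
    have h3 : ‖(t : ℂ) - z₁‖ / 4 ≤ ‖(t : ℂ) - z‖ := by linarith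
    have h4 : 0 < ‖(t : ℂ) - z₁‖ := by
      rw [norm_pos_iff, sub_ne_zero]
      intro h
      rw [← h] at hz₁im
      simp at hz₁im
    have h5 : ‖(t : ℂ) - z‖ ^ (-(α + 1)) ≤ (‖(t : ℂ) - z₁‖ / 4) ^ (-(α + 1)) :=
      Real.rpow_le_rpow_of_nonpos (by positivity) h3 (by linarith)
    rw [Real.div_rpow h4.le (by norm_num), Real.rpow_neg (by norm_num : (0 : ℝ) ≤ 4), div_inv_eq_mul,
      mul_comm] at h5
    exact mul_le_mul (hM t) h5 (by positivity) hMg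
  · exact setIntegral_le_integral ((hI.const_mul _).const_mul _)
      (Eventually.of_forall fun t => by positivity)

theorem half_le_norm_sub {x₀ δ : ℝ} {z : ℂ} (hzx : ‖z - x₀‖ ≤ δ / 2) {w : ℂ}
    (hw : δ ≤ ‖w - x₀‖) : δ / 2 ≤ ‖w - z‖ := by
  have : ‖w - x₀‖ ≤ ‖w - z‖ + ‖z - x₀‖ := by
    calc ‖w - x₀‖ = ‖(w - z) + (z - x₀)‖ := by ring_nf
      _ ≤ _ := norm_add_le _ _
  linarith

/-- Up to the factor -(iβ)⁻¹, the kernel of order β-1 is a primitive of the kernel of order β. The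
boundary terms sit at distance at least δ/2 from z and stay bounded, so a derivative of G can be
traded for one order of the kernel. -/
theorem exists_integration_by_parts_bound {β : ℝ} (hβ : 0 < β) {G G' : ℝ → ℂ} {x₀ δ : ℝ}
    (hδ : 0 < δ)
    (hG : ∀ t ∈ Set.Icc (x₀ - δ) (x₀ + δ), HasDerivAt G (G' t) t)
    (hG' : ContinuousOn G' (Set.Icc (x₀ - δ) (x₀ + δ))) :
    ∃ C : ℝ, ∀ z : ℂ, 0 < z.im → ‖z - x₀‖ ≤ δ / 2 →
      ‖(∫ t in (x₀ - δ)..(x₀ + δ), G t * cauchyKernel β z t) - (Complex.I * β)⁻¹ *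
        ∫ t in (x₀ - δ)..(x₀ + δ), G' t * cauchyKernel (β - 1) z t‖ ≤ C := by
  refine ⟨β⁻¹ * (‖G (x₀ + δ)‖ * (δ / 2) ^ (-β) + ‖G (x₀ - δ)‖ * (δ / 2) ^ (-β)), fun z hz hzx => ?_⟩
  have hle : x₀ - δ ≤ x₀ + δ := by linarith
  have hβ0 : (Complex.I * β : ℂ) ≠ 0 := mul_ne_zero Complex.I_ne_zero (by exact_mod_cast hβ.ne')
  have hparts := intervalIntegral.integral_mul_deriv_eq_deriv_mul
    (u := G) (v := fun t => -((Complex.I * β)⁻¹ * cauchyKernel (β - 1) z t))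
    (u' := G') (v' := cauchyKernel β z) (a := x₀ - δ) (b := x₀ + δ)
    (fun t ht => hG t (by rwa [Set.uIcc_of_le hle] at ht))
    (fun t _ => by
      have h1 := hasDerivAt_cauchyKernel (β - 1) hz t
      refine (h1.const_mul (Complex.I * β : ℂ)⁻¹).fun_neg.congr_deriv ?_
      rw [sub_add_cancel]
      push_cast
      rw [sub_add_cancel]
      have : (β : ℂ) ≠ 0 := by exact_mod_cast hβ.ne'
      have := Complex.I_ne_zero
      field_simp)
    ((hG'.mono (by rw [Set.uIcc_of_le hle])).intervalIntegrable)
    ((continuous_cauchyKernel β hz).intervalIntegrable _ _)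
  rw [hparts, show (∫ t in (x₀ - δ)..(x₀ + δ), G' t * -((Complex.I * β)⁻¹ * cauchyKernel (β - 1) z t)) =
    -((Complex.I * β)⁻¹ * ∫ t in (x₀ - δ)..(x₀ + δ), G' t * cauchyKernel (β - 1) z t) by
      rw [← intervalIntegral.integral_const_mul, ← intervalIntegral.integral_neg]
      congr 1
      ext t
      ring]
  rw [sub_neg_eq_add, add_sub_cancel_right]
  have hk : ∀ t : ℝ, δ ≤ |t - x₀| → ‖cauchyKernel (β - 1) z t‖ ≤ (δ / 2) ^ (-β) := by
    intro t ht
    rw [norm_cauchyKernel, sub_add_cancel]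
    refine Real.rpow_le_rpow_of_nonpos (by positivity) (half_le_norm_sub hzx ?_) (by linarith)
    rwa [← Complex.ofReal_sub, Complex.norm_real, Real.norm_eq_abs]
  have hI : ‖(Complex.I * β : ℂ)⁻¹‖ = β⁻¹ := by
    rw [norm_inv, norm_mul, Complex.norm_I, one_mul, Complex.norm_real, Real.norm_of_nonneg hβ.le]
  refine (norm_sub_le _ _).trans ?_
  rw [mul_add]
  refine add_le_add ?_ ?_
  · rw [mul_neg, norm_neg, norm_mul, norm_mul, hI]
    have := hk (x₀ + δ) (by rw [add_sub_cancel_left]; exact le_abs_self _)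
    calc _ ≤ ‖G (x₀ + δ)‖ * (β⁻¹ * (δ / 2) ^ (-β)) := by gcongr
      _ = _ := by ring
  · rw [mul_neg, norm_neg, norm_mul, norm_mul, hI]
    have := hk (x₀ - δ) (by rw [sub_sub_cancel_left, abs_neg]; exact le_abs_self _)
    calc _ ≤ ‖G (x₀ - δ)‖ * (β⁻¹ * (δ / 2) ^ (-β)) := by gcongr
      _ = _ := by ring

/-- The singularity z lies above the real line, so the integrand is holomorphic below it. Cauchy's
theorem moves the segment to the other three sides of a rectangle in the lower half-plane, which
stay at distance at least δ/2 from z. Polynomials may thus be subtracted at bounded cost. -/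
theorem exists_polynomial_kernel_bound {β : ℝ} (hβ : 0 < β) (Q : Polynomial ℂ) (x₀ : ℝ) {δ : ℝ}
    (hδ : 0 < δ) :
    ∃ C : ℝ, ∀ z : ℂ, 0 < z.im → ‖z - x₀‖ ≤ δ / 2 →
      ‖∫ t in (x₀ - δ)..(x₀ + δ), Q.eval ((t : ℂ) - x₀) * cauchyKernel β z t‖ ≤ C := by
  obtain ⟨M, hM⟩ := (isCompact_closedBall (x₀ : ℂ) (2 * δ)).exists_bound_of_continuousOn
    (f := fun w : ℂ => Q.eval (w - x₀)) (by fun_prop)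
  have hM0 : 0 ≤ M := (norm_nonneg _).trans (hM x₀ (by simp; linarith))
  set E : ℝ := M * (δ / 2) ^ (-(β + 1)) with hE
  refine ⟨E * |2 * δ| + E * |δ| + E * |δ|, fun z hz hzx => ?_⟩
  set f : ℂ → ℂ := fun w => Q.eval (w - x₀) * (Complex.I * (w - z)) ^ ((-(β + 1) : ℝ) : ℂ) with hf
  have hfd : DifferentiableOn ℂ f {w | w.im ≤ 0} := by
    intro w hw
    have hw' : w.im ≤ 0 := hw
    refine DifferentiableAt.differentiableWithinAt ?_
    refine DifferentiableAt.mul ?_ ?_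
    · exact (Polynomial.differentiable Q).differentiableAt.comp w (by fun_prop)
    · refine DifferentiableAt.cpow_const (by fun_prop) (Or.inl ?_)
      rw [kernel_arg_re]
      linarith
  have hfb : ∀ w : ℂ, ‖w - x₀‖ ≤ 2 * δ → δ ≤ ‖w - x₀‖ → ‖f w‖ ≤ E := by
    intro w h1 h2
    simp only [hf, hE]
    rw [norm_mul, Complex.norm_cpow_real, norm_mul, Complex.norm_I, one_mul]
    refine mul_le_mul (hM w (by simpa [dist_eq_norm] using h1)) ?_ (by positivity) hM0
    exact Real.rpow_le_rpow_of_nonpos (by positivity) (half_le_norm_sub hzx h2) (by linarith)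
  have hrect := Complex.integral_boundary_rect_eq_zero_of_differentiableOn f
    (((x₀ - δ : ℝ) : ℂ) + ((-δ : ℝ) : ℂ) * Complex.I) (((x₀ + δ : ℝ) : ℂ) + ((0 : ℝ) : ℂ) * Complex.I)
    (hfd.mono (by
      intro w hw
      have := (Complex.mem_reProdIm.1 hw).2
      simp only [Complex.add_im, Complex.ofReal_im, Complex.mul_im, Complex.ofReal_re, Complex.I_im,
        Complex.I_re, mul_one, mul_zero, add_zero, zero_add] at this
      rw [Set.uIcc_of_le (by linarith)] at this
      exact this.2))
  simp only [Complex.add_im, Complex.ofReal_im, Complex.mul_im, Complex.ofReal_re, Complex.I_im,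
    Complex.I_re, mul_one, mul_zero, add_zero, zero_add, Complex.add_re, Complex.mul_re, sub_zero,
    Complex.ofReal_zero, zero_mul] at hrect
  have hmain : (∫ t in (x₀ - δ)..(x₀ + δ), Q.eval ((t : ℂ) - x₀) * cauchyKernel β z t) =
      ∫ t : ℝ in (x₀ - δ)..(x₀ + δ), f t := rfl
  have hside : ∀ u v : ℝ, |u| ≤ δ → |v| ≤ δ → (|u| = δ ∨ |v| = δ) →
      ‖f (((x₀ + u : ℝ) : ℂ) + (v : ℂ) * Complex.I)‖ ≤ E := by
    intro u v hu hv huv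
    have he : ((x₀ + u : ℝ) : ℂ) + (v : ℂ) * Complex.I - x₀ = u + v * Complex.I := by push_cast; ring
    refine hfb _ ?_ ?_
    · rw [he]
      calc _ ≤ ‖(u : ℂ)‖ + ‖(v * Complex.I : ℂ)‖ := norm_add_le _ _
        _ = |u| + |v| := by simp
        _ ≤ _ := by linarith
    · rw [he]
      rcases huv with h | h
      · have := Complex.abs_re_le_norm ((u : ℂ) + v * Complex.I)
        simp at this
        linarith
      · have := Complex.abs_im_le_norm ((u : ℂ) + v * Complex.I)
        simp at this
        linarith
  have hδa := abs_of_pos hδ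
  have h1 : ‖∫ x in (x₀ - δ)..(x₀ + δ), f ((x : ℂ) + ((-δ : ℝ) : ℂ) * Complex.I)‖ ≤ E * |2 * δ| := by
    refine (intervalIntegral.norm_integral_le_of_norm_le_const (C := E) fun x hx => ?_).trans
      (le_of_eq (by congr 2; ring))
    rw [Set.uIoc_of_le (by linarith)] at hx
    have := hside (x - x₀) (-δ) (abs_le.2 ⟨by linarith [hx.1], by linarith [hx.2]⟩)
      (by rw [abs_neg, hδa]) (Or.inr (by rw [abs_neg, hδa]))
    rwa [add_sub_cancel] at this
  have h2 : ‖∫ y in (-δ)..0, f (((x₀ + δ : ℝ) : ℂ) + (y : ℂ) * Complex.I)‖ ≤ E * |δ| := by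
    refine (intervalIntegral.norm_integral_le_of_norm_le_const (C := E) fun x hx => ?_).trans
      (le_of_eq (by congr 2; ring))
    rw [Set.uIoc_of_le (by linarith)] at hx
    exact hside δ x hδa.le (abs_le.2 ⟨by linarith [hx.1], by linarith [hx.2]⟩) (Or.inl hδa)
  have h3 : ‖∫ y in (-δ)..0, f (((x₀ - δ : ℝ) : ℂ) + (y : ℂ) * Complex.I)‖ ≤ E * |δ| := by
    refine (intervalIntegral.norm_integral_le_of_norm_le_const (C := E) fun x hx => ?_).trans
      (le_of_eq (by congr 2; ring))
    rw [Set.uIoc_of_le (by linarith)] at hx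
    have := hside (-δ) x (by rw [abs_neg, hδa]) (abs_le.2 ⟨by linarith [hx.1], by linarith [hx.2]⟩)
      (Or.inl (by rw [abs_neg, hδa]))
    rwa [← sub_eq_add_neg] at this
  rw [hmain]
  have hsolve : ∫ t : ℝ in (x₀ - δ)..(x₀ + δ), f t =
      (∫ x in (x₀ - δ)..(x₀ + δ), f ((x : ℂ) + ((-δ : ℝ) : ℂ) * Complex.I)) +
        Complex.I • (∫ y in (-δ)..0, f (((x₀ + δ : ℝ) : ℂ) + (y : ℂ) * Complex.I)) -
        Complex.I • (∫ y in (-δ)..0, f (((x₀ - δ : ℝ) : ℂ) + (y : ℂ) * Complex.I)) := by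
    linear_combination (-1 : ℂ) * hrect
  rw [hsolve]
  refine (norm_sub_le _ _).trans (add_le_add ((norm_add_le _ _).trans (add_le_add h1 ?_)) ?_)
  · rwa [norm_smul, Complex.norm_I, one_mul]
  · rwa [norm_smul, Complex.norm_I, one_mul]

/-- Near `x₀`, the transform of `g` is controlled by the transform of its `k`-th derivative. -/
theorem exists_local_representation {α : ℝ} {g : ℝ → ℂ} (hg : Continuous g) {Mg : ℝ}
    (hM : ∀ t, ‖g t‖ ≤ Mg) {k : ℕ} (hk : (k : ℝ) < α) :
    ∃ c : ℝ, 0 < c ∧ ∀ (U : Set ℝ) (x₀ δ : ℝ), IsOpen U → ContDiffOn ℝ k g U → 0 < δ →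
      Set.Icc (x₀ - δ) (x₀ + δ) ⊆ U → ∃ C : ℝ, ∀ z : ℂ, 0 < z.im → ‖z - x₀‖ ≤ δ / 2 →
        ‖∫ t : ℝ, g t * cauchyKernel α z t‖ ≤ C + c *
          ‖∫ t in (x₀ - δ)..(x₀ + δ), iteratedDeriv k g t * cauchyKernel (α - k) z t‖ := by
  induction k with
  | zero =>
    refine ⟨1, one_pos, fun U x₀ δ _ _ hδ _ => ?_⟩
    obtain ⟨C, hC⟩ := exists_tail_bound (by simpa using hk) hg hM x₀ hδ
    refine ⟨C, fun z hz hzx => ?_⟩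
    have := hC z hz hzx
    simp only [iteratedDeriv_zero, Nat.cast_zero, sub_zero, one_mul]
    have h2 := norm_sub_norm_le (∫ t : ℝ, g t * cauchyKernel α z t)
      (∫ t in (x₀ - δ)..(x₀ + δ), g t * cauchyKernel α z t)
    linarith
  | succ k ih =>
    obtain ⟨c, hc, h⟩ := ih (by push_cast at hk; linarith)
    have hαk : 0 < α - k := by push_cast at hk; linarith
    -- The constant c is a product of the factors (α-j)⁻¹. It is fixed before the neighbourhood, so
    -- that a smallness parameter may depend on it.
    refine ⟨c * (α - k)⁻¹, by positivity, fun U x₀ δ hU hgU hδ hsub => ?_⟩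
    obtain ⟨C, hC⟩ := h U x₀ δ hU (hgU.of_le (by exact_mod_cast Nat.le_succ k)) hδ hsub
    obtain ⟨C', hC'⟩ := exists_integration_by_parts_bound hαk (G := iteratedDeriv k g)
      (G' := iteratedDeriv (k + 1) g) hδ
      (fun t ht => hasDerivAt_iteratedDeriv_of_contDiffOn hU hgU (Nat.lt_succ_self k) (hsub ht))
      ((continuousOn_iteratedDeriv_of_contDiffOn hU hgU le_rfl).mono hsub)
    refine ⟨C + c * C', fun z hz hzx => ?_⟩
    have h1 := hC z hz hzx
    have h2 := hC' z hz hzx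
    have h3 := (norm_sub_norm_le _ _).trans h2
    rw [norm_mul, norm_inv, norm_mul, Complex.norm_I, one_mul, Complex.norm_real,
      Real.norm_of_nonneg hαk.le] at h3
    rw [show α - (k + 1 : ℕ) = α - k - 1 by push_cast; ring]
    calc _ ≤ C + c * (C' + (α - k)⁻¹ * ‖∫ t in (x₀ - δ)..(x₀ + δ),
        iteratedDeriv (k + 1) g t * cauchyKernel (α - k - 1) z t‖) := by
          refine h1.trans ?_
          gcongr
          linarith
      _ = _ := by ring

theorem add_rpow_le_two_rpow_mul {a b s : ℝ} (ha : 0 ≤ a) (hb : 0 ≤ b) (hs : 0 ≤ s) :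
    (a + b) ^ s ≤ 2 ^ s * (a ^ s + b ^ s) := by
  have h1 : (a + b) ^ s ≤ (2 * max a b) ^ s :=
    Real.rpow_le_rpow (by positivity) (by linarith [le_max_left a b, le_max_right a b]) hs
  rw [Real.mul_rpow (by norm_num) (le_max_of_le_left ha)] at h1
  refine h1.trans ?_
  gcongr
  have := Real.rpow_nonneg ha s
  have := Real.rpow_nonneg hb s
  rcases max_choice a b with h | h <;> rw [h] <;> linarith

/-- Bound for the transform of a function that is small near `x₀`. -/
theorem exists_weighted_kernel_bound {β s s' : ℝ} (hβ : 0 < β) (hs : 0 ≤ s) (hs's : s' ≤ s)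
    (hs'β : s' < β) :
    ∃ K : ℝ, 0 < K ∧ ∀ (x₀ δ ε : ℝ) (G : ℝ → ℂ), 0 < δ → δ ≤ 1 / 2 → 0 ≤ ε →
      (∀ t ∈ Set.Icc (x₀ - δ) (x₀ + δ), ‖G t‖ ≤ ε * |t - x₀| ^ s) →
      ∀ z : ℂ, 0 < z.im → ‖z - x₀‖ ≤ δ / 2 →
        ‖∫ t in (x₀ - δ)..(x₀ + δ), G t * cauchyKernel β z t‖ ≤
          ε * (K * (z.im ^ (s' - β) + ‖z - x₀‖ ^ s * z.im ^ (-β))) := by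
  -- The weight |t-x₀|^s is split into |t-z|^{s'} + |z-x₀|^s up to a constant. The first part lowers
  -- the order of the kernel to β-s', which must be positive. As s may exceed β, it is replaced by
  -- s', at no cost since |t-z| ≤ 1.
  obtain ⟨K₁, hK₁0, hK₁⟩ := exists_integral_norm_sub_rpow_le (β := β - s') (by linarith)
  obtain ⟨K₂, hK₂0, hK₂⟩ := exists_integral_norm_sub_rpow_le hβ
  refine ⟨2 ^ s * (K₁ + K₂ + 1), by positivity, fun x₀ δ ε G hδ hδ2 hε hG z hz hzx => ?_⟩
  have hi1 := hK₁ z hz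
  have hi2 := hK₂ z hz
  have hbi : Integrable (fun t : ℝ => ε * (2 ^ s * (‖(t : ℂ) - z‖ ^ (-(β - s' + 1)) +
      ‖z - x₀‖ ^ s * ‖(t : ℂ) - z‖ ^ (-(β + 1))))) :=
    ((hi1.1.add (hi2.1.const_mul _)).const_mul _).const_mul _
  rw [intervalIntegral.integral_of_le (by linarith)]
  refine (norm_integral_le_of_norm_le hbi.integrableOn
    ((ae_restrict_iff' measurableSet_Ioc).2 (Eventually.of_forall fun t ht => ?_))).trans
    ((setIntegral_le_integral hbi (Eventually.of_forall fun t => by positivity)).trans ?_)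
  · have ht' : t ∈ Set.Icc (x₀ - δ) (x₀ + δ) := Set.Ioc_subset_Icc_self ht
    rw [norm_mul, norm_cauchyKernel]
    have h0 : 0 < ‖(t : ℂ) - z‖ := by
      rw [norm_pos_iff, sub_ne_zero]
      rintro h
      rw [← h] at hz
      simp at hz
    have hnt : ‖(t : ℂ) - x₀‖ = |t - x₀| := by
      rw [← Complex.ofReal_sub, Complex.norm_real, Real.norm_eq_abs]
    have htx : |t - x₀| ≤ δ := abs_le.2 ⟨by linarith [ht'.1], by linarith [ht'.2]⟩
    have h1 : |t - x₀| ≤ ‖(t : ℂ) - z‖ + ‖z - x₀‖ := by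
      rw [← hnt]
      calc ‖(t : ℂ) - x₀‖ = ‖((t : ℂ) - z) + (z - x₀)‖ := by rw [sub_add_sub_cancel]
        _ ≤ _ := norm_add_le _ _
    have h2 : ‖(t : ℂ) - z‖ ≤ 1 := by
      calc ‖(t : ℂ) - z‖ = ‖((t : ℂ) - x₀) - (z - x₀)‖ := by rw [sub_sub_sub_cancel_right]
        _ ≤ ‖(t : ℂ) - x₀‖ + ‖z - x₀‖ := norm_sub_le _ _
        _ ≤ 1 := by rw [hnt]; linarith
    have h3 : |t - x₀| ^ s ≤ 2 ^ s * (‖(t : ℂ) - z‖ ^ s' + ‖z - x₀‖ ^ s) :=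
      (Real.rpow_le_rpow (abs_nonneg _) h1 hs).trans
        ((add_rpow_le_two_rpow_mul h0.le (norm_nonneg _) hs).trans (by
          gcongr ?_ * (?_ + _)
          exact Real.rpow_le_rpow_of_exponent_ge h0 h2 hs's))
    calc _ ≤ ε * (2 ^ s * (‖(t : ℂ) - z‖ ^ s' + ‖z - x₀‖ ^ s)) * ‖(t : ℂ) - z‖ ^ (-(β + 1)) := by
          gcongr
          exact (hG t ht').trans (by gcongr)
      _ = _ := by
          rw [show -(β - s' + 1) = s' + -(β + 1) by ring, Real.rpow_add h0]
          ring
  · rw [integral_const_mul, integral_const_mul, integral_add hi1.1 (hi2.1.const_mul _),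
      integral_const_mul]
    have e1 := hi1.2
    rw [show -(β - s') = s' - β by ring] at e1
    gcongr ε * ?_
    rw [mul_assoc]
    gcongr 2 ^ s * ?_
    have p1 : 0 ≤ z.im ^ (s' - β) := by positivity
    have p2 : 0 ≤ ‖z - x₀‖ ^ s * z.im ^ (-β) := by positivity
    have e2 : ‖z - x₀‖ ^ s * ∫ t : ℝ, ‖(t : ℂ) - z‖ ^ (-(β + 1)) ≤
        ‖z - x₀‖ ^ s * (K₂ * z.im ^ (-β)) := by
      gcongr
      exact hi2.2
    nlinarith

/-- Pointwise smallness of `g^(k) - Q` at `x₀` limits the growth of the transform near `x₀`. -/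
theorem exists_pointwise_growth_bound {α : ℝ} {g : ℝ → ℂ} (hg : Continuous g) {Mg : ℝ}
    (hM : ∀ t, ‖g t‖ ≤ Mg) {k : ℕ} (hk : (k : ℝ) < α) {x₀ : ℝ} {U : Set ℝ} (hU : U ∈ 𝓝 x₀)
    (hUo : IsOpen U) (hgU : ContDiffOn ℝ k g U) (Q : Polynomial ℂ) {s s' : ℝ} (hs : 0 ≤ s)
    (hs's : s' ≤ s) (hs'k : s' < α - k)
    (ho : (fun t : ℝ => iteratedDeriv k g t - Q.eval ((t : ℂ) - x₀)) =o[𝓝 x₀]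
      fun t => |t - x₀| ^ s) {ε : ℝ} (hε : 0 < ε) :
    ∃ C η : ℝ, 0 < η ∧ ∀ z : ℂ, 0 < z.im → ‖z - x₀‖ ≤ η →
      ‖∫ t : ℝ, g t * cauchyKernel α z t‖ ≤
        C + ε * (z.im ^ (s' - (α - k)) + ‖z - x₀‖ ^ s * z.im ^ (-(α - k))) := by
  have hβ : 0 < α - k := by linarith
  obtain ⟨c, hc, hrep⟩ := exists_local_representation hg hM hk
  obtain ⟨K, hK, hw⟩ := exists_weighted_kernel_bound hβ hs hs's hs'k
  -- The smallness of the remainder is chosen to compensate the factors c of the representation and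
  -- K of the weighted estimate.
  have hε' : 0 < ε / (c * K) := by positivity
  have hev := (ho.def hε').and hU
  obtain ⟨d, hd, hball⟩ := Metric.eventually_nhds_iff_ball.1 hev
  set δ := min (d / 2) (1 / 2) with hδdef
  have hδ : 0 < δ := by positivity
  have hδd : δ < d := (min_le_left _ _).trans_lt (by linarith)
  have hIcc : ∀ t ∈ Set.Icc (x₀ - δ) (x₀ + δ), t ∈ Metric.ball x₀ d := by
    intro t ht
    rw [Metric.mem_ball, Real.dist_eq, abs_lt]
    constructor <;> linarith [ht.1, ht.2]
  have hsub : Set.Icc (x₀ - δ) (x₀ + δ) ⊆ U := fun t ht => (hball t (hIcc t ht)).2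
  obtain ⟨C, hC⟩ := hrep U x₀ δ hUo hgU hδ hsub
  obtain ⟨C', hC'⟩ := exists_polynomial_kernel_bound hβ Q x₀ hδ
  refine ⟨C + c * C', δ / 2, by positivity, fun z hz hzx => ?_⟩
  have h1 := hC z hz hzx
  have h2 := hC' z hz hzx
  have h3 := hw x₀ δ (ε / (c * K)) (fun t => iteratedDeriv k g t - Q.eval ((t : ℂ) - x₀)) hδ
    (min_le_right _ _) hε'.le (fun t ht => by
      have := (hball t (hIcc t ht)).1
      rwa [Real.norm_of_nonneg (by positivity)] at this) z hz hzx
  have hcont : ContinuousOn (iteratedDeriv k g) (Set.uIcc (x₀ - δ) (x₀ + δ)) := by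
    rw [Set.uIcc_of_le (by linarith)]
    exact (continuousOn_iteratedDeriv_of_contDiffOn hUo hgU le_rfl).mono hsub
  have hsplit : ∫ t in (x₀ - δ)..(x₀ + δ), iteratedDeriv k g t * cauchyKernel (α - k) z t =
      (∫ t in (x₀ - δ)..(x₀ + δ), (iteratedDeriv k g t - Q.eval ((t : ℂ) - x₀)) *
        cauchyKernel (α - k) z t) +
      ∫ t in (x₀ - δ)..(x₀ + δ), Q.eval ((t : ℂ) - x₀) * cauchyKernel (α - k) z t := by
    have hQ : Continuous fun t : ℝ => Q.eval ((t : ℂ) - x₀) := by fun_prop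
    rw [← intervalIntegral.integral_add]
    · congr 1
      ext t
      ring
    · exact ((hcont.sub hQ.continuousOn).mul
        (continuous_cauchyKernel _ hz).continuousOn).intervalIntegrable
    · exact (hQ.mul (continuous_cauchyKernel _ hz)).intervalIntegrable _ _
  rw [hsplit] at h1
  calc _ ≤ C + c * (ε / (c * K) * (K * (z.im ^ (s' - (α - k)) + ‖z - x₀‖ ^ s * z.im ^ (-(α - k))))
        + C') := by
        refine h1.trans ?_
        gcongr
        exact (norm_add_le _ _).trans (add_le_add h3 h2)
    _ = _ := by
        field_simp
        ring

/-- A local uniform Hölder condition on `g^(k)` limits the growth of the transform. -/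
theorem exists_uniform_growth_bound {α : ℝ} {g : ℝ → ℂ} (hg : Continuous g) {Mg : ℝ}
    (hM : ∀ t, ‖g t‖ ≤ Mg) {k : ℕ} (hk : (k : ℝ) < α) {x₀ d : ℝ} (hd : 0 < d) {U : Set ℝ}
    (hUd : Set.Icc (x₀ - d) (x₀ + d) ⊆ U)
    (hUo : IsOpen U) (hgU : ContDiffOn ℝ k g U) {s s' L : ℝ} (hs : 0 ≤ s)
    (hs's : s' ≤ s) (hs'k : s' < α - k) (hL0 : 0 ≤ L)
    (hL : ∀ t ∈ Set.Icc (x₀ - d) (x₀ + d), ∀ x ∈ Set.Icc (x₀ - d) (x₀ + d),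
      ‖iteratedDeriv k g t - iteratedDeriv k g x‖ ≤ L * |t - x| ^ s) :
    ∃ C K η : ℝ, 0 < η ∧ ∀ z : ℂ, 0 < z.im → ‖z - x₀‖ ≤ η →
      ‖∫ t : ℝ, g t * cauchyKernel α z t‖ ≤ C + K * z.im ^ (s' - (α - k)) := by
  have hβ : 0 < α - k := by linarith
  obtain ⟨c, hc, hrep⟩ := exists_local_representation hg hM hk
  obtain ⟨K, hK, hw⟩ := exists_weighted_kernel_bound hβ hs hs's hs'k
  set δ := min d (1 / 4) with hδdef
  have hδ : 0 < δ := by positivity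
  have hδd : δ ≤ d := min_le_left _ _
  have hδ4 : δ ≤ 1 / 4 := min_le_right _ _
  have hIcc : Set.Icc (x₀ - δ) (x₀ + δ) ⊆ Set.Icc (x₀ - d) (x₀ + d) :=
    Set.Icc_subset_Icc (by linarith) (by linarith)
  obtain ⟨C, hC⟩ := hrep U x₀ δ hUo hgU hδ (hIcc.trans hUd)
  obtain ⟨C', hC'⟩ := exists_polynomial_kernel_bound hβ 1 x₀ hδ
  have hcont : ContinuousOn (iteratedDeriv k g) (Set.Icc (x₀ - δ) (x₀ + δ)) :=
    (continuousOn_iteratedDeriv_of_contDiffOn hUo hgU le_rfl).mono (hIcc.trans hUd)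
  obtain ⟨B, hB⟩ := isCompact_Icc.exists_bound_of_continuousOn hcont
  refine ⟨C + c * (B * C'), c * (L * (K * 2)), δ / 2, by positivity, fun z hz hzx => ?_⟩
  have h1 := hC z hz hzx
  have h2 := hC' z hz hzx
  simp only [Polynomial.eval_one, one_mul] at h2
  have hre : |z.re - x₀| ≤ δ / 2 := by
    have := Complex.abs_re_le_norm (z - x₀)
    simp only [Complex.sub_re, Complex.ofReal_re] at this
    linarith
  have him : z.im ≤ δ / 2 := by
    have := Complex.abs_im_le_norm (z - x₀)
    simp only [Complex.sub_im, Complex.ofReal_im, sub_zero] at this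
    exact (le_abs_self _).trans (this.trans hzx)
  have hzr : ‖z - (z.re : ℂ)‖ = z.im := by
    have : z - (z.re : ℂ) = z.im * Complex.I := by
      apply Complex.ext <;> simp
    rw [this, norm_mul, Complex.norm_I, mul_one, Complex.norm_real, Real.norm_of_nonneg hz.le]
  rw [abs_le] at hre
  have hxmem : z.re ∈ Set.Icc (x₀ - δ) (x₀ + δ) := ⟨by linarith [hre.1], by linarith [hre.2]⟩
  set w : ℂ := iteratedDeriv k g z.re with hwdef
  -- The weighted estimate is recentred at Re z, where |z - Re z| = Im z turns it into a pure power
  -- of Im z. The cut-off lets the interval around Re z contain the original one without changing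
  -- the integral. The subtracted value w costs only a bounded term.
  set G : ℝ → ℂ := (Set.Ioc (x₀ - δ) (x₀ + δ)).indicator fun t => iteratedDeriv k g t - w with hG
  have h3 := hw z.re (2 * δ) L G (by positivity) (by linarith) hL0 (fun t _ => by
      by_cases ht : t ∈ Set.Ioc (x₀ - δ) (x₀ + δ)
      · rw [hG, Set.indicator_of_mem ht]
        exact hL t (hIcc (Set.Ioc_subset_Icc_self ht)) z.re (hIcc hxmem)
      · rw [hG, Set.indicator_of_notMem ht, norm_zero]
        positivity) z hz (by rw [hzr]; linarith)
  have hGint : ∫ t in (z.re - 2 * δ)..(z.re + 2 * δ), G t * cauchyKernel (α - k) z t =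
      ∫ t in (x₀ - δ)..(x₀ + δ), (iteratedDeriv k g t - w) * cauchyKernel (α - k) z t := by
    rw [intervalIntegral.integral_of_le (by linarith), intervalIntegral.integral_of_le (by linarith)]
    have : (fun t => G t * cauchyKernel (α - k) z t) = (Set.Ioc (x₀ - δ) (x₀ + δ)).indicator
        fun t => (iteratedDeriv k g t - w) * cauchyKernel (α - k) z t := by
      ext t
      simp only [hG, Set.indicator]
      split_ifs <;> simp
    rw [this, setIntegral_indicator measurableSet_Ioc, Set.inter_eq_self_of_subset_right]
    exact Set.Ioc_subset_Ioc (by linarith) (by linarith)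
  rw [hGint, hzr, ← Real.rpow_add hz] at h3
  have hsplit : ∫ t in (x₀ - δ)..(x₀ + δ), iteratedDeriv k g t * cauchyKernel (α - k) z t =
      (∫ t in (x₀ - δ)..(x₀ + δ), (iteratedDeriv k g t - w) * cauchyKernel (α - k) z t) +
      w * ∫ t in (x₀ - δ)..(x₀ + δ), cauchyKernel (α - k) z t := by
    rw [← intervalIntegral.integral_const_mul, ← intervalIntegral.integral_add]
    · congr 1
      ext t
      ring
    · refine ContinuousOn.intervalIntegrable ?_
      rw [Set.uIcc_of_le (by linarith)]
      exact (hcont.sub continuousOn_const).mul (continuous_cauchyKernel _ hz).continuousOn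
    · exact (continuous_const.mul (continuous_cauchyKernel _ hz)).intervalIntegrable _ _
  have hpow : z.im ^ (s + -(α - k)) ≤ z.im ^ (s' - (α - k)) :=
    Real.rpow_le_rpow_of_exponent_ge hz (by linarith) (by linarith)
  have hC'0 : 0 ≤ C' := (norm_nonneg _).trans h2
  calc _ ≤ C + c * (L * (K * (z.im ^ (s' - (α - k)) + z.im ^ (s' - (α - k)))) + B * C') := by
        refine h1.trans ?_
        rw [hsplit]
        gcongr
        refine (norm_add_le _ _).trans (add_le_add (h3.trans (by gcongr)) ?_)
        rw [norm_mul]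
        exact mul_le_mul (hB _ hxmem) h2 (norm_nonneg _) ((norm_nonneg _).trans (hB _ hxmem))
    _ = _ := by ring

/-! ### Exponential series and the reproducing property -/

/-- `F` is the sum of an exponential series `∑ bₙ e^{i lₙ z}` with positive frequencies. -/
structure HasExpSeries (F : ℂ → ℂ) (b : ℕ → ℂ) (l : ℕ → ℝ) : Prop where
  hasSum : ∀ z : ℂ, 0 < z.im → HasSum (fun n => b n * Complex.exp (Complex.I * l n * z)) (F z)
  lower : ∃ l₀ : ℝ, 0 < l₀ ∧ ∀ n, b n ≠ 0 → l₀ ≤ l n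

theorem HasExpSeries.pos {F : ℂ → ℂ} {b : ℕ → ℂ} {l : ℕ → ℝ} (h : HasExpSeries F b l) (n : ℕ)
    (hn : b n ≠ 0) : 0 < l n := by
  obtain ⟨l₀, h0, hl⟩ := h.lower
  exact h0.trans_le (hl n hn)

/-- The coefficients of the fractional integral. -/
noncomputable def rayCoeff (α : ℝ) (b : ℕ → ℂ) (l : ℕ → ℝ) (n : ℕ) : ℂ :=
  ((Real.Gamma α * l n ^ (-α) : ℝ) : ℂ) * b n

/-- This Gamma integral is what makes integration along the ray divide the coefficient of frequency
l by l^α. -/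
theorem integral_rpow_mul_cexp_frequency {α l : ℝ} (hα : 0 < α) (hl : 0 < l) (w : ℂ) :
    IntegrableOn (fun t : ℝ => ((t ^ (α - 1) : ℝ) : ℂ) *
      Complex.exp (Complex.I * l * (w + Complex.I * t))) (Set.Ioi 0) ∧
    ∫ t in Set.Ioi (0 : ℝ), ((t ^ (α - 1) : ℝ) : ℂ) * Complex.exp (Complex.I * l * (w + Complex.I * t))
      = ((Real.Gamma α * l ^ (-α) : ℝ) : ℂ) * Complex.exp (Complex.I * l * w) := by
  have h := integral_rpow_mul_cexp_neg hα (r := (l : ℂ)) (by simpa using hl)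
  have he : ∀ t : ℝ, ((t ^ (α - 1) : ℝ) : ℂ) * Complex.exp (Complex.I * l * (w + Complex.I * t)) =
      Complex.exp (Complex.I * l * w) * (((t ^ (α - 1) : ℝ) : ℂ) * Complex.exp (-((l : ℂ) * t))) := by
    intro t
    rw [show Complex.I * l * (w + Complex.I * t) = Complex.I * l * w + -((l : ℂ) * t) by
      linear_combination (l : ℂ) * t * Complex.I_mul_I, Complex.exp_add]
    ring
  simp_rw [he]
  refine ⟨h.1.const_mul _, ?_⟩
  rw [integral_const_mul, h.2, ← Complex.ofReal_cpow hl.le]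
  push_cast
  ring

theorem norm_exp_I_mul (l : ℝ) (z : ℂ) : ‖Complex.exp (Complex.I * l * z)‖ = Real.exp (-(l * z.im)) := by
  rw [Complex.norm_exp]
  congr 1
  simp

/-- On the line `Im z = ε` the fractional integral is given by an absolutely convergent series. -/
theorem HasExpSeries.hasSum_rayIntegral {F : ℂ → ℂ} {b : ℕ → ℂ} {l : ℕ → ℝ} (h : HasExpSeries F b l)
    {α : ℝ} (hα : 0 < α) {ε : ℝ} (hε : 0 < ε) :
    Summable (fun n => ‖rayCoeff α b l n‖ * Real.exp (-(l n * ε))) ∧ ∀ x : ℝ,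
    HasSum (fun n => rayCoeff α b l n * Real.exp (-(l n * ε)) * Complex.exp (Complex.I * l n * x))
      (rayIntegral α (fun z => F (z + Complex.I * ε)) x) := by
  have hG : 0 < Real.Gamma α := Real.Gamma_pos_of_pos hα
  have hterm : ∀ (n : ℕ) (w : ℂ), IntegrableOn (fun t : ℝ => b n * (((t ^ (α - 1) : ℝ) : ℂ) *
      Complex.exp (Complex.I * l n * (w + Complex.I * t)))) (Set.Ioi 0) ∧
      ∫ t in Set.Ioi (0 : ℝ), b n * (((t ^ (α - 1) : ℝ) : ℂ) *
        Complex.exp (Complex.I * l n * (w + Complex.I * t))) =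
        rayCoeff α b l n * Complex.exp (Complex.I * l n * w) := by
    intro n w
    by_cases hb : b n = 0
    · simp [hb, rayCoeff]
    · have h1 := integral_rpow_mul_cexp_frequency hα (h.pos n hb) w
      refine ⟨h1.1.const_mul _, ?_⟩
      rw [integral_const_mul, h1.2, rayCoeff]
      ring
  -- the terms on the imaginary axis have the largest absolute value
  have hnorm : ∀ (n : ℕ) (x : ℝ), ∫ t in Set.Ioi (0 : ℝ), ‖b n * (((t ^ (α - 1) : ℝ) : ℂ) *
      Complex.exp (Complex.I * l n * (((x : ℂ) + Complex.I * ε) + Complex.I * t)))‖ =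
      ‖rayCoeff α b l n‖ * Real.exp (-(l n * ε)) := by
    intro n x
    by_cases hb : b n = 0
    · simp [hb, rayCoeff]
    have hl := h.pos n hb
    have h2 := (integral_rpow_mul_cexp_frequency hα hl (Complex.I * ε)).2
    have h3 : ∀ t ∈ Set.Ioi (0 : ℝ), ‖b n * (((t ^ (α - 1) : ℝ) : ℂ) *
        Complex.exp (Complex.I * l n * (((x : ℂ) + Complex.I * ε) + Complex.I * t)))‖ =
        ‖b n‖ * (t ^ (α - 1) * Real.exp (-(l n * (ε + t)))) := by
      intro t ht
      have ht0 : 0 < t := ht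
      rw [norm_mul, norm_mul, norm_exp_I_mul, Complex.norm_real, Real.norm_of_nonneg (by positivity)]
      congr 4
      simp
    rw [setIntegral_congr_fun measurableSet_Ioi h3, integral_const_mul, rayCoeff, norm_mul,
      Complex.norm_real, Real.norm_of_nonneg (by positivity)]
    have h4 : ((∫ t in Set.Ioi (0 : ℝ), t ^ (α - 1) * Real.exp (-(l n * (ε + t))) : ℝ) : ℂ) =
        ((Real.Gamma α * l n ^ (-α) * Real.exp (-(l n * ε)) : ℝ) : ℂ) := by
      rw [← integral_complex_ofReal]
      calc _ = ∫ t in Set.Ioi (0 : ℝ), ((t ^ (α - 1) : ℝ) : ℂ) *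
            Complex.exp (Complex.I * l n * (Complex.I * ε + Complex.I * t)) := by
            refine integral_congr_ae (Eventually.of_forall fun t => ?_)
            simp only
            push_cast
            congr 2
            linear_combination (-(l n : ℂ) * (ε + t)) * Complex.I_mul_I
        _ = _ := by
            rw [h2]
            push_cast
            congr 2
            linear_combination ((l n : ℂ) * ε) * Complex.I_mul_I
    have h5 := Complex.ofReal_injective h4
    rw [h5]
    ring
  have hsum0 : Summable fun n => ‖b n‖ * Real.exp (-(l n * ε)) := by
    have := (h.hasSum (Complex.I * ε) (by simpa using hε)).summable.norm
    refine this.congr fun n => ?_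
    rw [norm_mul, norm_exp_I_mul]
    congr 3
    simp
  have hsum : Summable fun n => ‖rayCoeff α b l n‖ * Real.exp (-(l n * ε)) := by
    obtain ⟨l₀, hl0, hl⟩ := h.lower
    refine Summable.of_nonneg_of_le (fun n => by positivity) (fun n => ?_)
      (hsum0.mul_left (Real.Gamma α * l₀ ^ (-α)))
    by_cases hb : b n = 0
    · simp [hb, rayCoeff]
    have hln := h.pos n hb
    have : l n ^ (-α) ≤ l₀ ^ (-α) := Real.rpow_le_rpow_of_nonpos hl0 (hl n hb) (by linarith)
    rw [rayCoeff, norm_mul, Complex.norm_real, Real.norm_of_nonneg (by positivity), mul_assoc]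
    gcongr
  refine ⟨hsum, fun x => ?_⟩
  have key := hasSum_integral_of_summable_integral_norm (μ := volume.restrict (Set.Ioi (0 : ℝ)))
    (F := fun (n : ℕ) (t : ℝ) => b n * (((t ^ (α - 1) : ℝ) : ℂ) *
      Complex.exp (Complex.I * l n * (((x : ℂ) + Complex.I * ε) + Complex.I * t))))
    (fun n => (hterm n _).1) (by simpa only [hnorm] using hsum)
  have hval : rayIntegral α (fun z => F (z + Complex.I * ε)) x =
      ∫ t in Set.Ioi (0 : ℝ), ∑' n, b n * (((t ^ (α - 1) : ℝ) : ℂ) *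
        Complex.exp (Complex.I * l n * (((x : ℂ) + Complex.I * ε) + Complex.I * t))) := by
    refine setIntegral_congr_fun measurableSet_Ioi fun t ht => ?_
    have ht0 : 0 < t := ht
    have h1 := (h.hasSum ((x : ℂ) + Complex.I * ε + Complex.I * t)
      (by simp; linarith)).mul_left ((t ^ (α - 1) : ℝ) : ℂ)
    simp only
    rw [add_right_comm, ← h1.tsum_eq]
    refine tsum_congr fun n => ?_
    ring
  rw [hval]
  have hval' : ∀ n, ∫ t in Set.Ioi (0 : ℝ), b n * (((t ^ (α - 1) : ℝ) : ℂ) *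
      Complex.exp (Complex.I * l n * (((x : ℂ) + Complex.I * ε) + Complex.I * t))) =
      rayCoeff α b l n * Real.exp (-(l n * ε)) * Complex.exp (Complex.I * l n * x) := by
    intro n
    rw [(hterm n _).2, mul_assoc (rayCoeff α b l n), Complex.ofReal_exp, ← Complex.exp_add]
    congr 2
    push_cast
    linear_combination ((l n : ℂ) * ε) * Complex.I_mul_I
  simpa only [hval'] using key

/-- Integrals of the fractional integral against an integrable weight as a limit of series. -/
theorem HasExpSeries.tendsto_tsum_weight {F : ℂ → ℂ} {b : ℕ → ℂ} {l : ℕ → ℝ}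
    (h : HasExpSeries F b l) (hF : ContinuousOn F {z : ℂ | 0 < z.im}) {ρ α : ℝ}
    (hdec : VerticalDecay F ρ) (h0 : 0 ≤ ρ) (hρ : ρ < α) {w : ℝ → ℂ} (hw : Integrable w) :
    Tendsto (fun ε : ℝ => ∑' n, rayCoeff α b l n * Real.exp (-(l n * ε)) *
      ∫ t : ℝ, Complex.exp (Complex.I * l n * t) * w t) (𝓝[>] 0)
      (𝓝 (∫ t : ℝ, rayIntegral α F t * w t)) := by
  have hα : 0 < α := by linarith
  -- On the real line itself the series may fail to converge absolutely, so it is damped by raising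
  -- the ray by ε. For ε > 0 sum and integral can be exchanged. The same majorant B holds for every
  -- ε and justifies both limits ε → 0, in the ray integral and in the weighted one.
  obtain ⟨B, hB, hbd⟩ := hdec.exists_bound h0 hρ
  have hunif : ∀ ε : ℝ, 0 < ε → ∀ t : ℝ, ‖rayIntegral α (fun z => F (z + Complex.I * ε)) t‖ ≤
      ∫ t in Set.Ioi 0, B t := by
    intro ε hε t
    refine norm_integral_le_of_norm_le hB ?_
    refine (ae_restrict_iff' measurableSet_Ioi).2 (Eventually.of_forall fun s hs => ?_)
    exact hbd s hs _ (by simp; linarith)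
  have hlim : ∀ t : ℝ, Tendsto (fun ε : ℝ => rayIntegral α (fun z => F (z + Complex.I * ε)) t) (𝓝[>] 0)
      (𝓝 (rayIntegral α F t)) := by
    intro t
    refine tendsto_integral_filter_of_dominated_convergence B ?_ ?_ hB ?_
    · filter_upwards [self_mem_nhdsWithin] with ε hε
      have hc := continuousOn_ray hF α t ε (le_of_lt hε)
      refine ContinuousOn.aestronglyMeasurable ?_ measurableSet_Ioi
      refine hc.congr fun s _ => ?_
      simp only
      rw [add_right_comm]
    · filter_upwards [self_mem_nhdsWithin] with ε hε
      have hε0 : 0 < ε := hε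
      refine (ae_restrict_iff' measurableSet_Ioi).2 (Eventually.of_forall fun s hs => ?_)
      exact hbd s hs _ (by simp; linarith)
    · refine (ae_restrict_iff' measurableSet_Ioi).2 (Eventually.of_forall fun s hs => ?_)
      refine Tendsto.const_mul _ ?_
      have hs0 : 0 < s := hs
      have hFc : ContinuousAt F ((t : ℂ) + Complex.I * s) :=
        hF.continuousAt (isOpen_upperHalfSet.mem_nhds (by simpa using hs0))
      have h2 : Tendsto (fun ε : ℝ => (t : ℂ) + Complex.I * s + Complex.I * ε) (𝓝[>] 0)
          (𝓝 ((t : ℂ) + Complex.I * s)) := by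
        have : Continuous fun ε : ℝ => (t : ℂ) + Complex.I * s + Complex.I * ε := by fun_prop
        have h3 := (this.tendsto 0).mono_left (nhdsWithin_le_nhds (s := Set.Ioi 0))
        simpa using h3
      exact hFc.tendsto.comp h2
  have hterm : ∀ ε : ℝ, 0 < ε → (∑' n, rayCoeff α b l n * Real.exp (-(l n * ε)) *
      ∫ t : ℝ, Complex.exp (Complex.I * l n * t) * w t) =
      ∫ t : ℝ, rayIntegral α (fun z => F (z + Complex.I * ε)) t * w t := by
    intro ε hε
    obtain ⟨hs, hsum⟩ := h.hasSum_rayIntegral hα hε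
    have hexp : ∀ (n : ℕ) (t : ℝ), ‖Complex.exp (Complex.I * l n * t)‖ = 1 := by
      intro n t
      rw [norm_exp_I_mul]
      simp
    have hint : ∀ n, Integrable fun t : ℝ => rayCoeff α b l n * Real.exp (-(l n * ε)) *
        (Complex.exp (Complex.I * l n * t) * w t) := by
      intro n
      refine (hw.bdd_mul (c := 1) (Continuous.aestronglyMeasurable (by fun_prop)) ?_).const_mul _
      exact Eventually.of_forall fun t => (hexp n t).le
    have hnorm : ∀ n, ∫ t : ℝ, ‖rayCoeff α b l n * Real.exp (-(l n * ε)) *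
        (Complex.exp (Complex.I * l n * t) * w t)‖ =
        ‖rayCoeff α b l n‖ * Real.exp (-(l n * ε)) * ∫ t, ‖w t‖ := by
      intro n
      rw [← integral_const_mul]
      congr 1
      ext t
      rw [norm_mul, norm_mul, norm_mul, hexp, one_mul, Complex.norm_real,
        Real.norm_of_nonneg (Real.exp_pos _).le]
    have key := hasSum_integral_of_summable_integral_norm hint
      (by simp only [hnorm]; exact hs.mul_right _)
    simp only [integral_const_mul] at key
    rw [key.tsum_eq]
    congr 1
    ext t
    rw [← (hsum t).tsum_eq, ← tsum_mul_right]
    exact tsum_congr fun n => by ring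
  have hmeas : ∀ ε : ℝ, 0 < ε → Continuous (fun t : ℝ => rayIntegral α (fun z => F (z + Complex.I * ε)) t) := by
    intro ε hε
    obtain ⟨hs, hsum⟩ := h.hasSum_rayIntegral hα hε
    rw [show (fun t : ℝ => rayIntegral α (fun z => F (z + Complex.I * ε)) t) = fun t : ℝ =>
      ∑' n, rayCoeff α b l n * Real.exp (-(l n * ε)) * Complex.exp (Complex.I * l n * t) from
      funext fun t => (hsum t).tsum_eq.symm]
    refine continuous_tsum (fun n => by fun_prop) hs fun n t => ?_
    rw [norm_mul, norm_mul, norm_exp_I_mul, Complex.norm_real,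
        Real.norm_of_nonneg (Real.exp_pos _).le]
    simp
  refine Tendsto.congr' (f₁ := fun ε : ℝ =>
    ∫ t : ℝ, rayIntegral α (fun z => F (z + Complex.I * ε)) t * w t) ?_ ?_
  · filter_upwards [self_mem_nhdsWithin] with ε hε
    exact (hterm ε hε).symm
  · refine tendsto_integral_filter_of_dominated_convergence
      (fun t => (∫ t in Set.Ioi 0, B t) * ‖w t‖) ?_ ?_ (hw.norm.const_mul _) ?_
    · filter_upwards [self_mem_nhdsWithin] with ε hε
      exact (hmeas ε hε).aestronglyMeasurable.mul hw.aestronglyMeasurable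
    · filter_upwards [self_mem_nhdsWithin] with ε hε
      refine Eventually.of_forall fun t => ?_
      rw [norm_mul]
      gcongr
      exact hunif ε hε t
    · exact Eventually.of_forall fun t => (hlim t).mul_const _

/-- The transform of the fractional integral recovers `F`. -/
theorem HasExpSeries.integral_rayIntegral_mul_cauchyKernel {F : ℂ → ℂ} {b : ℕ → ℂ} {l : ℕ → ℝ}
    (h : HasExpSeries F b l) (hF : ContinuousOn F {z : ℂ | 0 < z.im}) {ρ α : ℝ}
    (hdec : VerticalDecay F ρ) (h0 : 0 ≤ ρ) (hρ : ρ < α) {z : ℂ} (hz : 0 < z.im) :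
    ∫ t : ℝ, rayIntegral α F t * cauchyKernel α z t = ((2 * Real.pi / α : ℝ) : ℂ) * F z := by
  have hα : 0 < α := by linarith
  have hG : 0 < Real.Gamma α := Real.Gamma_pos_of_pos hα
  refine tendsto_nhds_unique
    (h.tendsto_tsum_weight hF hdec h0 hρ (integrable_cauchyKernel hα hz)) ?_
  have h1 : ∀ ε : ℝ, 0 < ε → (∑' n, rayCoeff α b l n * Real.exp (-(l n * ε)) *
      ∫ t : ℝ, Complex.exp (Complex.I * l n * t) * cauchyKernel α z t) =
      ((2 * Real.pi / α : ℝ) : ℂ) * F (z + Complex.I * ε) := by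
    intro ε hε
    rw [← (h.hasSum (z + Complex.I * ε) (by simp; linarith)).tsum_eq, ← tsum_mul_left]
    refine tsum_congr fun n => ?_
    by_cases hb : b n = 0
    · simp [hb, rayCoeff]
    have hl := h.pos n hb
    rw [integral_exp_mul_cauchyKernel hα hz, if_pos hl, rayCoeff, Real.Gamma_add_one hα.ne',
      show Complex.I * l n * (z + Complex.I * ε) = Complex.I * l n * z + ((-(l n * ε) : ℝ) : ℂ) by
        push_cast; linear_combination (l n : ℂ) * ε * Complex.I_mul_I, Complex.exp_add,
      ← Complex.ofReal_exp]
    -- The l^{-α} of the fractional integral meets the l^α of the kernel's Fourier transform, so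
    -- only 2π/α remains for every frequency.
    have : Real.Gamma α * l n ^ (-α) * (2 * Real.pi * l n ^ α / (α * Real.Gamma α)) =
        2 * Real.pi / α := by
      rw [Real.rpow_neg hl.le]
      field_simp
    rw [← this]
    push_cast
    ring
  refine Tendsto.congr' (f₁ := fun ε : ℝ => ((2 * Real.pi / α : ℝ) : ℂ) * F (z + Complex.I * ε)) ?_ ?_
  · filter_upwards [self_mem_nhdsWithin] with ε hε
    exact (h1 ε hε).symm
  · refine Tendsto.const_mul _ ?_
    have hFc : ContinuousAt F z := hF.continuousAt (isOpen_upperHalfSet.mem_nhds hz)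
    have h2 : Tendsto (fun ε : ℝ => z + Complex.I * ε) (𝓝[>] 0) (𝓝 z) := by
      have : Continuous fun ε : ℝ => z + Complex.I * ε := by fun_prop
      have h3 := (this.tendsto 0).mono_left (nhdsWithin_le_nhds (s := Set.Ioi 0))
      simpa using h3
    exact hFc.tendsto.comp h2

/-- The transform kills the complex conjugate of the fractional integral. -/
theorem HasExpSeries.integral_conj_rayIntegral_mul_cauchyKernel {F : ℂ → ℂ} {b : ℕ → ℂ} {l : ℕ → ℝ}
    (h : HasExpSeries F b l) (hF : ContinuousOn F {z : ℂ | 0 < z.im}) {ρ α : ℝ}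
    (hdec : VerticalDecay F ρ) (h0 : 0 ≤ ρ) (hρ : ρ < α) {z : ℂ} (hz : 0 < z.im) (c : ℂ) :
    ∫ t : ℝ, (starRingEnd ℂ) (c * rayIntegral α F t) * cauchyKernel α z t = 0 := by
  have hα : 0 < α := by linarith
  have hw : Integrable fun t => (starRingEnd ℂ) (cauchyKernel α z t) := by
    refine (integrable_cauchyKernel hα hz).norm.mono'
      (Complex.continuous_conj.comp (continuous_cauchyKernel α hz)).aestronglyMeasurable
      (Eventually.of_forall fun t => ?_)
    simp
  have h1 : ∫ t : ℝ, rayIntegral α F t * (starRingEnd ℂ) (cauchyKernel α z t) = 0 := by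
    refine tendsto_nhds_unique (h.tendsto_tsum_weight hF hdec h0 hρ hw) ?_
    refine tendsto_const_nhds.congr fun ε => ?_
    refine tsum_zero.symm.trans (tsum_congr fun n => Eq.symm ?_)
    by_cases hb : b n = 0
    · simp [hb, rayCoeff]
    -- Conjugation turns the frequency l into -l < 0, where the Fourier transform of the kernel
    -- vanishes.
    have h2 : ∫ t : ℝ, Complex.exp (Complex.I * l n * t) * (starRingEnd ℂ) (cauchyKernel α z t) =
        (starRingEnd ℂ) (∫ t : ℝ, Complex.exp (Complex.I * (-l n : ℝ) * t) * cauchyKernel α z t) := by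
      rw [← integral_conj]
      congr 1
      ext t
      rw [map_mul, ← Complex.exp_conj]
      simp
    rw [h2, integral_exp_mul_cauchyKernel hα hz, if_neg (by linarith [h.pos n hb])]
    simp
  have h3 : ∀ t : ℝ, (starRingEnd ℂ) (c * rayIntegral α F t) * cauchyKernel α z t =
      (starRingEnd ℂ) (c * (rayIntegral α F t * (starRingEnd ℂ) (cauchyKernel α z t))) := by
    intro t
    simp
    ring
  simp_rw [h3]
  rw [integral_conj, integral_const_mul, h1]
  simp

/-! ### Pointwise convergence of the Fourier series -/

theorem norm_exp_two_pi_I_mul_sub_one_ge {u : ℝ} (h0 : 0 ≤ u) (h1 : u ≤ 1) :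
    4 * min u (1 - u) ≤ ‖Complex.exp (2 * Real.pi * Complex.I * u) - 1‖ := by
  have hπ := Real.pi_pos
  have h : ‖Complex.exp (2 * Real.pi * Complex.I * u) - 1‖ = 2 * Real.sin (Real.pi * u) := by
    have h2 : 0 ≤ Real.sin (Real.pi * u) :=
      Real.sin_nonneg_of_nonneg_of_le_pi (by positivity) (by nlinarith)
    rw [show 2 * Real.pi * Complex.I * u = Complex.I * ((2 * (Real.pi * u) : ℝ) : ℂ) by
      push_cast; ring, Complex.norm_exp_I_mul_ofReal_sub_one]
    rw [mul_div_cancel_left₀ _ two_ne_zero, Real.norm_of_nonneg (by positivity)]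
  rw [h]
  rcases le_total u (1 / 2) with hu | hu
  · have := Real.mul_le_sin (x := Real.pi * u) (by positivity) (by nlinarith)
    have h3 : 2 / Real.pi * (Real.pi * u) = 2 * u := by field_simp
    linarith [min_le_left u (1 - u)]
  · have := Real.mul_le_sin (x := Real.pi * (1 - u)) (by nlinarith) (by nlinarith)
    have h3 : 2 / Real.pi * (Real.pi * (1 - u)) = 2 * (1 - u) := by field_simp
    rw [h3, show Real.pi * (1 - u) = Real.pi - Real.pi * u by ring, Real.sin_pi_sub] at this
    linarith [min_le_right u (1 - u)]

/-- Convergence of one-sided Fourier series at a point with a Hölder condition. -/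
theorem tendsto_sum_fourier_of_holder {H : ℝ → ℂ} (hH : Continuous H) {s K : ℝ} (hs : 0 < s)
    (hK0 : ∀ u ∈ Set.Ioo (0 : ℝ) 1, ‖H u - H 0‖ ≤ K * u ^ s)
    (hK1 : ∀ u ∈ Set.Ioo (0 : ℝ) 1, ‖H u - H 0‖ ≤ K * (1 - u) ^ s) {c : ℤ → ℂ}
    (hc : ∀ n : ℤ, ∫ u in (0 : ℝ)..1, Complex.exp (-(2 * Real.pi * Complex.I * n * u)) * H u = c n)
    (hneg : ∀ n : ℤ, n < 0 → c n = 0) :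
    Tendsto (fun N : ℕ => ∑ n ∈ Finset.range N, c n) atTop (𝓝 (H 0)) := by
  have hK : 0 ≤ K := by
    have := (norm_nonneg _).trans (hK0 (1 / 2) (by norm_num))
    have h2 : (0 : ℝ) < (1 / 2) ^ s := by positivity
    nlinarith
  set E : ℝ → ℂ := fun u => Complex.exp (2 * Real.pi * Complex.I * u) with hE
  have hEc : Continuous E := by fun_prop
  have hE1 : ∀ u ∈ Set.Ioo (0 : ℝ) 1, E u - 1 ≠ 0 := by
    intro u hu
    have h1 := norm_exp_two_pi_I_mul_sub_one_ge hu.1.le hu.2.le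
    have h2 : 0 < min u (1 - u) := lt_min hu.1 (by linarith [hu.2])
    rw [← norm_pos_iff]
    exact lt_of_lt_of_le (by positivity) h1
  -- Dini's device: the Hölder condition at both ends makes D integrable. Since H - H(0) = (E-1)D,
  -- the coefficients of H are differences of those of D, apart from H(0) in degree 0, and the
  -- partial sums telescope.
  set D : ℝ → ℂ := fun u => (H u - H 0) / (E u - 1) with hD
  have hDint : IntegrableOn D (Set.Ioo 0 1) := by
    have hb : IntegrableOn (fun u : ℝ => K / 4 * (u ^ (s - 1) + (1 - u) ^ (s - 1))) (Set.Ioo 0 1) := by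
      have i1 : IntervalIntegrable (fun u : ℝ => u ^ (s - 1)) volume 0 1 :=
        intervalIntegral.intervalIntegrable_rpow' (by linarith)
      have i2 : IntervalIntegrable (fun u : ℝ => (1 - u) ^ (s - 1)) volume 0 1 := by
        have := (i1.comp_sub_left 1).symm
        simpa using this
      exact (((intervalIntegrable_iff_integrableOn_Ioo_of_le zero_le_one).1 i1).add
        ((intervalIntegrable_iff_integrableOn_Ioo_of_le zero_le_one).1 i2)).const_mul _
    refine Integrable.mono' hb ?_ ?_
    · refine ContinuousOn.aestronglyMeasurable ?_ measurableSet_Ioo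
      exact (hH.sub continuous_const).continuousOn.div (hEc.sub continuous_const).continuousOn hE1
    · refine (ae_restrict_iff' measurableSet_Ioo).2 (Eventually.of_forall fun u hu => ?_)
      have h1 := norm_exp_two_pi_I_mul_sub_one_ge hu.1.le hu.2.le
      have hu0 := hu.1
      have hu1 : 0 < 1 - u := by linarith [hu.2]
      have p1 : 0 ≤ u ^ (s - 1) := by positivity
      have p2 : 0 ≤ (1 - u) ^ (s - 1) := by positivity
      simp only [hD]
      rw [norm_div]
      have main : ∀ v : ℝ, 0 < v → 4 * v ≤ ‖E u - 1‖ → ‖H u - H 0‖ ≤ K * v ^ s →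
          ‖H u - H 0‖ / ‖E u - 1‖ ≤ K / 4 * v ^ (s - 1) := by
        intro v hv h2 h3
        rw [div_le_iff₀ (by linarith)]
        calc _ ≤ K * v ^ s := h3
          _ = K / 4 * v ^ (s - 1) * (4 * v) := by
            rw [Real.rpow_sub_one hv.ne']
            field_simp
          _ ≤ _ := by gcongr
      rcases le_total u (1 - u) with h | h
      · rw [min_eq_left h] at h1
        refine (main u hu0 h1 (hK0 u hu)).trans ?_
        gcongr
        linarith
      · rw [min_eq_right h] at h1
        refine (main (1 - u) hu1 h1 (hK1 u hu)).trans ?_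
        gcongr
        linarith
  set f : ℝ → ℂ := (Set.Ioo (0 : ℝ) 1).indicator D with hf
  set d : ℤ → ℂ := fun n => ∫ u in Set.Ioo (0 : ℝ) 1, Complex.exp (-(2 * Real.pi * Complex.I * n * u)) * D u
    with hd
  have hnormexp : ∀ (n : ℤ) (u : ℝ), ‖Complex.exp (-(2 * Real.pi * Complex.I * n * u))‖ = 1 := by
    intro n u
    rw [show -(2 * Real.pi * Complex.I * n * u) = ((-(2 * Real.pi * n * u) : ℝ) : ℂ) * Complex.I by
      push_cast; ring, Complex.norm_exp_ofReal_mul_I]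
  have hdi : ∀ n : ℤ, IntegrableOn (fun u : ℝ => Complex.exp (-(2 * Real.pi * Complex.I * n * u)) * D u)
      (Set.Ioo 0 1) := by
    intro n
    exact hDint.bdd_mul (c := 1) (Continuous.aestronglyMeasurable (by fun_prop))
      (Eventually.of_forall fun u => (hnormexp n u).le)
  have hRL := Real.tendsto_integral_exp_smul_cocompact f
  have hdeq : ∀ n : ℤ, ∫ v : ℝ, 𝐞 (-(v * (n : ℝ))) • f v = d n := by
    intro n
    simp only [hd]
    rw [← integral_indicator measurableSet_Ioo]
    congr 1
    ext v
    simp only [hf, Set.indicator]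
    split_ifs
    · rw [Circle.smul_def, Real.fourierChar_apply, smul_eq_mul]
      congr 2
      push_cast
      ring
    · simp
  have hrec : ∀ n : ℤ, d (n - 1) - d n = c n - if n = 0 then H 0 else 0 := by
    intro n
    have h1 : d (n - 1) - d n = ∫ u in Set.Ioo (0 : ℝ) 1,
        (Complex.exp (-(2 * Real.pi * Complex.I * n * u)) * H u -
          Complex.exp (-(2 * Real.pi * Complex.I * n * u)) * H 0) := by
      simp only [hd]
      rw [← integral_sub (hdi _) (hdi _)]
      refine setIntegral_congr_fun measurableSet_Ioo fun u hu => ?_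
      simp only [hD]
      have h2 : Complex.exp (-(2 * Real.pi * Complex.I * ((n - 1 : ℤ) : ℂ) * u)) =
          Complex.exp (-(2 * Real.pi * Complex.I * n * u)) * E u := by
        rw [hE, ← Complex.exp_add]
        congr 1
        push_cast
        ring
      rw [h2]
      have := hE1 u hu
      field_simp
    rw [h1, ← integral_Ioc_eq_integral_Ioo, ← intervalIntegral.integral_of_le zero_le_one,
      intervalIntegral.integral_sub (Continuous.intervalIntegrable (by fun_prop) _ _)
        (Continuous.intervalIntegrable (by fun_prop) _ _), hc]
    congr 1
    rw [intervalIntegral.integral_mul_const]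
    split_ifs with hn
    · subst hn
      simp
    · have hne : -(2 * Real.pi * Complex.I * n) ≠ 0 := by
        have := Real.pi_ne_zero
        simp [this, hn, Complex.I_ne_zero]
      have h3 : ∀ u : ℝ, Complex.exp (-(2 * Real.pi * Complex.I * n * u)) =
          Complex.exp (-(2 * Real.pi * Complex.I * n) * u) := fun u => by congr 1; ring
      simp_rw [h3]
      rw [integral_exp_mul_complex hne]
      have h4 : Complex.exp (-(2 * Real.pi * Complex.I * n)) = 1 := by
        rw [Complex.exp_eq_one_iff]
        exact ⟨-n, by push_cast; ring⟩
      simp [h4]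
  -- The coefficients of H vanish in negative degree, so d is constant there. By the
  -- Riemann–Lebesgue lemma the constant is 0, which fixes the lower end of the telescoping sum.
  have hneg_const : ∀ k : ℕ, d (-1 - k) = d (-1) := by
    intro k
    induction k with
    | zero => simp
    | succ k ih =>
      have h1 := hrec (-1 - k)
      rw [hneg _ (by omega), if_neg (by omega), sub_zero, sub_eq_zero] at h1
      rw [← ih, ← h1]
      congr 1
      push_cast
      ring
  have hd1 : d (-1) = 0 := by
    have ht : Tendsto (fun k : ℕ => ((-1 - k : ℤ) : ℝ)) atTop (cocompact ℝ) := by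
      rw [cocompact_eq_atBot_atTop]
      refine Tendsto.mono_right ?_ le_sup_left
      push_cast
      exact tendsto_atBot_add_const_left _ (-1 : ℝ) (tendsto_neg_atTop_atBot.comp tendsto_natCast_atTop_atTop)
    have h1 := hRL.comp ht
    refine tendsto_nhds_unique (f := fun k : ℕ => d (-1 - k)) (l := atTop) ?_ ?_
    · simp_rw [hneg_const]
      exact tendsto_const_nhds
    · refine h1.congr fun k => ?_
      exact hdeq (-1 - k)
  have hsum : ∀ N : ℕ, ∑ n ∈ Finset.range (N + 1), c n = H 0 - d N := by
    intro N
    induction N with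
    | zero =>
      have := hrec 0
      simp [hd1] at this
      simp only [zero_add, Finset.range_one, Finset.sum_singleton, Nat.cast_zero]
      linear_combination -this
    | succ N ih =>
      rw [Finset.sum_range_succ, ih]
      have := hrec (N + 1 : ℕ)
      rw [if_neg (by push_cast; omega)] at this
      push_cast at this ⊢
      rw [add_sub_cancel_right] at this
      linear_combination -this
  rw [← tendsto_add_atTop_iff_nat 1]
  simp_rw [hsum]
  have ht : Tendsto (fun k : ℕ => ((k : ℤ) : ℝ)) atTop (cocompact ℝ) := by
    rw [cocompact_eq_atBot_atTop]
    refine Tendsto.mono_right ?_ le_sup_right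
    push_cast
    exact tendsto_natCast_atTop_atTop
  have h1 := hRL.comp ht
  have h2 : Tendsto (fun k : ℕ => d k) atTop (𝓝 0) := h1.congr fun k => hdeq k
  simpa using tendsto_const_nhds.sub h2

/-- The fractional integral is globally Hölder continuous. -/
theorem exists_rayIntegral_holder {F : ℂ → ℂ} (hF : DifferentiableOn ℂ F {z : ℂ | 0 < z.im})
    {ρ α s : ℝ} (hdec : VerticalDecay F ρ) (h0 : 0 ≤ ρ) (hs : 0 < s) (hs1 : s < 1)
    (hsα : s ≤ α - ρ) :
    ∃ K : ℝ, ∀ x y : ℝ, ‖rayIntegral α F x - rayIntegral α F y‖ ≤ K * |x - y| ^ s := by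
  -- The decay exponent α-s is admissible because it is at least ρ. With A = 0, B = α-s and a = 0
  -- the Taylor bound of order zero has error |h|^s at every real base point.
  obtain ⟨C, hC⟩ := hdec (α - s) (by linarith)
  obtain ⟨-, K, hK⟩ := exists_rayIntegral_taylor_bound hF hdec h0 (by linarith) (A := 0) (B := α - s)
    (C := C) (s := s) (a := 0) (n := 0) (S := Set.univ) (by simpa using hC) (by linarith) (by ring)
    (by simpa using hs) (by simpa using hs1)
  refine ⟨K, fun x y => ?_⟩
  have := hK y trivial (x - y)
  simpa using this

theorem continuous_of_holder {G : ℝ → ℂ} {s K : ℝ} (hs : 0 < s)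
    (h : ∀ x y : ℝ, ‖G x - G y‖ ≤ K * |x - y| ^ s) : Continuous G := by
  rw [continuous_iff_continuousAt]
  intro y
  rw [ContinuousAt, tendsto_iff_norm_sub_tendsto_zero]
  refine squeeze_zero (fun x => norm_nonneg _) (fun x => h x y) ?_
  have : Continuous fun x : ℝ => K * |x - y| ^ s :=
    continuous_const.mul ((by fun_prop : Continuous fun x : ℝ => |x - y|).rpow_const
      fun _ => Or.inr hs.le)
  have h2 := this.tendsto y
  simpa [Real.zero_rpow hs.ne'] using h2

/-- The series of the fractional integral converges to it at every real number. -/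
theorem HasExpSeries.tendsto_sum_rayCoeff {F : ℂ → ℂ} {b : ℕ → ℂ} {κ m : ℝ} (hm : 0 < m)
    (h : HasExpSeries F b (fun n => 2 * Real.pi * (n + κ) / m))
    (hF : DifferentiableOn ℂ F {z : ℂ | 0 < z.im}) {ρ α : ℝ}
    (hdec : VerticalDecay F ρ) (h0 : 0 ≤ ρ) (hρ : ρ < α) (y : ℝ) :
    Tendsto (fun N : ℕ => ∑ n ∈ Finset.range N,
      rayCoeff α b (fun n => 2 * Real.pi * (n + κ) / m) n *
        Complex.exp (Complex.I * (2 * Real.pi * (n + κ) / m : ℝ) * y))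
      atTop (𝓝 (rayIntegral α F y)) := by
  set l : ℕ → ℝ := fun n => 2 * Real.pi * (n + κ) / m with hl
  have hπ := Real.pi_pos
  obtain ⟨s, hs, hs1, hsα⟩ : ∃ s : ℝ, 0 < s ∧ s < 1 ∧ s ≤ α - ρ :=
    ⟨min (1 / 2) (α - ρ), lt_min (by norm_num) (by linarith),
      (min_le_left _ _).trans_lt (by norm_num), min_le_right _ _⟩
  obtain ⟨K, hK⟩ := exists_rayIntegral_holder hF hdec h0 hs hs1 hsα
  obtain ⟨Mg, hMg⟩ := exists_norm_rayIntegral_le hdec h0 hρ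
  have hG := continuous_of_holder hs hK
  have hK0 : 0 ≤ K := by
    have := (norm_nonneg _).trans (hK 1 0)
    simpa using this
  have hMg0 : 0 ≤ Mg := (norm_nonneg _).trans (hMg 0)
  have hm0 : (m : ℂ) ≠ 0 := by exact_mod_cast hm.ne'
  -- quasi-periodicity
  have hFper : ∀ z : ℂ, 0 < z.im → F (z + m) = Complex.exp (2 * Real.pi * Complex.I * κ) * F z := by
    intro z hz
    refine (h.hasSum (z + m) (by simpa using hz)).unique ?_
    have h1 := (h.hasSum z hz).mul_left (Complex.exp (2 * Real.pi * Complex.I * κ))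
    have h2 : ∀ n : ℕ, Complex.exp (2 * Real.pi * Complex.I * κ) *
        (b n * Complex.exp (Complex.I * l n * z)) = b n * Complex.exp (Complex.I * l n * (z + m)) := by
      intro n
      rw [mul_left_comm, ← Complex.exp_add]
      congr 1
      rw [Complex.exp_eq_exp_iff_exists_int]
      refine ⟨-n, ?_⟩
      simp only [hl]
      push_cast
      field_simp
      ring
    simpa only [h2] using h1
  have hGper : rayIntegral α F (y + m) = Complex.exp (2 * Real.pi * Complex.I * κ) *
      rayIntegral α F y := by
    rw [rayIntegral, rayIntegral, ← integral_const_mul]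
    refine setIntegral_congr_fun measurableSet_Ioi fun t ht => ?_
    have ht0 : 0 < t := ht
    have := hFper ((y : ℂ) + Complex.I * t) (by simpa using ht0)
    rw [show (((y + m : ℝ) : ℂ) + Complex.I * t) = (y : ℂ) + Complex.I * t + m by push_cast; ring, this]
    ring
  -- The ray integral picks up e^{2πiκ} over one period m. The twist by e^{-2πiκu} makes H(1) = H(0)
  -- and turns the frequencies n+κ into integers n.
  set H : ℝ → ℂ := fun u => Complex.exp (Complex.I * (-(2 * Real.pi * κ * u) : ℝ)) *
    rayIntegral α F (y + m * u) with hHdef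
  have hHc : Continuous H := by
    have : Continuous fun u : ℝ => rayIntegral α F (y + m * u) := hG.comp (by fun_prop)
    fun_prop
  have hH1 : H 1 = H 0 := by
    simp only [hHdef]
    rw [mul_one m, hGper, ← mul_assoc, ← Complex.exp_add, mul_zero m, add_zero]
    congr 2
    push_cast
    ring
  set K' : ℝ := K * m ^ s + 2 * Real.pi * |κ| * Mg with hK'
  have hHol : ∀ u v : ℝ, |u - v| ≤ 1 → ‖H u - H v‖ ≤ K' * |u - v| ^ s := by
    intro u v huv
    have e1 : H u - H v = Complex.exp (Complex.I * (-(2 * Real.pi * κ * u) : ℝ)) *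
        (rayIntegral α F (y + m * u) - rayIntegral α F (y + m * v)) +
        Complex.exp (Complex.I * (-(2 * Real.pi * κ * v) : ℝ)) *
        (Complex.exp (Complex.I * (-(2 * Real.pi * κ * (u - v)) : ℝ)) - 1) *
          rayIntegral α F (y + m * v) := by
      rw [mul_sub (Complex.exp (Complex.I * (-(2 * Real.pi * κ * v) : ℝ))), ← Complex.exp_add,
        show Complex.I * ((-(2 * Real.pi * κ * v) : ℝ) : ℂ) +
          Complex.I * ((-(2 * Real.pi * κ * (u - v)) : ℝ) : ℂ) =
          Complex.I * ((-(2 * Real.pi * κ * u) : ℝ) : ℂ) by push_cast; ring]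
      simp only [hHdef]
      ring
    have e2 : ‖rayIntegral α F (y + m * u) - rayIntegral α F (y + m * v)‖ ≤ K * (m ^ s * |u - v| ^ s) := by
      refine (hK _ _).trans (le_of_eq ?_)
      rw [show y + m * u - (y + m * v) = m * (u - v) by ring, abs_mul, abs_of_pos hm,
        Real.mul_rpow hm.le (abs_nonneg _)]
    have e3 : ‖Complex.exp (Complex.I * (-(2 * Real.pi * κ * (u - v)) : ℝ)) - 1‖ ≤
        2 * Real.pi * |κ| * |u - v| ^ s := by
      refine (Real.norm_exp_I_mul_ofReal_sub_one_le).trans ?_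
      rw [norm_neg, Real.norm_eq_abs, abs_mul, abs_mul, abs_of_pos (by positivity : 0 < 2 * Real.pi)]
      gcongr
      exact Real.self_le_rpow_of_le_one (abs_nonneg _) huv hs1.le
    have e4 : ∀ a : ℝ, ‖Complex.exp (Complex.I * (a : ℂ))‖ = 1 := fun a => by
      rw [mul_comm, Complex.norm_exp_ofReal_mul_I]
    rw [e1]
    refine (norm_add_le _ _).trans ?_
    rw [norm_mul, norm_mul, norm_mul, e4, e4, one_mul, one_mul]
    calc _ ≤ K * (m ^ s * |u - v| ^ s) + 2 * Real.pi * |κ| * |u - v| ^ s * Mg := by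
          gcongr
          exact hMg _
      _ = _ := by rw [hK']; ring
  -- Fourier coefficients
  set c : ℤ → ℂ := fun k => if 0 ≤ k then
    rayCoeff α b l k.toNat * Complex.exp (Complex.I * (l k.toNat : ℝ) * y) else 0 with hc
  have hcoef : ∀ k : ℤ, ∫ u in (0 : ℝ)..1, Complex.exp (-(2 * Real.pi * Complex.I * k * u)) * H u
      = c k := by
    intro k
    set e : ℝ → ℂ := fun t => Complex.exp (-(2 * Real.pi * Complex.I * (k + κ) / m * t)) with he
    have hec : Continuous e := by fun_prop
    -- An exponential cut off to one period is an integrable weight. Testing the damped series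
    -- against it isolates a single coefficient by orthogonality, with no convergence on the real
    -- line required.
    set w : ℝ → ℂ := (Set.Ioc y (y + m)).indicator e with hw
    have hwi : Integrable w :=
      ((hec.intervalIntegrable y (y + m)).1).integrable_indicator measurableSet_Ioc
    have hT := h.tendsto_tsum_weight hF.continuousOn hdec h0 hρ hwi
    have hwint : ∀ G : ℝ → ℂ, ∫ t, G t * w t = ∫ t in y..(y + m), G t * e t := by
      intro G
      rw [intervalIntegral.integral_of_le (by linarith), ← integral_indicator measurableSet_Ioc]
      congr 1
      ext t
      simp only [hw, Set.indicator]
      split_ifs <;> simp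
    have horth : ∀ n : ℕ, ∫ t : ℝ, Complex.exp (Complex.I * l n * t) * w t =
        if (n : ℤ) = k then (m : ℂ) else 0 := by
      intro n
      rw [hwint]
      have h1 : ∀ t : ℝ, Complex.exp (Complex.I * l n * t) * e t =
          Complex.exp (2 * Real.pi * Complex.I * ((n : ℤ) - k : ℤ) / m * t) := by
        intro t
        rw [he, ← Complex.exp_add]
        congr 1
        simp only [hl]
        push_cast
        field_simp
        ring
      simp_rw [h1]
      split_ifs with hnk
      · rw [hnk]
        simp
      · have hne : 2 * Real.pi * Complex.I * (((n : ℤ) - k : ℤ) : ℂ) / m ≠ 0 := by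
          have h2 : (((n : ℤ) - k : ℤ) : ℂ) ≠ 0 := by exact_mod_cast sub_ne_zero.2 hnk
          have := hπ.ne'
          simp only [ne_eq, div_eq_zero_iff, mul_eq_zero, not_or]
          exact ⟨⟨⟨⟨two_ne_zero, by exact_mod_cast this⟩, Complex.I_ne_zero⟩, h2⟩, hm0⟩
        rw [integral_exp_mul_complex hne]
        have h3 : Complex.exp (2 * Real.pi * Complex.I * (((n : ℤ) - k : ℤ) : ℂ) / m * (y + m : ℝ)) =
            Complex.exp (2 * Real.pi * Complex.I * (((n : ℤ) - k : ℤ) : ℂ) / m * y) := by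
          rw [Complex.exp_eq_exp_iff_exists_int]
          refine ⟨(n : ℤ) - k, ?_⟩
          push_cast
          field_simp
        rw [h3, sub_self, zero_div]
    have hlim : ∫ t in y..(y + m), rayIntegral α F t * e t =
        if 0 ≤ k then rayCoeff α b l k.toNat * m else 0 := by
      rw [← hwint]
      refine tendsto_nhds_unique hT ?_
      simp_rw [horth]
      split_ifs with hk
      · obtain ⟨j, rfl⟩ := Int.eq_ofNat_of_zero_le hk
        have h4 : ∀ ε : ℝ, (∑' n : ℕ, rayCoeff α b l n * Real.exp (-(l n * ε)) *
            if (n : ℤ) = (j : ℤ) then (m : ℂ) else 0) =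
            rayCoeff α b l j * Real.exp (-(l j * ε)) * m := by
          intro ε
          rw [tsum_eq_single j]
          · simp
          · intro n hn
            rw [if_neg (by exact_mod_cast hn), mul_zero]
        simp_rw [h4]
        have : Continuous fun ε : ℝ => rayCoeff α b l j * Real.exp (-(l j * ε)) * m := by fun_prop
        have h5 := (this.tendsto 0).mono_left (nhdsWithin_le_nhds (s := Set.Ioi 0))
        simpa using h5
      · refine tendsto_const_nhds.congr fun ε => ?_
        refine tsum_zero.symm.trans (tsum_congr fun n => ?_)
        rw [if_neg (by omega), mul_zero]
    have hsub : ∀ u : ℝ, Complex.exp (-(2 * Real.pi * Complex.I * k * u)) * H u =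
        Complex.exp (2 * Real.pi * Complex.I * (k + κ) / m * y) *
          (rayIntegral α F (y + m * u) * e (y + m * u)) := by
      intro u
      simp only [hHdef, he]
      rw [← mul_assoc, ← Complex.exp_add, mul_left_comm, ← Complex.exp_add, mul_comm]
      congr 2
      push_cast
      field_simp
      ring
    simp_rw [hsub]
    rw [intervalIntegral.integral_const_mul, intervalIntegral.integral_comp_add_mul
      (fun t => rayIntegral α F t * e t) hm.ne', mul_zero, add_zero, mul_one, hlim]
    simp only [hc]
    split_ifs with hk
    · obtain ⟨j, rfl⟩ := Int.eq_ofNat_of_zero_le hk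
      rw [Complex.real_smul]
      simp only [Int.toNat_natCast, hl]
      push_cast
      rw [show (m : ℂ)⁻¹ * (rayCoeff α b l j * m) = rayCoeff α b l j by field_simp, mul_comm]
      congr 2
      ring
    · simp
  have key := tendsto_sum_fourier_of_holder hHc hs (K := K')
    (fun u hu => by
      have := hHol u 0 (by rw [sub_zero, abs_of_pos hu.1]; exact hu.2.le)
      rwa [sub_zero, abs_of_pos hu.1] at this)
    (fun u hu => by
      have h1 : |u - 1| = 1 - u := by rw [abs_sub_comm, abs_of_pos]; linarith [hu.2]
      have := hHol u 1 (by rw [h1]; linarith [hu.1])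
      rwa [h1, hH1] at this) hcoef (fun n hn => by simp only [hc]; rw [if_neg (by omega)])
  have hH0 : H 0 = rayIntegral α F y := by simp [hHdef]
  rw [hH0] at key
  refine key.congr fun N => Finset.sum_congr rfl fun n _ => ?_
  simp only [hc, hl]
  rw [if_pos (Int.natCast_nonneg n), Int.toNat_natCast]

/-! ### The invariant norm of a modular form and the cusps -/

theorem coe_smul_eq_div_cocycleFactor (γ : SL(2, ℤ)) (z : UpperHalfPlane) :
    ((γ • z : UpperHalfPlane) : ℂ) = (((γ 0 0 : ℤ) : ℂ) * z + ((γ 0 1 : ℤ) : ℂ)) /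
      cocycleFactor γ z := by
  rw [UpperHalfPlane.coe_specialLinearGroup_apply]
  simp [cocycleFactor]

theorem cocycleFactor_eq_denom (γ : SL(2, ℤ)) (z : UpperHalfPlane) :
    cocycleFactor γ z = UpperHalfPlane.denom (γ : GL (Fin 2) ℝ) z := by
  rw [ModularGroup.denom_apply]; rfl

theorem cocycleFactor_ne_zero (γ : SL(2, ℤ)) (z : UpperHalfPlane) : cocycleFactor γ z ≠ 0 := by
  rw [cocycleFactor_eq_denom]
  exact UpperHalfPlane.denom_ne_zero _ _

theorem im_smul_eq_div_norm_cocycleFactor (γ : SL(2, ℤ)) (z : UpperHalfPlane) :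
    (γ • z : UpperHalfPlane).im = z.im / ‖cocycleFactor γ z‖ ^ 2 := by
  rw [ModularGroup.im_smul_eq_div_normSq, cocycleFactor_eq_denom, Complex.normSq_eq_norm_sq]

theorem norm_cocycleFactor_pos (γ : SL(2, ℤ)) (z : UpperHalfPlane) : 0 < ‖cocycleFactor γ z‖ :=
  norm_pos_iff.2 (cocycleFactor_ne_zero γ z)

/-- The function `|f(z)| (Im z)^{r/2}`. -/
noncomputable def petNorm (f : UpperHalfPlane → ℂ) (r : ℝ) (z : UpperHalfPlane) : ℝ :=
  ‖f z‖ * z.im ^ (r / 2)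

theorem norm_slashReal (f : UpperHalfPlane → ℂ) (r : ℝ) (γ : SL(2, ℤ)) (z : UpperHalfPlane) :
    ‖slashReal f r γ z‖ = ‖f (γ • z)‖ / ‖cocycleFactor γ z‖ ^ r := by
  rw [slashReal, norm_div, Complex.norm_cpow_real]

/-- Im(γz) = Im z/|cz+d|², so the weight (Im z)^{r/2} absorbs the modulus of the automorphy factor
exactly. -/
theorem norm_slashReal_mul (f : UpperHalfPlane → ℂ) (r : ℝ) (γ : SL(2, ℤ))
    (z : UpperHalfPlane) :
    ‖slashReal f r γ z‖ * z.im ^ (r / 2) = petNorm f r (γ • z) := by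
  have hc := norm_cocycleFactor_pos γ z
  rw [norm_slashReal, petNorm, im_smul_eq_div_norm_cocycleFactor,
    Real.div_rpow z.im_pos.le (by positivity), ← Real.rpow_natCast, ← Real.rpow_mul hc.le]
  rw [show ((2 : ℕ) : ℝ) * (r / 2) = r by push_cast; ring]
  ring

theorem norm_slashReal_eq (f : UpperHalfPlane → ℂ) (r : ℝ) (γ : SL(2, ℤ))
    (z : UpperHalfPlane) :
    ‖slashReal f r γ z‖ = petNorm f r (γ • z) * z.im ^ (-(r / 2)) := by
  have := Real.rpow_pos_of_pos z.im_pos (r / 2)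
  rw [← norm_slashReal_mul, Real.rpow_neg z.im_pos.le]
  field_simp

theorem slashReal_one (f : UpperHalfPlane → ℂ) (r : ℝ) : slashReal f r 1 = f := by
  ext z; simp [slashReal, cocycleFactor]

/-- The elements of the modular group under which `petNorm f r` is invariant. -/
noncomputable def petStabilizer (f : UpperHalfPlane → ℂ) (r : ℝ) : Subgroup SL(2, ℤ) where
  carrier := {δ | ∀ z, petNorm f r (δ • z) = petNorm f r z}
  mul_mem' {a b} ha hb z := by rw [mul_smul, ha, hb]
  one_mem' z := by rw [one_smul]
  inv_mem' {a} ha z := by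
    have := ha (a⁻¹ • z)
    rw [smul_inv_smul] at this
    exact this.symm

/-- The multipliers are unimodular, so on moduli the transformation law becomes plain invariance,
and -1 acts trivially. Working with moduli avoids all questions about branches of the powers. -/
theorem IsModularFormOfWeight.le_petStabilizer {f : UpperHalfPlane → ℂ} {r : ℝ}
    {Γ : Subgroup SL(2, ℤ)} {μ : Γ → ℂ} (hf : IsModularFormOfWeight f r Γ μ) :
    Γ ⊔ Subgroup.zpowers (-1 : SL(2, ℤ)) ≤ petStabilizer f r := by
  refine sup_le ?_ ?_
  · intro δ hδ z
    rw [← norm_slashReal_mul, norm_slashReal, hf.transform ⟨δ, hδ⟩ z, norm_mul, norm_mul,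
      hf.norm_multiplier, Complex.norm_cpow_real, petNorm]
    have := Real.rpow_pos_of_pos (norm_cocycleFactor_pos δ z) r
    field_simp
  · rw [Subgroup.zpowers_le]
    intro z
    rw [ModularGroup.SL_neg_smul, one_smul]

/-! ### Stabilizers of cusps -/

theorem cuspOf_mul (γ δ : SL(2, ℤ)) :
    cuspOf (γ * δ) = Matrix.SpecialLinearGroup.mapGL ℚ γ • cuspOf δ := by
  rw [cuspOf, cuspOf, map_mul, mul_smul]

theorem cuspOf_one : cuspOf 1 = OnePoint.infty := by
  rw [cuspOf, map_one, one_smul]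

theorem cuspOf_eq_infty_iff (γ : SL(2, ℤ)) : cuspOf γ = OnePoint.infty ↔ γ 1 0 = 0 := by
  rw [cuspOf, OnePoint.smul_infty_eq_self_iff]
  simp

theorem cuspOf_eq_coe {γ : SL(2, ℤ)} (hc : γ 1 0 ≠ 0) :
    cuspOf γ = (((γ 0 0 : ℚ) / (γ 1 0 : ℚ) : ℚ) : OnePoint ℚ) := by
  rw [cuspOf, OnePoint.smul_infty_eq_ite]
  simp [hc]

theorem exists_cuspOf_eq (𝔞 : OnePoint ℚ) : ∃ γ : SL(2, ℤ), cuspOf γ = 𝔞 := by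
  obtain ⟨γ, hγ⟩ := OnePoint.exists_mem_SL2 ℤ 𝔞
  exact ⟨γ, hγ⟩

theorem exists_eq_T_zpow_or_neg {g : SL(2, ℤ)} (hg : g 1 0 = 0) :
    ∃ n : ℤ, g = ModularGroup.T ^ n ∨ g = -1 * ModularGroup.T ^ n := by
  have hdet := Matrix.det_fin_two (g : Matrix (Fin 2) (Fin 2) ℤ)
  rw [g.det_coe] at hdet
  have hg' : (g : Matrix (Fin 2) (Fin 2) ℤ) 1 0 = 0 := hg
  rw [hg', mul_zero, sub_zero] at hdet
  rcases Int.eq_one_or_neg_one_of_mul_eq_one' hdet.symm with ⟨h0, h1⟩ | ⟨h0, h1⟩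
  · refine ⟨g 0 1, Or.inl ?_⟩
    ext i j
    rw [ModularGroup.coe_T_zpow]
    fin_cases i <;> fin_cases j <;> simp [h0, h1, hg']
  · refine ⟨-g 0 1, Or.inr ?_⟩
    ext i j
    rw [neg_one_mul, Matrix.SpecialLinearGroup.coe_neg, ModularGroup.coe_T_zpow]
    fin_cases i <;> fin_cases j <;> simp [h0, h1, hg']

/-- The stabilizer in `SL(2, ℤ)` of a cusp. -/
noncomputable def cuspStabilizer (𝔞 : OnePoint ℚ) : Subgroup SL(2, ℤ) :=
  (MulAction.stabilizer (GL (Fin 2) ℚ) 𝔞).comap (Matrix.SpecialLinearGroup.mapGL ℚ)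

theorem mem_cuspStabilizer_iff (γ g : SL(2, ℤ)) :
    g ∈ cuspStabilizer (cuspOf γ) ↔ (γ⁻¹ * g * γ) 1 0 = 0 := by
  rw [← cuspOf_eq_infty_iff, cuspOf_mul, map_mul, mul_smul, cuspStabilizer, Subgroup.mem_comap,
    MulAction.mem_stabilizer_iff, map_inv, inv_smul_eq_iff]
  rfl

theorem conj_T_zpow_mem_cuspStabilizer (γ : SL(2, ℤ)) (n : ℤ) :
    γ * ModularGroup.T ^ n * γ⁻¹ ∈ cuspStabilizer (cuspOf γ) := by
  rw [mem_cuspStabilizer_iff, show γ⁻¹ * (γ * ModularGroup.T ^ n * γ⁻¹) * γ = ModularGroup.T ^ n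
    by group, ModularGroup.coe_T_zpow]
  simp

/-- Conjugation by γ carries both elements to the form ±Tⁿ. Commutativity makes every subgroup of
the stabilizer normal in it, so an index can be used as an exponent. -/
theorem commute_of_mem_cuspStabilizer {γ a b : SL(2, ℤ)} (ha : a ∈ cuspStabilizer (cuspOf γ))
    (hb : b ∈ cuspStabilizer (cuspOf γ)) : a * b = b * a := by
  rw [mem_cuspStabilizer_iff] at ha hb
  have key : (γ⁻¹ * a * γ) * (γ⁻¹ * b * γ) = (γ⁻¹ * b * γ) * (γ⁻¹ * a * γ) := by
    obtain ⟨n, hn⟩ := exists_eq_T_zpow_or_neg ha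
    obtain ⟨k, hk⟩ := exists_eq_T_zpow_or_neg hb
    have hT : Commute (ModularGroup.T ^ n) (ModularGroup.T ^ k) :=
      (Commute.refl ModularGroup.T).zpow_zpow n k
    rcases hn with hn | hn <;> rcases hk with hk | hk <;> rw [hn, hk] <;> simp [hT.eq]
  have : γ * ((γ⁻¹ * a * γ) * (γ⁻¹ * b * γ)) * γ⁻¹ =
    γ * ((γ⁻¹ * b * γ) * (γ⁻¹ * a * γ)) * γ⁻¹ := by rw [key]
  simpa [mul_assoc] using this

theorem finiteIndex_sup_zpowers {Γ : Subgroup SL(2, ℤ)} (hΓ : Γ.FiniteIndex) :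
    (Γ ⊔ Subgroup.zpowers (-1 : SL(2, ℤ))).FiniteIndex :=
  Subgroup.finiteIndex_of_le le_sup_left

theorem cuspWidth_pos {Γ : Subgroup SL(2, ℤ)} (hΓ : Γ.FiniteIndex) (𝔞 : OnePoint ℚ) : 0 < cuspWidth Γ 𝔞 := by
  have := finiteIndex_sup_zpowers hΓ
  rw [Nat.pos_iff_ne_zero, cuspWidth]
  have := Subgroup.isFiniteRelIndex_of_finiteIndex (H := Γ ⊔ Subgroup.zpowers (-1 : SL(2, ℤ)))
    (K := cuspStabilizer 𝔞)
  exact Subgroup.relIndex_ne_zero (H := Γ ⊔ Subgroup.zpowers (-1 : SL(2, ℤ)))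
    (K := cuspStabilizer 𝔞)

/-- The width is an index in an abelian group, so raising any element of the stabilizer to that
power lands in the subgroup. -/
theorem conj_T_pow_cuspWidth_mem (Γ : Subgroup SL(2, ℤ)) (γ : SL(2, ℤ)) :
    γ * ModularGroup.T ^ (cuspWidth Γ (cuspOf γ)) * γ⁻¹ ∈
      Γ ⊔ Subgroup.zpowers (-1 : SL(2, ℤ)) := by
  set H := Γ ⊔ Subgroup.zpowers (-1 : SL(2, ℤ)) with hH
  set K := cuspStabilizer (cuspOf γ) with hK
  have hT : γ * ModularGroup.T * γ⁻¹ ∈ K := by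
    simpa using conj_T_zpow_mem_cuspStabilizer γ 1
  have hn : (H.subgroupOf K).Normal := by
    constructor
    intro n hn g
    have : g * n * g⁻¹ = n := by
      ext1
      push_cast
      rw [commute_of_mem_cuspStabilizer g.2 n.2, mul_assoc, mul_inv_cancel, mul_one]
    rwa [this]
  have := Subgroup.pow_index_mem (H.subgroupOf K) ⟨_, hT⟩
  rw [Subgroup.mem_subgroupOf] at this
  have h2 : (H.subgroupOf K).index = cuspWidth Γ (cuspOf γ) := rfl
  rw [h2] at this
  simpa [conj_pow] using this

variable {f : UpperHalfPlane → ℂ} {r : ℝ} {Γ : Subgroup SL(2, ℤ)} {μ : Γ → ℂ}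

theorem petNorm_smul_vadd_cuspWidth (hf : IsModularFormOfWeight f r Γ μ)
    (γ : SL(2, ℤ)) (z : UpperHalfPlane) :
    petNorm f r (γ • ((cuspWidth Γ (cuspOf γ) : ℝ) +ᵥ z)) = petNorm f r (γ • z) := by
  have h := hf.le_petStabilizer (conj_T_pow_cuspWidth_mem Γ γ) (γ • z)
  have h2 := UpperHalfPlane.modular_T_zpow_smul z (cuspWidth Γ (cuspOf γ) : ℤ)
  rw [Int.cast_natCast, zpow_natCast] at h2
  rw [← h2, ← h, ← mul_smul, ← mul_smul, inv_mul_cancel_right]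

theorem norm_slashReal_vadd_cuspWidth (hf : IsModularFormOfWeight f r Γ μ)
    (γ : SL(2, ℤ)) (z : UpperHalfPlane) :
    ‖slashReal f r γ ((cuspWidth Γ (cuspOf γ) : ℝ) +ᵥ z)‖ = ‖slashReal f r γ z‖ := by
  rw [norm_slashReal_eq, norm_slashReal_eq, petNorm_smul_vadd_cuspWidth hf,
    UpperHalfPlane.vadd_im]

/-- The modulus at one point thus recurs along a whole horizontal orbit, which a matrix sends to a
sequence on a horocycle at the cusp. -/
theorem norm_slashReal_vadd_nat_mul_cuspWidth (hf : IsModularFormOfWeight f r Γ μ) (γ : SL(2, ℤ)) (N : ℕ) (z : UpperHalfPlane) :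
    ‖slashReal f r γ ((N * cuspWidth Γ (cuspOf γ) : ℝ) +ᵥ z)‖ = ‖slashReal f r γ z‖ := by
  induction N with
  | zero => simp
  | succ N ih =>
    rw [← ih, ← norm_slashReal_vadd_cuspWidth hf γ ((N * _ : ℝ) +ᵥ z), vadd_vadd]
    congr 3
    push_cast; ring

/-! ### Holomorphy of the slashed function, and the cusp parameter -/

/-- The slashed function on the complex plane. -/
noncomputable def slashFun (f : UpperHalfPlane → ℂ) (r : ℝ) (γ : SL(2, ℤ)) : ℂ → ℂ :=
  slashReal f r γ ∘ UpperHalfPlane.ofComplex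

theorem slashFun_coe (f : UpperHalfPlane → ℂ) (r : ℝ) (γ : SL(2, ℤ)) (z : UpperHalfPlane) :
    slashFun f r γ z = slashReal f r γ z := by
  simp [slashFun]

theorem slashFun_eq {f : UpperHalfPlane → ℂ} {r : ℝ} {γ : SL(2, ℤ)} {w : ℂ} (hw : 0 < w.im) :
    slashFun f r γ w = slashReal f r γ ⟨w, hw⟩ := by
  rw [slashFun, Function.comp_apply, UpperHalfPlane.ofComplex_apply_of_im_pos hw]

theorem isPreconnected_upperHalfSet : IsPreconnected {z : ℂ | 0 < z.im} :=
  (convex_halfSpace_im_gt 0).isPreconnected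

theorem cocycle_mem_slitPlane {γ : SL(2, ℤ)} (hc : γ 1 0 ≠ 0) {w : ℂ} (hw : 0 < w.im) :
    ((γ 1 0 : ℤ) : ℂ) * w + ((γ 1 1 : ℤ) : ℂ) ∈ Complex.slitPlane := by
  right
  simp [hc, hw.ne']

theorem IsModularFormOfWeight.differentiableOn_slashFun {f : UpperHalfPlane → ℂ} {r : ℝ}
    {Γ : Subgroup SL(2, ℤ)} {μ : Γ → ℂ} (hf : IsModularFormOfWeight f r Γ μ) (γ : SL(2, ℤ)) :
    DifferentiableOn ℂ (slashFun f r γ) {z : ℂ | 0 < z.im} := by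
  set mo : ℂ → ℂ := fun w => (((γ 0 0 : ℤ) : ℂ) * w + ((γ 0 1 : ℤ) : ℂ)) /
      (((γ 1 0 : ℤ) : ℂ) * w + ((γ 1 1 : ℤ) : ℂ)) with hmo
  have hne : ∀ w : ℂ, 0 < w.im → ((γ 1 0 : ℤ) : ℂ) * w + ((γ 1 1 : ℤ) : ℂ) ≠ 0 := fun w hw =>
    cocycleFactor_ne_zero γ ⟨w, hw⟩
  have hcoe : ∀ (w : ℂ) (hw : 0 < w.im), ((γ • (⟨w, hw⟩ : UpperHalfPlane) : UpperHalfPlane) : ℂ)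
      = mo w := fun w hw => coe_smul_eq_div_cocycleFactor γ ⟨w, hw⟩
  have him : ∀ w : ℂ, 0 < w.im → 0 < (mo w).im := fun w hw => by
    rw [← hcoe w hw]; exact UpperHalfPlane.im_pos _
  have heq : Set.EqOn (slashFun f r γ) (fun w => (f ∘ UpperHalfPlane.ofComplex) (mo w) /
      (((γ 1 0 : ℤ) : ℂ) * w + ((γ 1 1 : ℤ) : ℂ)) ^ (r : ℂ)) {z : ℂ | 0 < z.im} := by
    intro w hw
    rw [slashFun_eq hw, slashReal]
    congr 1
    simp only [Function.comp_apply]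
    rw [← hcoe w hw, UpperHalfPlane.ofComplex_apply]
  refine DifferentiableOn.congr ?_ heq
  refine DifferentiableOn.div ?_ ?_ ?_
  · refine hf.holo.comp ?_ him
    refine DifferentiableOn.div (by fun_prop) (by fun_prop) hne
  -- If c = 0 the automorphy factor is constant. Otherwise cz+d is not real, so it avoids the branch
  -- cut.
  · by_cases hc : γ 1 0 = 0
    · simp only [hc, Int.cast_zero, zero_mul, zero_add]
      exact differentiableOn_const _
    · intro w hw
      exact (DifferentiableAt.cpow ((differentiableAt_id.const_mul _).add_const _)
        (differentiableAt_const _)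
        (cocycle_mem_slitPlane hc hw)).differentiableWithinAt
  · intro w hw
    rw [Ne, Complex.cpow_eq_zero_iff]
    exact fun h => hne w hw h.1

/-- Holomorphic functions with the same absolute value differ by a unimodular constant. -/
theorem exists_unimodular_of_norm_eq {u v : ℂ → ℂ} {U : Set ℂ} (hU : IsOpen U)
    (hUc : IsPreconnected U) (hu : DifferentiableOn ℂ u U) (hv : DifferentiableOn ℂ v U)
    (h : ∀ z ∈ U, ‖u z‖ = ‖v z‖) : ∃ χ : ℂ, ‖χ‖ = 1 ∧ ∀ z ∈ U, u z = χ * v z := by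
  by_cases h0 : ∃ z ∈ U, v z ≠ 0
  · obtain ⟨z₀, hz₀, hv0⟩ := h0
    have hev : ∀ᶠ z in 𝓝 z₀, z ∈ U ∧ v z ≠ 0 :=
      (hU.eventually_mem hz₀).and ((hv.continuousOn.continuousAt (hU.mem_nhds hz₀)).eventually_ne hv0)
    have hnorm : ∀ z ∈ U, v z ≠ 0 → ‖u z / v z‖ = 1 := fun z hz hvz => by
      rw [norm_div, h z hz, div_self (norm_ne_zero_iff.2 hvz)]
    have hd : ∀ᶠ z in 𝓝 z₀, DifferentiableAt ℂ (fun z => u z / v z) z := by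
      filter_upwards [hev] with z hz
      exact (hu.differentiableAt (hU.mem_nhds hz.1)).div
        (hv.differentiableAt (hU.mem_nhds hz.1)) hz.2
    -- The quotient u/v has modulus 1 near z₀, so it is locally constant by the maximum principle.
    -- The identity theorem spreads this to U.
    have hmax : IsLocalMax (norm ∘ fun z => u z / v z) z₀ := by
      filter_upwards [hev] with z hz
      simp only [Function.comp_apply]
      rw [hnorm z hz.1 hz.2, hnorm z₀ hz₀ hv0]
    have hconst := Complex.eventually_eq_of_isLocalMax_norm hd hmax
    refine ⟨u z₀ / v z₀, hnorm z₀ hz₀ hv0, ?_⟩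
    have := (hu.analyticOnNhd hU).eqOn_of_preconnected_of_eventuallyEq
      ((hv.const_mul (u z₀ / v z₀)).analyticOnNhd hU) hUc hz₀ ?_
    · exact fun z hz => this hz
    · filter_upwards [hconst, hev] with z hz hz2
      rw [← hz]
      field_simp [hz2.2]
  · push Not at h0
    refine ⟨1, norm_one, fun z hz => ?_⟩
    have := h z hz
    rw [h0 z hz, norm_zero, norm_eq_zero] at this
    rw [this, h0 z hz, mul_zero]

theorem exists_slashReal_ne_zero {f : UpperHalfPlane → ℂ} (hf0 : f ≠ 0) (r : ℝ)
    (γ : SL(2, ℤ)) : ∃ z, slashReal f r γ z ≠ 0 := by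
  obtain ⟨z, hz⟩ := Function.ne_iff.1 hf0
  refine ⟨γ⁻¹ • z, ?_⟩
  rw [slashReal, smul_inv_smul]
  refine div_ne_zero hz ?_
  rw [Ne, Complex.cpow_eq_zero_iff]
  exact fun h => cocycleFactor_ne_zero _ _ h.1

section

variable {f : UpperHalfPlane → ℂ} {r : ℝ} {Γ : Subgroup SL(2, ℤ)} {μ : Γ → ℂ}

/-- The slashed function and its translate by the width have equal moduli, hence differ by a
unimodular constant χ, and κ is arg χ/(2π) modulo 1. As f ≠ 0, it is the only element of the set
defining `cuspParameter`, so the infimum is attained. -/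
theorem IsModularFormOfWeight.cuspParameter_spec (hf : IsModularFormOfWeight f r Γ μ)
    (hf0 : f ≠ 0) (γ : SL(2, ℤ)) :
    0 ≤ cuspParameter f r Γ γ ∧ cuspParameter f r Γ γ < 1 ∧ ∀ z : UpperHalfPlane,
      slashReal f r γ ((cuspWidth Γ (cuspOf γ) : ℝ) +ᵥ z) =
        Complex.exp (2 * Real.pi * Complex.I * cuspParameter f r Γ γ) * slashReal f r γ z := by
  set m : ℝ := ((cuspWidth Γ (cuspOf γ) : ℕ) : ℝ) with hm
  have hol := hf.differentiableOn_slashFun γ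
  obtain ⟨χ, hχ, hχ2⟩ := exists_unimodular_of_norm_eq isOpen_upperHalfSet
    isPreconnected_upperHalfSet (u := fun w => slashFun f r γ (m + w)) (v := slashFun f r γ)
    (hol.comp (by fun_prop) (fun z hz => by simpa using hz)) hol (by
      intro z hz
      have hz' : 0 < ((m : ℂ) + z).im := by simpa using hz
      rw [slashFun_eq hz', slashFun_eq hz, ← norm_slashReal_vadd_cuspWidth hf γ ⟨z, hz⟩]
      rfl)
  have key : ∀ z : UpperHalfPlane, slashReal f r γ (m +ᵥ z) = χ * slashReal f r γ z := by
    intro z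
    rw [← slashFun_coe, ← slashFun_coe, ← hχ2 z z.im_pos, UpperHalfPlane.coe_vadd]
  set S := {κ : ℝ | 0 ≤ κ ∧ κ < 1 ∧ ∀ z : UpperHalfPlane,
    slashReal f r γ (m +ᵥ z) =
      Complex.exp (2 * Real.pi * Complex.I * κ) * slashReal f r γ z} with hS
  set κ₀ : ℝ := Int.fract (χ.arg / (2 * Real.pi)) with hκ₀
  have hexp : Complex.exp (2 * Real.pi * Complex.I * κ₀) = χ := by
    have hχ' : Complex.exp (χ.arg * Complex.I) = χ := by
      have := Complex.norm_mul_exp_arg_mul_I χ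
      rwa [hχ, Complex.ofReal_one, one_mul] at this
    conv_rhs => rw [← hχ']
    rw [Complex.exp_eq_exp_iff_exists_int]
    refine ⟨-⌊χ.arg / (2 * Real.pi)⌋, ?_⟩
    rw [hκ₀, ← Int.self_sub_floor]
    push_cast
    have : (Real.pi : ℂ) ≠ 0 := by exact_mod_cast Real.pi_ne_zero
    field_simp
    ring
  have hmem : κ₀ ∈ S := ⟨Int.fract_nonneg _, Int.fract_lt_one _, fun z => by rw [hexp, key]⟩
  have huniq : S = {κ₀} := by
    refine Set.eq_singleton_iff_unique_mem.2 ⟨hmem, ?_⟩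
    rintro κ ⟨h0, h1, h2⟩
    obtain ⟨z, hz⟩ := exists_slashReal_ne_zero hf0 r γ
    have h3 := h2 z
    rw [hmem.2.2 z] at h3
    have h4 := mul_right_cancel₀ hz h3
    rw [Complex.exp_eq_exp_iff_exists_int] at h4
    obtain ⟨n, hn⟩ := h4
    have hpi : (2 * Real.pi * Complex.I : ℂ) ≠ 0 := Complex.two_pi_I_ne_zero
    have h5 : (κ₀ : ℂ) = κ + n := by
      apply mul_left_cancel₀ hpi
      rw [hn]; ring
    have h6 : κ₀ = κ + n := by exact_mod_cast h5
    have h7 : (n : ℝ) < 1 := by linarith [hmem.2.1]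
    have h8 : (-1 : ℝ) < n := by linarith [hmem.1]
    have h9 : n = 0 := by
      have a1 : n < 1 := by exact_mod_cast h7
      have a2 : -1 < n := by exact_mod_cast h8
      omega
    rw [h6, h9]; simp
  have hval : cuspParameter f r Γ γ = κ₀ := by
    change sInf S = κ₀
    rw [huniq, csInf_singleton]
  rw [hval]
  exact hmem

/-! ### Growth at the cusps -/

/-- A matrix with c ≠ 0 sends high points close to the real line, where the growth hypothesis on f
applies. If γ fixes ∞, a power of STS⁻¹ lying in Γ is put in front of it. -/
theorem exists_mem_mul_apply_one_zero_ne_zero (hΓ : Γ.FiniteIndex) (γ : SL(2, ℤ)) :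
    ∃ δ ∈ Γ, (δ * γ) 1 0 ≠ 0 := by
  by_cases hc : γ 1 0 = 0
  · obtain ⟨k, hk, -, hmem⟩ := Subgroup.exists_pow_mem_of_index_ne_zero hΓ.index_ne_zero
      (ModularGroup.S * ModularGroup.T * ModularGroup.S⁻¹)
    refine ⟨_, hmem, ?_⟩
    have hdet := Matrix.det_fin_two (γ : Matrix (Fin 2) (Fin 2) ℤ)
    have hc' : (γ : Matrix (Fin 2) (Fin 2) ℤ) 1 0 = 0 := hc
    rw [γ.det_coe, hc', mul_zero, sub_zero] at hdet
    have ha : (γ : Matrix (Fin 2) (Fin 2) ℤ) 0 0 ≠ 0 := by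
      intro h; rw [h] at hdet; simp at hdet
    rw [conj_pow, ← zpow_natCast]
    have : (ModularGroup.S * ModularGroup.T ^ (k : ℤ) * ModularGroup.S⁻¹ * γ) 1 0
        = -k * γ 0 0 := by
      simp only [Matrix.SpecialLinearGroup.coe_mul, ModularGroup.coe_T_zpow, ModularGroup.coe_S,
        Matrix.SpecialLinearGroup.coe_inv, Matrix.adjugate_fin_two_of]
      simp [Matrix.mul_apply, Fin.sum_univ_two, hc']
    rw [this]
    exact mul_ne_zero (by simpa using hk.ne') ha
  · exact ⟨1, Γ.one_mem, by rwa [one_mul]⟩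

/-- Polynomial growth of the slashed function in vertical strips. -/
theorem IsModularFormOfWeight.exists_norm_slashReal_le_strip (hf : IsModularFormOfWeight f r Γ μ)
    (hΓ : Γ.FiniteIndex) (γ : SL(2, ℤ)) {m : ℝ} (hm : 0 ≤ m) :
    ∃ C K Y : ℝ, 1 ≤ Y ∧ ∀ z : UpperHalfPlane, |z.re| ≤ m → Y ≤ z.im →
      ‖slashReal f r γ z‖ ≤ C * z.im ^ K := by
  obtain ⟨A₀, C₀, η, hη, hgr⟩ := hf.growth
  obtain ⟨δ, hδ, hc⟩ := exists_mem_mul_apply_one_zero_ne_zero hΓ γ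
  set c : ℤ := (δ * γ) 1 0 with hcdef
  set d : ℤ := (δ * γ) 1 1 with hddef
  -- The exponent is enlarged so that A - r/2 ≥ 0. A lower bound for the height then bounds the
  -- power from above.
  set A := max A₀ (r / 2) with hA
  set E := |(c : ℝ)| * (m + 1) + |(d : ℝ)| with hE
  have hE0 : 0 ≤ E := by positivity
  refine ⟨|C₀| * (E ^ 2) ^ (A - r / 2), (A - r / 2) - r / 2, max 1 (2 / η), le_max_left _ _, ?_⟩
  intro z hre him
  have hy : 1 ≤ z.im := (le_max_left _ _).trans him
  have hy0 := z.im_pos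
  -- The invariant norm is the same at w, whose height lies between 1/(E² Im z) and 1/Im z. Hence w
  -- is within reach of the growth condition once Im z is large.
  set w : UpperHalfPlane := (δ * γ) • z with hw
  have hpet : petNorm f r (γ • z) = petNorm f r w := by
    rw [hw, mul_smul]
    exact (hf.le_petStabilizer (Subgroup.mem_sup_left hδ) (γ • z)).symm
  have hcf : cocycleFactor (δ * γ) z = c * z + d := rfl
  have hn0 := norm_cocycleFactor_pos (δ * γ) z
  have hwim : w.im = z.im / ‖cocycleFactor (δ * γ) z‖ ^ 2 :=
    im_smul_eq_div_norm_cocycleFactor _ _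
  have hc1 : (1 : ℝ) ≤ |(c : ℝ)| := by exact_mod_cast Int.one_le_abs hc
  have hlow : z.im ≤ ‖cocycleFactor (δ * γ) z‖ := by
    refine le_trans ?_ (Complex.abs_im_le_norm _)
    rw [hcf]
    simp only [Complex.add_im, Complex.mul_im, Complex.intCast_re, Complex.intCast_im, zero_mul,
      add_zero, abs_mul, UpperHalfPlane.coe_im]
    rw [abs_of_pos hy0]
    nlinarith
  have hupp : ‖cocycleFactor (δ * γ) z‖ ≤ E * z.im := by
    rw [hcf]
    have hz : ‖(z : ℂ)‖ ≤ m + z.im := by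
      refine (Complex.norm_le_abs_re_add_abs_im _).trans ?_
      rw [UpperHalfPlane.coe_re, UpperHalfPlane.coe_im, abs_of_pos hy0]
      linarith
    have h1 : ‖(c : ℂ) * z + d‖ ≤ |(c : ℝ)| * (m + z.im) + |(d : ℝ)| := by
      refine (norm_add_le _ _).trans ?_
      rw [norm_mul, Complex.norm_intCast, Complex.norm_intCast]
      gcongr
    refine h1.trans ?_
    have : m + z.im ≤ (m + 1) * z.im := by nlinarith
    have h2 : |(d : ℝ)| ≤ |(d : ℝ)| * z.im := by nlinarith [abs_nonneg (d : ℝ)]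
    rw [hE]
    nlinarith [abs_nonneg (c : ℝ)]
  have hw1 : w.im ≤ 1 / z.im := by
    rw [hwim, div_le_div_iff₀ (by positivity) hy0]
    nlinarith
  have hwη : w.im < η := by
    have : 2 / η ≤ z.im := (le_max_right _ _).trans him
    rw [div_le_iff₀ hη] at this
    refine hw1.trans_lt ?_
    rw [div_lt_iff₀ hy0]; linarith
  have hwle1 : w.im ≤ 1 := hw1.trans (by rw [div_le_one hy0]; exact hy)
  have hfw : ‖f w‖ ≤ |C₀| * w.im ^ (-A) := by
    refine (hgr w hwη).trans ?_
    have h1 : w.im ^ (-A₀) ≤ w.im ^ (-A) :=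
      Real.rpow_le_rpow_of_exponent_ge w.im_pos hwle1 (neg_le_neg (le_max_left _ _))
    have h2 := Real.rpow_nonneg w.im_pos.le (-A₀)
    nlinarith [le_abs_self C₀, abs_nonneg C₀]
  have hAr : 0 ≤ A - r / 2 := sub_nonneg.2 (le_max_right _ _)
  have hwinv : w.im⁻¹ ≤ E ^ 2 * z.im := by
    rw [hwim, inv_div, div_le_iff₀ hy0]
    calc ‖cocycleFactor (δ * γ) z‖ ^ 2 ≤ (E * z.im) ^ 2 := by gcongr
      _ = _ := by ring
  have hpw : petNorm f r w ≤ |C₀| * ((E ^ 2) ^ (A - r / 2) * z.im ^ (A - r / 2)) := by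
    rw [petNorm]
    calc ‖f w‖ * w.im ^ (r / 2) ≤ |C₀| * w.im ^ (-A) * w.im ^ (r / 2) := by
          gcongr
      _ = |C₀| * (w.im⁻¹) ^ (A - r / 2) := by
          rw [mul_assoc, ← Real.rpow_add w.im_pos, Real.inv_rpow w.im_pos.le,
            ← Real.rpow_neg w.im_pos.le]
          congr 2; ring
      _ ≤ |C₀| * (E ^ 2 * z.im) ^ (A - r / 2) := by
          gcongr
      _ = _ := by rw [Real.mul_rpow (by positivity) hy0.le]
  rw [norm_slashReal_eq, hpet, sub_eq_add_neg (A - r / 2) (r / 2), Real.rpow_add hy0]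
  have := Real.rpow_nonneg hy0.le (-(r / 2))
  calc _ ≤ |C₀| * ((E ^ 2) ^ (A - r / 2) * z.im ^ (A - r / 2)) * z.im ^ (-(r / 2)) := by gcongr
    _ = _ := by ring

end

/-! ### Fourier expansions of periodic holomorphic functions -/

theorem tendsto_rpow_mul_exp_neg_mul {K b : ℝ} (hb : 0 < b) :
    Tendsto (fun y : ℝ => y ^ K * Real.exp (-b * y)) atTop (𝓝 0) := by
  simpa using tendsto_rpow_mul_exp_neg_mul_atTop_nhds_zero K b hb

/-- The principal logarithm places the preimage of q in a fixed vertical strip, so growth needs to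
be known only there. -/
theorem abs_re_invQParam_le {h : ℝ} (hh : 0 < h) (q : ℂ) :
    |(Function.Periodic.invQParam h q).re| ≤ h := by
  have : (Function.Periodic.invQParam h q).re = h / (2 * Real.pi) * q.arg := by
    have hpi : (Real.pi : ℂ) ≠ 0 := by exact_mod_cast Real.pi_ne_zero
    have : Function.Periodic.invQParam h q
        = ((h / (2 * Real.pi) : ℝ) : ℂ) * (-Complex.I * Complex.log q) := by
      rw [Function.Periodic.invQParam]
      push_cast
      field_simp
      rw [Complex.I_sq]; ring
    rw [this, Complex.re_ofReal_mul]
    simp [Complex.log_im]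
  rw [this, abs_mul, abs_of_pos (by positivity)]
  have := Complex.abs_arg_le_pi q
  calc h / (2 * Real.pi) * |q.arg| ≤ h / (2 * Real.pi) * Real.pi := by gcongr
    _ = h / 2 := by field_simp
    _ ≤ h := by linarith

/-- A holomorphic periodic function on the upper half-plane of subcritical growth is a
holomorphic function of `q`. -/
theorem differentiableOn_cuspFunction_of_growth {h : ℝ} (hh : 0 < h) {G : ℂ → ℂ}
    (hG : DifferentiableOn ℂ G {z | 0 < z.im}) (hper : Function.Periodic G h) {C K a Y : ℝ}
    (ha : a < 2 * Real.pi / h)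
    (hgrow : ∀ z : ℂ, |z.re| ≤ h → Y ≤ z.im → ‖G z‖ ≤ C * z.im ^ K * Real.exp (a * z.im)) :
    DifferentiableOn ℂ (Function.Periodic.cuspFunction h G) (Metric.ball 0 1) := by
  set Φ := Function.Periodic.cuspFunction h G with hΦ
  have hd : DifferentiableOn ℂ Φ (Metric.ball 0 1 \ {0}) := by
    intro q hq
    have hq0 : q ≠ 0 := hq.2
    have hq1 : ‖q‖ < 1 := by simpa using hq.1
    have him : 0 < (Function.Periodic.invQParam h q).im := by
      rw [Function.Periodic.im_invQParam]
      have := Real.log_neg (norm_pos_iff.2 hq0) hq1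
      have h2 : 0 < h / (2 * Real.pi) := by positivity
      rw [neg_div]
      nlinarith
    have := Function.Periodic.differentiableAt_cuspFunction hh.ne' hper
      (hG.differentiableAt (isOpen_upperHalfSet.mem_nhds him))
    rw [Function.Periodic.qParam_right_inv hh.ne' hq0] at this
    exact this.differentiableWithinAt
  have hinv : Tendsto (fun q : ℂ => (Function.Periodic.invQParam h q).im) (𝓝[≠] 0) atTop :=
    tendsto_comap_iff.1 (Function.Periodic.invQParam_tendsto hh)
  -- As |q| = e^{-2πy/h} and a < 2π/h, growth like y^K e^{ay} is o(1/|q|), so the singularity at q =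
  -- 0 is removable.
  have ho1 : Φ =o[𝓝[≠] 0] fun q : ℂ => (q - 0)⁻¹ := by
    set b := 2 * Real.pi / h - a with hb
    have hb0 : 0 < b := sub_pos.2 ha
    have hlim := ((tendsto_rpow_mul_exp_neg_mul (K := K) hb0).comp hinv).const_mul C
    rw [mul_zero] at hlim
    have hbig : Φ =O[𝓝[≠] 0] fun q : ℂ =>
        (C * ((fun y : ℝ => y ^ K * Real.exp (-b * y)) ∘
          fun q : ℂ => (Function.Periodic.invQParam h q).im) q : ℝ) * ‖q‖⁻¹ := by
      refine IsBigO.of_bound 1 ?_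
      filter_upwards [self_mem_nhdsWithin, hinv.eventually_ge_atTop Y] with q hq0 hqY
      have hq0 : q ≠ 0 := hq0
      rw [hΦ, Function.Periodic.cuspFunction_eq_of_nonzero _ _ hq0, one_mul]
      refine le_trans (hgrow _ (abs_re_invQParam_le hh q) hqY) (le_trans (le_of_eq ?_)
        (Real.le_norm_self _))
      have hn : ‖q‖⁻¹ = Real.exp (2 * Real.pi / h * (Function.Periodic.invQParam h q).im) := by
        rw [Function.Periodic.im_invQParam,
          show 2 * Real.pi / h * (-h / (2 * Real.pi) * Real.log ‖q‖) = -Real.log ‖q‖ by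
            field_simp, Real.exp_neg, Real.exp_log (norm_pos_iff.2 hq0)]
      rw [hn, Function.comp_apply, mul_assoc, mul_assoc, mul_assoc, ← Real.exp_add]
      congr 4
      rw [hb]; ring
    refine hbig.trans_isLittleO ?_
    have h2 : (fun q : ℂ => (C * ((fun y : ℝ => y ^ K * Real.exp (-b * y)) ∘
          fun q : ℂ => (Function.Periodic.invQParam h q).im) q : ℝ)) =o[𝓝[≠] (0 : ℂ)]
          fun _ => (1 : ℝ) := (isLittleO_one_iff ℝ).2 hlim
    have h3 := h2.mul_isBigO (isBigO_refl (fun q : ℂ => ‖q‖⁻¹) (𝓝[≠] 0))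
    refine h3.trans_isBigO (IsBigO.of_bound 1 (Eventually.of_forall fun q => ?_))
    simp
  have ho : (fun q => Φ q - Φ 0) =o[𝓝[≠] 0] fun q : ℂ => (q - 0)⁻¹ := by
    refine ho1.sub ?_
    refine IsLittleO.of_bound fun c hc => ?_
    have hε : 0 < c / (‖Φ 0‖ + 1) := by positivity
    filter_upwards [self_mem_nhdsWithin, mem_nhdsWithin_of_mem_nhds (Metric.ball_mem_nhds 0 hε)]
      with q hq0 hq
    have hq0 : 0 < ‖q‖ := norm_pos_iff.2 hq0
    rw [mem_ball_zero_iff, lt_div_iff₀ (by positivity)] at hq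
    rw [sub_zero, norm_inv, ← div_eq_mul_inv, le_div_iff₀ hq0]
    nlinarith [norm_nonneg (Φ 0)]
  have := Complex.differentiableOn_update_limUnder_of_isLittleO
    (Metric.ball_mem_nhds (0 : ℂ) one_pos) hd ho
  rwa [hΦ, ← Function.Periodic.cuspFunction_zero_eq_limUnder_nhds_ne,
    Function.update_eq_self] at this

/-- The Taylor coefficients at `0` of a function holomorphic in the unit disc are mean values. -/
theorem integral_comp_exp_div_eq {Φ : ℂ → ℂ} (hΦ : DifferentiableOn ℂ Φ (Metric.ball 0 1))
    (n : ℕ) :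
    ∫ x in (0 : ℝ)..1, Φ (Complex.exp (2 * Real.pi * Complex.I * (x + Complex.I))) *
        Complex.exp (-(2 * Real.pi * Complex.I * n * (x + Complex.I))) =
      (n.factorial : ℂ)⁻¹ * iteratedDeriv n Φ 0 := by
  -- The line Im z = 1 is mapped by e^{2πiz} to the circle of radius e^{-2π}, on which Cauchy's
  -- formula is applied.
  set R := Real.exp (-(2 * Real.pi)) with hR
  have hR0 : 0 < R := Real.exp_pos _
  have hR1 : R < 1 := Real.exp_lt_one_iff.2 (by have := Real.pi_pos; linarith)
  have h1 := (hΦ.mono (Metric.closedBall_subset_ball hR1)).circleIntegral_one_div_sub_center_pow_smul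
    hR0 n
  rw [circleIntegral] at h1
  have h2 := intervalIntegral.smul_integral_comp_mul_right (a := 0) (b := 1) (fun θ : ℝ =>
    deriv (circleMap 0 R) θ • (fun z => (1 / (z - 0) ^ (n + 1)) • Φ z) (circleMap 0 R θ))
      (2 * Real.pi)
  rw [zero_mul, one_mul] at h2
  rw [← h2] at h1
  have hcirc : ∀ x : ℝ, circleMap 0 R (x * (2 * Real.pi)) =
      Complex.exp (2 * Real.pi * Complex.I * (x + Complex.I)) := by
    intro x
    rw [circleMap, hR, Complex.ofReal_exp, zero_add, ← Complex.exp_add]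
    congr 1
    push_cast
    linear_combination (-2 * Real.pi : ℂ) * Complex.I_sq
  have h3 : ∀ x : ℝ, (fun θ : ℝ => deriv (circleMap 0 R) θ •
      (fun z => (1 / (z - 0) ^ (n + 1)) • Φ z) (circleMap 0 R θ)) (x * (2 * Real.pi)) =
      Complex.I * (Φ (Complex.exp (2 * Real.pi * Complex.I * (x + Complex.I))) *
        Complex.exp (-(2 * Real.pi * Complex.I * n * (x + Complex.I)))) := by
    intro x
    simp only [deriv_circleMap, hcirc, smul_eq_mul, sub_zero]
    have : Complex.exp (-(2 * Real.pi * Complex.I * n * (x + Complex.I)))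
        = (Complex.exp (2 * Real.pi * Complex.I * (x + Complex.I)) ^ n)⁻¹ := by
      rw [← Complex.exp_nat_mul, ← Complex.exp_neg]
      congr 1; ring
    rw [this, pow_succ]
    have := Complex.exp_ne_zero (2 * Real.pi * Complex.I * (x + Complex.I))
    field_simp
  simp only [h3] at h1
  rw [intervalIntegral.integral_const_mul, smul_eq_mul, Complex.real_smul] at h1
  have hpi : (Real.pi : ℂ) ≠ 0 := by exact_mod_cast Real.pi_ne_zero
  have hfac : (n.factorial : ℂ) ≠ 0 := by exact_mod_cast n.factorial_ne_zero
  push_cast at h1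
  have h4 : (2 * Real.pi * Complex.I : ℂ) ≠ 0 := Complex.two_pi_I_ne_zero
  apply mul_left_cancel₀ h4
  calc _ = 2 * Real.pi * (Complex.I * ∫ x in (0 : ℝ)..1,
          Φ (Complex.exp (2 * Real.pi * Complex.I * (x + Complex.I))) *
        Complex.exp (-(2 * Real.pi * Complex.I * n * (x + Complex.I)))) := by ring
    _ = _ := by rw [h1]; field_simp

section

variable {f : UpperHalfPlane → ℂ} {r : ℝ} {Γ : Subgroup SL(2, ℤ)} {μ : Γ → ℂ}

/-- The Fourier expansion at a cusp, as a holomorphic function of `q`. -/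
theorem IsModularFormOfWeight.exists_cuspFunction (hf : IsModularFormOfWeight f r Γ μ)
    (hΓ : Γ.FiniteIndex) (hf0 : f ≠ 0) (γ : SL(2, ℤ)) :
    ∃ Φ : ℂ → ℂ, DifferentiableOn ℂ Φ (Metric.ball 0 1) ∧
      (∀ z : UpperHalfPlane, slashReal f r γ z =
        Complex.exp (2 * Real.pi * Complex.I * cuspParameter f r Γ γ * z /
          (cuspWidth Γ (cuspOf γ) : ℂ)) *
        Φ (Complex.exp (2 * Real.pi * Complex.I * z / (cuspWidth Γ (cuspOf γ) : ℂ)))) ∧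
      ∀ n, cuspCoeff f r Γ γ n = (n.factorial : ℂ)⁻¹ * iteratedDeriv n Φ 0 := by
  obtain ⟨hκ0, hκ1, hκ⟩ := hf.cuspParameter_spec hf0 γ
  set κ := cuspParameter f r Γ γ with hκdef
  set m : ℝ := ((cuspWidth Γ (cuspOf γ) : ℕ) : ℝ) with hm
  have hm0 : 0 < m := Nat.cast_pos.2 (cuspWidth_pos hΓ (cuspOf γ))
  have hmC : (m : ℂ) ≠ 0 := by exact_mod_cast hm0.ne'
  have hmcast : ((cuspWidth Γ (cuspOf γ) : ℕ) : ℂ) = (m : ℂ) := by rw [hm]; simp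
  set E : ℂ → ℂ := fun z => Complex.exp (2 * Real.pi * Complex.I * κ * z / m) with hE
  -- Dividing by E removes the factor e^{2πiκ}. The extension by 0 makes G periodic on all of ℂ.
  set G : ℂ → ℂ := Set.indicator {z : ℂ | 0 < z.im} (fun z => slashFun f r γ z / E z) with hGdef
  have hGin : ∀ z : ℂ, 0 < z.im → G z = slashFun f r γ z / E z := fun z hz =>
    Set.indicator_of_mem (s := {z : ℂ | 0 < z.im}) hz _
  have hGout : ∀ z : ℂ, ¬ 0 < z.im → G z = 0 := fun z hz =>
    Set.indicator_of_notMem (s := {z : ℂ | 0 < z.im}) hz _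
  have hG : DifferentiableOn ℂ G {z | 0 < z.im} := by
    refine DifferentiableOn.congr (f := fun z => slashFun f r γ z / E z) ?_ hGin
    refine (hf.differentiableOn_slashFun γ).div (by fun_prop) fun z _ => Complex.exp_ne_zero _
  have hper : Function.Periodic G m := by
    intro z
    have him : (z + m).im = z.im := by simp
    by_cases hz : 0 < z.im
    · rw [hGin z hz, hGin (z + m) (by rwa [him])]
      have h1 := hκ ⟨z, hz⟩
      rw [← slashFun_coe, ← slashFun_coe, UpperHalfPlane.coe_vadd] at h1
      have h2 : E (z + m) = Complex.exp (2 * Real.pi * Complex.I * κ) * E z := by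
        rw [hE, ← Complex.exp_add]
        field_simp
        ring_nf
      rw [add_comm z, h1, add_comm (m : ℂ), h2]
      exact mul_div_mul_left _ _ (Complex.exp_ne_zero _)
    · rw [hGout z hz, hGout (z + m) (by rwa [him])]
  obtain ⟨C, K, Y, hY, hst⟩ := hf.exists_norm_slashReal_le_strip hΓ γ hm0.le
  have hnE : ∀ z, ‖E z‖ = Real.exp (-(2 * Real.pi * κ / m * z.im)) := by
    intro z
    rw [hE, Complex.norm_exp]
    congr 1
    have : 2 * Real.pi * Complex.I * κ * z / m = ((2 * Real.pi * κ / m : ℝ) : ℂ) *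
        (Complex.I * z) := by push_cast; field_simp
    rw [this, Complex.re_ofReal_mul]
    simp
  have hgrow : ∀ z : ℂ, |z.re| ≤ m → Y ≤ z.im →
      ‖G z‖ ≤ C * z.im ^ K * Real.exp (2 * Real.pi * κ / m * z.im) := by
    intro z hre him
    have hz : 0 < z.im := by linarith
    rw [hGin z hz, norm_div, hnE, Real.exp_neg, div_inv_eq_mul, slashFun_eq hz]
    have := hst ⟨z, hz⟩ hre him
    gcongr
    exact this
  -- Division by E costs e^{2πκy/m}, which is subcritical precisely because κ < 1.
  have hΦ := differentiableOn_cuspFunction_of_growth hm0 hG hper (by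
    rw [div_lt_div_iff_of_pos_right hm0]
    nlinarith [Real.pi_pos]) hgrow
  set Φ := Function.Periodic.cuspFunction m G with hΦdef
  have hexp : ∀ z : UpperHalfPlane, slashReal f r γ z = E z *
      Φ (Complex.exp (2 * Real.pi * Complex.I * z / m)) := by
    intro z
    have h1 := Function.Periodic.eq_cuspFunction hm0.ne' hper (z : ℂ)
    rw [Function.Periodic.qParam, ← hΦdef] at h1
    rw [h1, hGin z z.im_pos, slashFun_coe, mul_div_cancel₀ _ (Complex.exp_ne_zero _)]
  refine ⟨Φ, hΦ, ?_, ?_⟩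
  · intro z
    rw [hmcast]
    exact hexp z
  · intro n
    rw [← integral_comp_exp_div_eq hΦ n, cuspCoeff]
    refine intervalIntegral.integral_congr fun x _ => ?_
    rw [hmcast]
    have him : 0 < ((m : ℂ) * (x + Complex.I)).im := by simpa using hm0
    rw [UpperHalfPlane.ofComplex_apply_of_im_pos him, hexp, UpperHalfPlane.coe_mk]
    have e1 : 2 * Real.pi * Complex.I * ((m : ℂ) * (x + Complex.I)) / m =
      2 * Real.pi * Complex.I * (x + Complex.I) := by field_simp
    have e2 : E (m * (x + Complex.I)) = Complex.exp (2 * Real.pi * Complex.I * κ *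
        (x + Complex.I)) := by
      rw [hE]; field_simp
    rw [e1, e2, mul_comm (Complex.exp _), mul_assoc, ← Complex.exp_add]
    congr 2
    ring

end

/-! ### Size of modular forms near the cusps and in the upper half-plane -/

theorem norm_exp_two_pi_I_mul_div (κ m : ℝ) (z : ℂ) :
    ‖Complex.exp (2 * Real.pi * Complex.I * κ * z / m)‖ =
      Real.exp (-(2 * Real.pi * κ / m * z.im)) := by
  rw [Complex.norm_exp]
  congr 1
  have : 2 * Real.pi * Complex.I * κ * z / m = ((2 * Real.pi * κ / m : ℝ) : ℂ) *
      (Complex.I * z) := by push_cast; ring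
  rw [this, Complex.re_ofReal_mul]
  simp

theorem norm_exp_two_pi_I_div (m : ℝ) (z : ℂ) :
    ‖Complex.exp (2 * Real.pi * Complex.I * z / m)‖ = Real.exp (-(2 * Real.pi / m * z.im)) := by
  simpa using norm_exp_two_pi_I_mul_div 1 m z

/-- Values of a holomorphic function on the unit disc near its centre. -/
theorem exists_norm_sub_le_of_differentiableOn_ball {Φ : ℂ → ℂ}
    (hΦ : DifferentiableOn ℂ Φ (Metric.ball 0 1)) {R : ℝ} (hR : R < 1) :
    ∃ C : ℝ, 0 ≤ C ∧ ∀ q : ℂ, ‖q‖ ≤ R → ‖Φ q - Φ 0‖ ≤ C * ‖q‖ := by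
  have hd : DifferentiableOn ℂ (dslope Φ 0) (Metric.ball 0 1) :=
    (Complex.differentiableOn_dslope (Metric.ball_mem_nhds 0 one_pos)).2 hΦ
  obtain ⟨C, hC⟩ := (isCompact_closedBall (0 : ℂ) R).exists_bound_of_continuousOn
    (hd.continuousOn.mono (Metric.closedBall_subset_ball hR))
  refine ⟨max C 0, le_max_right _ _, fun q hq => ?_⟩
  have h1 := sub_smul_dslope Φ 0 q
  rw [← h1, sub_zero, norm_smul, mul_comm]
  gcongr
  exact (hC q (by simpa using hq)).trans (le_max_left _ _)

theorem exists_bound_rpow_mul_exp_neg {K ε y₀ : ℝ} (hε : 0 < ε) (hy₀ : 0 < y₀) :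
    ∃ D : ℝ, 0 ≤ D ∧ ∀ y : ℝ, y₀ ≤ y → y ^ K * Real.exp (-(ε * y)) ≤ D := by
  have hlim := tendsto_rpow_mul_exp_neg_mul (K := K) hε
  obtain ⟨Y, hY⟩ := eventually_atTop.1 ((tendsto_order.1 hlim).2 1 one_pos)
  obtain ⟨D, hD⟩ := (isCompact_Icc (a := y₀) (b := Y)).exists_bound_of_continuousOn
    (f := fun y : ℝ => y ^ K * Real.exp (-(ε * y))) (by
      refine ContinuousOn.mul (fun y hy => ?_) (by fun_prop)
      exact (Real.continuousAt_rpow_const y K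
        (Or.inl (hy₀.trans_le hy.1).ne')).continuousWithinAt)
  refine ⟨max D 1, by positivity, fun y hy => ?_⟩
  by_cases h : Y ≤ y
  · have := (hY y h).le
    rw [neg_mul] at this
    exact this.trans (le_max_right _ _)
  · exact (Real.le_norm_self _).trans ((hD y ⟨hy, (not_le.1 h).le⟩).trans (le_max_left _ _))

section

variable {f : UpperHalfPlane → ℂ} {r : ℝ} {Γ : Subgroup SL(2, ℤ)} {μ : Γ → ℂ}

/-- Exponential approach to the constant term of the expansion at a cusp. -/
theorem IsModularFormOfWeight.exists_norm_slashReal_sub_le_exp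
    (hf : IsModularFormOfWeight f r Γ μ) (hΓ : Γ.FiniteIndex) (hf0 : f ≠ 0) (γ : SL(2, ℤ))
    {a : ℂ} (ha0 : 0 < cuspParameter f r Γ γ → a = 0)
    (ha1 : cuspParameter f r Γ γ = 0 → a = cuspCoeff f r Γ γ 0) {y₀ : ℝ} (hy₀ : 0 < y₀) :
    ∃ C ε : ℝ, 0 ≤ C ∧ 0 < ε ∧ ∀ z : UpperHalfPlane, y₀ ≤ z.im →
      ‖slashReal f r γ z - a‖ ≤ C * Real.exp (-(ε * z.im)) := by
  obtain ⟨Φ, hΦ, hexp, hcoeff⟩ := hf.exists_cuspFunction hΓ hf0 γ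
  obtain ⟨hκ0, -, -⟩ := hf.cuspParameter_spec hf0 γ
  set κ := cuspParameter f r Γ γ
  set m : ℝ := ((cuspWidth Γ (cuspOf γ) : ℕ) : ℝ) with hm
  have hm0 : 0 < m := Nat.cast_pos.2 (cuspWidth_pos hΓ (cuspOf γ))
  have hmcast : ((cuspWidth Γ (cuspOf γ) : ℕ) : ℂ) = (m : ℂ) := by rw [hm]; simp
  rw [hmcast] at hexp
  have hc0 : cuspCoeff f r Γ γ 0 = Φ 0 := by simp [hcoeff 0]
  have hpi := Real.pi_pos
  set R := Real.exp (-(2 * Real.pi / m * y₀)) with hR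
  have hR1 : R < 1 := Real.exp_lt_one_iff.2 (neg_lt_zero.2 (by positivity))
  obtain ⟨C, hC0, hC⟩ := exists_norm_sub_le_of_differentiableOn_ball hΦ hR1
  have hq : ∀ z : UpperHalfPlane, y₀ ≤ z.im →
      ‖Complex.exp (2 * Real.pi * Complex.I * z / m)‖ ≤ R := by
    intro z hz
    rw [norm_exp_two_pi_I_div, hR]
    gcongr
    exact hz
  -- For κ = 0 the decay is that of Φ(q) - Φ(0) = O(|q|). For κ > 0 it comes from the factor
  -- e^{2πiκz/m}, and Φ only needs to be bounded.
  rcases hκ0.eq_or_lt with hκ | hκ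
  · refine ⟨C, 2 * Real.pi / m, hC0, by positivity, fun z hz => ?_⟩
    rw [hexp, ← hκ, ha1 hκ.symm, hc0]
    simp only [Complex.ofReal_zero, mul_zero, zero_mul, zero_div, Complex.exp_zero, one_mul]
    refine (hC _ (hq z hz)).trans (le_of_eq ?_)
    rw [norm_exp_two_pi_I_div]
    rfl
  · refine ⟨C * R + ‖Φ 0‖, 2 * Real.pi * κ / m, by positivity, by positivity, fun z hz => ?_⟩
    rw [hexp, ha0 hκ, sub_zero, norm_mul, norm_exp_two_pi_I_mul_div, mul_comm]
    gcongr
    · have h1 := hC _ (hq z hz)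
      have h2 : ‖Φ (Complex.exp (2 * Real.pi * Complex.I * z / m))‖ ≤
          ‖Φ (Complex.exp (2 * Real.pi * Complex.I * z / m)) - Φ 0‖ + ‖Φ 0‖ := by
        simpa using norm_add_le (Φ (Complex.exp (2 * Real.pi * Complex.I * z / m)) - Φ 0) (Φ 0)
      have h3 := mul_le_mul_of_nonneg_left (hq z hz) hC0
      linarith
    · rfl

theorem IsModularFormOfWeight.exists_norm_slashReal_le (hf : IsModularFormOfWeight f r Γ μ)
    (hΓ : Γ.FiniteIndex) (hf0 : f ≠ 0) (γ : SL(2, ℤ)) {y₀ : ℝ} (hy₀ : 0 < y₀) :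
    ∃ C : ℝ, 0 ≤ C ∧ ∀ z : UpperHalfPlane, y₀ ≤ z.im → ‖slashReal f r γ z‖ ≤ C := by
  obtain ⟨C, ε, hC, hε, h⟩ := hf.exists_norm_slashReal_sub_le_exp hΓ hf0 γ
    (a := if cuspParameter f r Γ γ = 0 then cuspCoeff f r Γ γ 0 else 0)
    (fun h => if_neg h.ne') (fun h => if_pos h) hy₀
  refine ⟨C + ‖if cuspParameter f r Γ γ = 0 then cuspCoeff f r Γ γ 0 else 0‖, by positivity,
    fun z hz => ?_⟩
  rw [← sub_add_cancel (slashReal f r γ z)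
    (if cuspParameter f r Γ γ = 0 then cuspCoeff f r Γ γ 0 else 0)]
  refine (norm_add_le _ _).trans ?_
  gcongr
  refine (h z hz).trans (mul_le_of_le_one_right hC (Real.exp_le_one_iff.2 ?_))
  have := z.im_pos
  exact neg_nonpos.2 (by positivity)

theorem IsModularFormOfWeight.exists_norm_slashReal_le_exp (hf : IsModularFormOfWeight f r Γ μ)
    (hΓ : Γ.FiniteIndex) (hf0 : f ≠ 0) {γ : SL(2, ℤ)}
    (hγ : 0 < cuspParameter f r Γ γ ∨ cuspCoeff f r Γ γ 0 = 0) {y₀ : ℝ} (hy₀ : 0 < y₀) :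
    ∃ C ε : ℝ, 0 ≤ C ∧ 0 < ε ∧ ∀ z : UpperHalfPlane, y₀ ≤ z.im →
      ‖slashReal f r γ z‖ ≤ C * Real.exp (-(ε * z.im)) := by
  have := hf.exists_norm_slashReal_sub_le_exp hΓ hf0 γ (a := 0) (fun _ => rfl)
    (fun h => (hγ.resolve_left (by rw [h]; exact lt_irrefl 0)).symm) hy₀
  simpa using this

/-- High in the cusp the nonzero constant term dominates the exponentially small remainder. -/
theorem IsModularFormOfWeight.exists_le_norm_slashReal (hf : IsModularFormOfWeight f r Γ μ)
    (hΓ : Γ.FiniteIndex) (hf0 : f ≠ 0) {γ : SL(2, ℤ)}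
    (hγ : ¬ (0 < cuspParameter f r Γ γ ∨ cuspCoeff f r Γ γ 0 = 0)) :
    ∃ c V : ℝ, 0 < c ∧ 0 < V ∧ ∀ z : UpperHalfPlane, V ≤ z.im → c ≤ ‖slashReal f r γ z‖ := by
  push Not at hγ
  obtain ⟨C, ε, hC, hε, h⟩ := hf.exists_norm_slashReal_sub_le_exp hΓ hf0 γ
    (a := cuspCoeff f r Γ γ 0) (fun h => absurd h hγ.1.not_gt) (fun _ => rfl) one_pos
  have ha := norm_pos_iff.2 hγ.2
  set a := cuspCoeff f r Γ γ 0
  have hlim : Tendsto (fun y : ℝ => C * Real.exp (-(ε * y))) atTop (𝓝 0) := by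
    have : Tendsto (fun y : ℝ => Real.exp (-(ε * y))) atTop (𝓝 0) :=
      Real.tendsto_exp_neg_atTop_nhds_zero.comp (tendsto_id.const_mul_atTop hε)
    simpa using this.const_mul C
  obtain ⟨V, hV⟩ := eventually_atTop.1 ((tendsto_order.1 hlim).2 (‖a‖ / 2) (half_pos ha))
  refine ⟨‖a‖ / 2, max V 1, half_pos ha, by positivity, fun z hz => ?_⟩
  have h1 := h z ((le_max_right _ _).trans hz)
  have h2 := hV z.im ((le_max_left _ _).trans hz)
  have h3 : ‖a‖ ≤ ‖slashReal f r γ z‖ + ‖slashReal f r γ z - a‖ := by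
    have := norm_sub_le (slashReal f r γ z) (slashReal f r γ z - a)
    simpa using this
  linarith

/-- Every value of the invariant norm is attained high up in one of finitely many cusps. -/
theorem IsModularFormOfWeight.exists_petNorm_eq (hf : IsModularFormOfWeight f r Γ μ)
    (z : UpperHalfPlane) : ∃ (σ : SL(2, ℤ)) (c : SL(2, ℤ) ⧸ Γ), 1 / 2 ≤ (σ • z).im ∧
      petNorm f r z = ‖slashReal f r c.out⁻¹ (σ • z)‖ * (σ • z).im ^ (r / 2) := by
  obtain ⟨σ, hσ⟩ := ModularGroup.exists_one_half_le_im_smul z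
  refine ⟨σ, (σ : SL(2, ℤ) ⧸ Γ), hσ, ?_⟩
  -- Since h and σ lie in the same coset, h⁻¹σz is Γ-equivalent to z. Only finitely many slashes, by
  -- the h⁻¹, are therefore needed.
  set h := (σ : SL(2, ℤ) ⧸ Γ).out with hh
  have hmem : h⁻¹ * σ ∈ Γ := by
    rw [← QuotientGroup.eq, hh, QuotientGroup.out_eq']
  rw [norm_slashReal_mul, ← mul_smul]
  exact (hf.le_petStabilizer (Subgroup.mem_sup_left hmem) z).symm

/-- The denominator satisfies |cz+d| ≥ 1 if c = 0, and |cz+d| ≥ Im z otherwise. -/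
theorem im_smul_le_max (σ : SL(2, ℤ)) (z : UpperHalfPlane) :
    (σ • z).im ≤ max z.im z.im⁻¹ := by
  have hy := z.im_pos
  rw [im_smul_eq_div_norm_cocycleFactor]
  have hn := norm_cocycleFactor_pos σ z
  rw [div_le_iff₀ (by positivity)]
  by_cases hc : σ 1 0 = 0
  · have hd : (1 : ℝ) ≤ ‖cocycleFactor σ z‖ := by
      have hcf : cocycleFactor σ z = ((σ 1 1 : ℤ) : ℂ) := by
        rw [cocycleFactor, hc]; simp
      rw [hcf] at hn ⊢
      rw [Complex.norm_intCast] at hn ⊢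
      have h0 : σ 1 1 ≠ 0 := by
        intro h; rw [h] at hn; simp at hn
      exact_mod_cast Int.one_le_abs h0
    have h1 := le_max_left z.im z.im⁻¹
    have h2 : 1 ≤ ‖cocycleFactor σ z‖ ^ 2 := by nlinarith
    nlinarith
  · have hlow : z.im ≤ ‖cocycleFactor σ z‖ := by
      refine le_trans ?_ (Complex.abs_im_le_norm _)
      have hc1 : (1 : ℝ) ≤ |((σ 1 0 : ℤ) : ℝ)| := by exact_mod_cast Int.one_le_abs hc
      rw [cocycleFactor]
      simp only [Complex.add_im, Complex.mul_im, Complex.intCast_re, Complex.intCast_im, zero_mul,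
        add_zero, abs_mul, UpperHalfPlane.coe_im]
      rw [abs_of_pos hy]
      nlinarith
    have h1 := le_max_right z.im z.im⁻¹
    calc z.im = z.im⁻¹ * z.im ^ 2 := by field_simp
      _ ≤ max z.im z.im⁻¹ * ‖cocycleFactor σ z‖ ^ 2 := by gcongr

/-- After moving to height at least 1/2, one of finitely many bounded slashed functions remains, and
the weight is controlled by the largest height on the modular orbit. -/
theorem IsModularFormOfWeight.exists_petNorm_le (hf : IsModularFormOfWeight f r Γ μ) (hr : 0 < r)
    (hΓ : Γ.FiniteIndex) (hf0 : f ≠ 0) :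
    ∃ C : ℝ, 0 ≤ C ∧ ∀ (γ : SL(2, ℤ)) (z : UpperHalfPlane),
      petNorm f r (γ • z) ≤ C * (z.im ^ (r / 2) + z.im ^ (-(r / 2))) := by
  choose C hC0 hC using fun c : SL(2, ℤ) ⧸ Γ =>
    hf.exists_norm_slashReal_le hΓ hf0 c.out⁻¹ (y₀ := 1 / 2) (by norm_num)
  have := Fintype.ofFinite (SL(2, ℤ) ⧸ Γ)
  refine ⟨∑ c, C c, Finset.sum_nonneg fun c _ => hC0 c, fun γ z => ?_⟩
  obtain ⟨σ, c, hσ, hz⟩ := hf.exists_petNorm_eq (γ • z)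
  rw [hz]
  have hy := z.im_pos
  have h1 := Real.rpow_nonneg hy.le (r / 2)
  have h2 := Real.rpow_nonneg hy.le (-(r / 2))
  refine mul_le_mul ?_ ?_ (Real.rpow_nonneg (UpperHalfPlane.im_pos _).le _)
    (Finset.sum_nonneg fun c _ => hC0 c)
  · exact (hC c _ hσ).trans (Finset.single_le_sum (fun c _ => hC0 c) (Finset.mem_univ c))
  · rw [← mul_smul]
    refine (Real.rpow_le_rpow (UpperHalfPlane.im_pos _).le (im_smul_le_max (σ * γ) z)
      (by positivity)).trans ?_
    rcases max_cases z.im z.im⁻¹ with ⟨h, -⟩ | ⟨h, -⟩ <;> rw [h]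
    · linarith
    · rw [Real.inv_rpow hy.le, ← Real.rpow_neg hy.le]; linarith

/-- At every cusp exponential decay beats the factor (Im z)^{r/2}, so the invariant norm stays
bounded. -/
theorem IsModularFormOfWeight.exists_petNorm_le_of_isCuspForm (hf : IsModularFormOfWeight f r Γ μ)
    (hΓ : Γ.FiniteIndex) (hf0 : f ≠ 0) (hcusp : IsCuspFormOn f r Γ) :
    ∃ C : ℝ, 0 ≤ C ∧ ∀ z : UpperHalfPlane, petNorm f r z ≤ C := by
  have key : ∀ c : SL(2, ℤ) ⧸ Γ, ∃ C : ℝ, 0 ≤ C ∧ ∀ w : UpperHalfPlane, 1 / 2 ≤ w.im →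
      ‖slashReal f r c.out⁻¹ w‖ * w.im ^ (r / 2) ≤ C := by
    intro c
    obtain ⟨C, ε, hC, hε, h⟩ := hf.exists_norm_slashReal_le_exp hΓ hf0 (γ := c.out⁻¹)
      (hcusp _ _ rfl) (y₀ := 1 / 2) (by norm_num)
    obtain ⟨D, hD0, hD⟩ := exists_bound_rpow_mul_exp_neg (K := r / 2) (y₀ := 1 / 2) hε
      (by norm_num)
    refine ⟨C * D, by positivity, fun w hw => ?_⟩
    · calc _ ≤ C * Real.exp (-(ε * w.im)) * w.im ^ (r / 2) := by
            gcongr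
            exact h w hw
        _ = C * (w.im ^ (r / 2) * Real.exp (-(ε * w.im))) := by ring
        _ ≤ C * D := by gcongr; exact hD _ hw
  choose C hC0 hC using key
  have := Fintype.ofFinite (SL(2, ℤ) ⧸ Γ)
  refine ⟨∑ c, C c, Finset.sum_nonneg fun c _ => hC0 c, fun z => ?_⟩
  obtain ⟨σ, c, hσ, hz⟩ := hf.exists_petNorm_eq z
  rw [hz]
  exact (hC c _ hσ).trans (Finset.single_le_sum (fun c _ => hC0 c) (Finset.mem_univ c))

theorem alphaZero_of_isCuspForm (h : IsCuspFormOn f r Γ) : alphaZero f r Γ = r / 2 := if_pos h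

theorem alphaZero_of_not_isCuspForm (h : ¬ IsCuspFormOn f r Γ) : alphaZero f r Γ = r := if_neg h

theorem alphaZero_pos (hr : 0 < r) : 0 < alphaZero f r Γ := by
  rw [alphaZero]; split_ifs <;> linarith

theorem half_le_alphaZero (hr : 0 < r) : r / 2 ≤ alphaZero f r Γ := by
  rw [alphaZero]; split_ifs <;> linarith

/-- The origin of α₀: near the real line the invariant norm is O(1) for cusp forms and O(y^{-r/2})
otherwise. Removing its weight multiplies by a further y^{-r/2}. -/
theorem IsModularFormOfWeight.exists_norm_slashReal_le_rpow (hf : IsModularFormOfWeight f r Γ μ)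
    (hr : 0 < r) (hΓ : Γ.FiniteIndex) (hf0 : f ≠ 0) (γ : SL(2, ℤ)) :
    ∃ C : ℝ, 0 ≤ C ∧ ∀ z : UpperHalfPlane, z.im ≤ 1 →
      ‖slashReal f r γ z‖ ≤ C * z.im ^ (-alphaZero f r Γ) := by
  by_cases hcusp : IsCuspFormOn f r Γ
  · obtain ⟨C, hC0, hC⟩ := hf.exists_petNorm_le_of_isCuspForm hΓ hf0 hcusp
    refine ⟨C, hC0, fun z hz => ?_⟩
    rw [norm_slashReal_eq, alphaZero_of_isCuspForm hcusp]
    have := Real.rpow_nonneg z.im_pos.le (-(r / 2))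
    gcongr
    exact hC _
  · obtain ⟨C, hC0, hC⟩ := hf.exists_petNorm_le hr hΓ hf0
    refine ⟨2 * C, by positivity, fun z hz => ?_⟩
    have hy := z.im_pos
    rw [norm_slashReal_eq, alphaZero_of_not_isCuspForm hcusp]
    have h1 := Real.rpow_nonneg hy.le (-(r / 2))
    have h2 : z.im ^ (r / 2) ≤ z.im ^ (-(r / 2)) :=
      Real.rpow_le_rpow_of_exponent_ge hy hz (by linarith)
    calc _ ≤ C * (z.im ^ (-(r / 2)) + z.im ^ (-(r / 2))) * z.im ^ (-(r / 2)) := by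
          gcongr
          exact (hC γ z).trans (by gcongr)
      _ = 2 * C * (z.im ^ (-(r / 2)) * z.im ^ (-(r / 2))) := by ring
      _ = 2 * C * z.im ^ (-r) := by
          rw [← Real.rpow_add hy]; congr 2; ring

/-- Decay of the slashed function, without its constant term, in the whole half-plane. -/
theorem IsModularFormOfWeight.exists_norm_slashReal_sub_le (hf : IsModularFormOfWeight f r Γ μ)
    (hr : 0 < r) (hΓ : Γ.FiniteIndex) (hf0 : f ≠ 0) (γ : SL(2, ℤ)) {a : ℂ}
    (ha0 : 0 < cuspParameter f r Γ γ → a = 0)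
    (ha1 : cuspParameter f r Γ γ = 0 → a = cuspCoeff f r Γ γ 0) {M : ℝ}
    (hM : alphaZero f r Γ ≤ M) :
    ∃ C : ℝ, ∀ z : UpperHalfPlane, ‖slashReal f r γ z - a‖ ≤ C * z.im ^ (-M) := by
  obtain ⟨C₁, hC₁, h₁⟩ := hf.exists_norm_slashReal_le_rpow hr hΓ hf0 γ
  obtain ⟨C₂, ε, hC₂, hε, h₂⟩ := hf.exists_norm_slashReal_sub_le_exp hΓ hf0 γ ha0 ha1 one_pos
  obtain ⟨D, hD0, hD⟩ := exists_bound_rpow_mul_exp_neg (K := M) hε one_pos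
  have hα := alphaZero_pos (f := f) (Γ := Γ) hr
  refine ⟨max (C₁ + ‖a‖) (C₂ * D), fun z => ?_⟩
  have hy := z.im_pos
  have hyM := Real.rpow_pos_of_pos hy (-M)
  rcases le_total z.im 1 with hz | hz
  · have e1 : z.im ^ (-alphaZero f r Γ) ≤ z.im ^ (-M) :=
      Real.rpow_le_rpow_of_exponent_ge hy hz (by linarith)
    have e2 : 1 ≤ z.im ^ (-M) := Real.one_le_rpow_of_pos_of_le_one_of_nonpos hy hz (by linarith)
    calc ‖slashReal f r γ z - a‖ ≤ ‖slashReal f r γ z‖ + ‖a‖ := norm_sub_le _ _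
      _ ≤ C₁ * z.im ^ (-M) + ‖a‖ * z.im ^ (-M) := by
          gcongr
          · exact (h₁ z hz).trans (by gcongr)
          · exact le_mul_of_one_le_right (norm_nonneg _) e2
      _ = (C₁ + ‖a‖) * z.im ^ (-M) := by ring
      _ ≤ _ := by gcongr; exact le_max_left _ _
  · have e1 : z.im ^ M * z.im ^ (-M) = 1 := by
      rw [← Real.rpow_add hy, add_neg_cancel, Real.rpow_zero]
    calc ‖slashReal f r γ z - a‖ ≤ C₂ * Real.exp (-(ε * z.im)) := h₂ z hz
      _ = C₂ * (z.im ^ M * Real.exp (-(ε * z.im))) * z.im ^ (-M) := by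
          rw [mul_comm (z.im ^ M), ← mul_assoc, mul_assoc (C₂ * _), e1, mul_one]
      _ ≤ C₂ * D * z.im ^ (-M) := by
          gcongr
          exact hD _ hz
      _ ≤ _ := by gcongr; exact le_max_right _ _

theorem IsModularFormOfWeight.exists_norm_slashReal_le_of_cuspidal
    (hf : IsModularFormOfWeight f r Γ μ) (hr : 0 < r) (hΓ : Γ.FiniteIndex) (hf0 : f ≠ 0)
    {γ : SL(2, ℤ)} (hγ : 0 < cuspParameter f r Γ γ ∨ cuspCoeff f r Γ γ 0 = 0) {M : ℝ}
    (hM : alphaZero f r Γ ≤ M) :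
    ∃ C : ℝ, ∀ z : UpperHalfPlane, ‖slashReal f r γ z‖ ≤ C * z.im ^ (-M) := by
  simpa using hf.exists_norm_slashReal_sub_le hr hΓ hf0 γ (a := 0) (fun _ => rfl)
    (fun h => (hγ.resolve_left (by rw [h]; exact lt_irrefl 0)).symm) hM

end

/-! ### Modular forms without their constant term -/

/-- The constant term of the Fourier expansion at `∞`. -/
noncomputable def cuspConst (f : UpperHalfPlane → ℂ) (r : ℝ) (Γ : Subgroup SL(2, ℤ)) : ℂ :=
  if cuspParameter f r Γ 1 = 0 then cuspCoeff f r Γ 1 0 else 0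

/-- A modular form without its constant term, on the complex plane. -/
noncomputable def reducedForm (f : UpperHalfPlane → ℂ) (r : ℝ) (Γ : Subgroup SL(2, ℤ)) : ℂ → ℂ :=
  fun w => (f ∘ UpperHalfPlane.ofComplex) w - cuspConst f r Γ

/-- The frequencies in the Fourier expansion at `∞`. -/
noncomputable def cuspFreq (f : UpperHalfPlane → ℂ) (r : ℝ) (Γ : Subgroup SL(2, ℤ)) (n : ℕ) : ℝ :=
  2 * Real.pi * (n + cuspParameter f r Γ 1) / (cuspWidth Γ OnePoint.infty : ℝ)

/-- The coefficients of positive frequency in the Fourier expansion at `∞`. -/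
noncomputable def reducedCoeff (f : UpperHalfPlane → ℂ) (r : ℝ) (Γ : Subgroup SL(2, ℤ)) (n : ℕ) :
    ℂ :=
  if 0 < (n : ℝ) + cuspParameter f r Γ 1 then cuspCoeff f r Γ 1 n else 0

section

variable {f : UpperHalfPlane → ℂ} {r : ℝ} {Γ : Subgroup SL(2, ℤ)} {μ : Γ → ℂ}

theorem reducedForm_coe (z : UpperHalfPlane) :
    reducedForm f r Γ z = f z - cuspConst f r Γ := by
  simp [reducedForm]

theorem IsModularFormOfWeight.differentiableOn_reducedForm (hf : IsModularFormOfWeight f r Γ μ) :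
    DifferentiableOn ℂ (reducedForm f r Γ) {z | 0 < z.im} :=
  hf.holo.sub_const _

theorem deriv_reducedForm : deriv (reducedForm f r Γ) = deriv (f ∘ UpperHalfPlane.ofComplex) := by
  ext z
  exact deriv_sub_const _

/-- Without the constant term there is exponential decay at i∞. Every exponent from α₀ on is then
admissible: the smallest governs the real line, larger ones give integrability at infinity. -/
theorem IsModularFormOfWeight.verticalDecay_reducedForm (hf : IsModularFormOfWeight f r Γ μ)
    (hr : 0 < r) (hΓ : Γ.FiniteIndex) (hf0 : f ≠ 0) :
    VerticalDecay (reducedForm f r Γ) (alphaZero f r Γ) := by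
  intro M hM
  obtain ⟨C, hC⟩ := hf.exists_norm_slashReal_sub_le hr hΓ hf0 1 (a := cuspConst f r Γ)
    (fun h => if_neg h.ne') (fun h => if_pos h) hM
  refine ⟨C, fun z hz => ?_⟩
  have := hC ⟨z, hz⟩
  rw [slashReal_one] at this
  have h2 := reducedForm_coe (f := f) (r := r) (Γ := Γ) ⟨z, hz⟩
  rw [UpperHalfPlane.coe_mk] at h2
  rw [h2]
  exact this

/-- This is the Taylor series of the cusp function in q. Removing the constant term discards
frequency 0, so the remaining ones are at least 2π/m, or 2πκ/m if κ > 0. -/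
theorem IsModularFormOfWeight.hasExpSeries_reducedForm (hf : IsModularFormOfWeight f r Γ μ)
    (hΓ : Γ.FiniteIndex) (hf0 : f ≠ 0) :
    HasExpSeries (reducedForm f r Γ) (reducedCoeff f r Γ) (cuspFreq f r Γ) := by
  obtain ⟨Φ, hΦ, hexp, hcoeff⟩ := hf.exists_cuspFunction hΓ hf0 1
  obtain ⟨hκ0, hκ1, -⟩ := hf.cuspParameter_spec hf0 1
  rw [cuspOf_one] at hexp
  set κ := cuspParameter f r Γ 1 with hκ
  set m : ℝ := ((cuspWidth Γ OnePoint.infty : ℕ) : ℝ) with hm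
  have hm0 : 0 < m := Nat.cast_pos.2 (cuspWidth_pos hΓ _)
  have hmcast : ((cuspWidth Γ OnePoint.infty : ℕ) : ℂ) = (m : ℂ) := by rw [hm]; simp
  rw [hmcast] at hexp
  have hpi := Real.pi_pos
  constructor
  · intro w hw
    set q := Complex.exp (2 * Real.pi * Complex.I * w / m) with hq
    set e := Complex.exp (2 * Real.pi * Complex.I * κ * w / m) with he
    have hq1 : ‖q‖ < 1 := by
      rw [hq, norm_exp_two_pi_I_div]
      exact Real.exp_lt_one_iff.2 (neg_lt_zero.2 (by positivity))
    have h1 := Complex.hasSum_taylorSeries_on_ball (z := q) hΦ (by simpa using hq1)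
    have h2 := h1.mul_left e
    have h3 : reducedForm f r Γ w = e * Φ q - cuspConst f r Γ := by
      have h4 := reducedForm_coe (f := f) (r := r) (Γ := Γ) ⟨w, hw⟩
      have h5 := hexp ⟨w, hw⟩
      rw [slashReal_one] at h5
      rw [UpperHalfPlane.coe_mk] at h4 h5
      rw [h4, h5]
    rw [h3]
    refine (h2.sub (hasSum_ite_eq 0 (cuspConst f r Γ))).congr_fun ?_
    intro n
    have hterm : e * ((n.factorial : ℂ)⁻¹ • (q - 0) ^ n • iteratedDeriv n Φ 0) =
        cuspCoeff f r Γ 1 n * Complex.exp (Complex.I * cuspFreq f r Γ n * w) := by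
      rw [hcoeff n]
      have : Complex.exp (Complex.I * cuspFreq f r Γ n * w) = e * q ^ n := by
        rw [he, hq, ← Complex.exp_nat_mul, ← Complex.exp_add, cuspFreq]
        congr 1
        push_cast
        rw [hmcast]
        ring
      rw [this, smul_eq_mul, smul_eq_mul, sub_zero]
      ring
    rw [hterm, reducedCoeff]
    by_cases hn : 0 < (n : ℝ) + cuspParameter f r Γ 1
    · rw [if_pos hn]
      split_ifs with h0
      · have : cuspParameter f r Γ 1 ≠ 0 := by
          rw [h0] at hn; simp at hn; exact hn.ne'
        rw [cuspConst, if_neg this, sub_zero]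
      · rw [sub_zero]
    · have hn0 : n = 0 := by
        by_contra h
        have : (1 : ℝ) ≤ n := by exact_mod_cast Nat.one_le_iff_ne_zero.2 h
        exact hn (by linarith)
      subst hn0
      have hκz : cuspParameter f r Γ 1 = 0 := by
        simp at hn; linarith
      rw [if_neg hn, if_pos rfl, cuspConst, if_pos hκz, cuspFreq, hκz]
      simp
  · rcases hκ0.eq_or_lt with hκz | hκp
    · refine ⟨2 * Real.pi / m, by positivity, fun n hn => ?_⟩
      have hpos : 0 < (n : ℝ) + cuspParameter f r Γ 1 := by
        by_contra h; exact hn (if_neg h)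
      rw [← hκ, ← hκz, add_zero] at hpos
      have : (1 : ℝ) ≤ n := by exact_mod_cast Nat.cast_pos.1 hpos
      rw [cuspFreq, ← hκ, ← hκz, add_zero, ← hm]
      rw [div_le_div_iff_of_pos_right hm0]
      exact le_mul_of_one_le_right (by positivity) this
    · refine ⟨2 * Real.pi * κ / m, by positivity, fun n hn => ?_⟩
      rw [cuspFreq, ← hκ, ← hm]
      gcongr
      have : (0 : ℝ) ≤ n := n.cast_nonneg
      linarith

/-! ### Behaviour near rational points -/

/-- The geometry of horoballs: the position of `γ z` with respect to the cusp `a / c`. -/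
theorem norm_smul_sub_mul (γ : SL(2, ℤ)) (hc : γ 1 0 ≠ 0) (z : UpperHalfPlane) :
    ‖((γ • z : UpperHalfPlane) : ℂ) - (((γ 0 0 : ℝ) / (γ 1 0 : ℝ) : ℝ) : ℂ)‖ *
      (|(γ 1 0 : ℝ)| * ‖cocycleFactor γ z‖) = 1 := by
  have hcC : ((γ 1 0 : ℤ) : ℂ) ≠ 0 := by exact_mod_cast hc
  have hcf := cocycleFactor_ne_zero γ z
  have hdet := Matrix.det_fin_two (γ : Matrix (Fin 2) (Fin 2) ℤ)
  rw [γ.det_coe] at hdet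
  have hdetC : (1 : ℂ) = ((γ 0 0 : ℤ) : ℂ) * ((γ 1 1 : ℤ) : ℂ) -
      ((γ 0 1 : ℤ) : ℂ) * ((γ 1 0 : ℤ) : ℂ) := by exact_mod_cast hdet
  have h1 : (((γ • z : UpperHalfPlane) : ℂ) - (((γ 0 0 : ℝ) / (γ 1 0 : ℝ) : ℝ) : ℂ)) *
      (((γ 1 0 : ℤ) : ℂ) * cocycleFactor γ z) = -1 := by
    rw [coe_smul_eq_div_cocycleFactor]
    push_cast
    field_simp
    rw [cocycleFactor]
    linear_combination hdetC
  have h2 := congrArg norm h1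
  rw [norm_mul, norm_mul, Complex.norm_intCast, norm_neg, norm_one] at h2
  exact h2

/-- The size of `f` at `γ z` in terms of the slashed function at `z`. -/
theorem norm_apply_smul_eq (r : ℝ) (γ : SL(2, ℤ)) (hc : γ 1 0 ≠ 0) (z : UpperHalfPlane) {ρ : ℝ}
    (hρ : ρ = ‖((γ • z : UpperHalfPlane) : ℂ) - (((γ 0 0 : ℝ) / (γ 1 0 : ℝ) : ℝ) : ℂ)‖) :
    0 < ρ ∧ (γ • z).im = z.im * (γ 1 0 : ℝ) ^ 2 * ρ ^ 2 ∧
      ‖f (γ • z)‖ = ‖slashReal f r γ z‖ * (|(γ 1 0 : ℝ)| ^ (-r) * ρ ^ (-r)) := by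
  have h := norm_smul_sub_mul γ hc z
  rw [← hρ] at h
  have hcR : 0 < |((γ 1 0 : ℤ) : ℝ)| := abs_pos.2 (by exact_mod_cast hc)
  have hn := norm_cocycleFactor_pos γ z
  have hρ0 : 0 < ρ := by
    rcases (hρ ▸ norm_nonneg _ : 0 ≤ ρ).eq_or_lt with h0 | h0
    · rw [← h0, zero_mul] at h; exact absurd h zero_ne_one
    · exact h0
  have hcf : ‖cocycleFactor γ z‖ = (|((γ 1 0 : ℤ) : ℝ)| * ρ)⁻¹ := by
    refine eq_inv_of_mul_eq_one_left ?_
    linarith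
  refine ⟨hρ0, ?_, ?_⟩
  · rw [im_smul_eq_div_norm_cocycleFactor, hcf, inv_pow, div_inv_eq_mul, mul_pow, sq_abs]
    ring
  · rw [norm_slashReal, hcf, Real.inv_rpow (by positivity), div_inv_eq_mul, mul_assoc,
      Real.mul_rpow hcR.le hρ0.le]
    have e1 : |((γ 1 0 : ℤ) : ℝ)| ^ r * |((γ 1 0 : ℤ) : ℝ)| ^ (-r) = 1 := by
      rw [← Real.rpow_add hcR, add_neg_cancel, Real.rpow_zero]
    have e2 : ρ ^ r * ρ ^ (-r) = 1 := by
      rw [← Real.rpow_add hρ0, add_neg_cancel, Real.rpow_zero]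
    rw [show |((γ 1 0 : ℤ) : ℝ)| ^ r * ρ ^ r * (|((γ 1 0 : ℤ) : ℝ)| ^ (-r) * ρ ^ (-r)) =
      (|((γ 1 0 : ℤ) : ℝ)| ^ r * |((γ 1 0 : ℤ) : ℝ)| ^ (-r)) * (ρ ^ r * ρ ^ (-r)) by ring, e1, e2]
    ring

theorem exists_cuspOf_eq_rat (x : ℚ) : ∃ γ : SL(2, ℤ), cuspOf γ = (x : OnePoint ℚ) ∧
    γ 1 0 ≠ 0 ∧ ((γ 0 0 : ℝ) / (γ 1 0 : ℝ) : ℝ) = x := by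
  obtain ⟨γ, hγ⟩ := exists_cuspOf_eq (x : OnePoint ℚ)
  have hc : γ 1 0 ≠ 0 := by
    intro h
    rw [(cuspOf_eq_infty_iff γ).2 h] at hγ
    exact OnePoint.infty_ne_coe x hγ
  refine ⟨γ, hγ, hc, ?_⟩
  rw [cuspOf_eq_coe hc, OnePoint.coe_eq_coe] at hγ
  rw [← hγ]; push_cast; rfl

theorem ratio_eq_of_cuspOf_eq {γ : SL(2, ℤ)} {x : ℚ} (hγ : cuspOf γ = (x : OnePoint ℚ)) :
    γ 1 0 ≠ 0 ∧ ((γ 0 0 : ℝ) / (γ 1 0 : ℝ) : ℝ) = x := by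
  have hc : γ 1 0 ≠ 0 := by
    intro h
    rw [(cuspOf_eq_infty_iff γ).2 h] at hγ
    exact OnePoint.infty_ne_coe x hγ
  refine ⟨hc, ?_⟩
  rw [cuspOf_eq_coe hc, OnePoint.coe_eq_coe] at hγ
  rw [← hγ]; push_cast; rfl

/-- The decay of `f` near a rational point at which it is cuspidal. -/
theorem IsModularFormOfWeight.exists_norm_le_of_isCuspidalAt (hf : IsModularFormOfWeight f r Γ μ)
    (hr : 0 < r) (hΓ : Γ.FiniteIndex) (hf0 : f ≠ 0) {x : ℚ}
    (hx : IsCuspidalAt f r Γ (x : OnePoint ℚ)) {M : ℝ} (hM : alphaZero f r Γ ≤ M) :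
    ∃ C : ℝ, ∀ w : ℂ, 0 < w.im → ‖reducedForm f r Γ w + cuspConst f r Γ‖ ≤
      C * ‖w - ((x : ℝ) : ℂ)‖ ^ (2 * M - r) * w.im ^ (-M) := by
  obtain ⟨γ, hγ, hc, hγx⟩ := exists_cuspOf_eq_rat x
  obtain ⟨C, hC⟩ := hf.exists_norm_slashReal_le_of_cuspidal hr hΓ hf0 (hx γ hγ) hM
  have hcR : 0 < |((γ 1 0 : ℤ) : ℝ)| := abs_pos.2 (by exact_mod_cast hc)
  refine ⟨C * (((γ 1 0 : ℝ) ^ 2) ^ M * |(γ 1 0 : ℝ)| ^ (-r)), fun w hw => ?_⟩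
  set z : UpperHalfPlane := γ⁻¹ • ⟨w, hw⟩ with hz
  have hγz : γ • z = ⟨w, hw⟩ := smul_inv_smul _ _
  obtain ⟨hρ0, him, hnorm⟩ := norm_apply_smul_eq (f := f) r γ hc z rfl
  rw [hγz, hγx, UpperHalfPlane.coe_mk] at hρ0 him hnorm
  have him' : w.im = z.im * (γ 1 0 : ℝ) ^ 2 * ‖w - ((x : ℝ) : ℂ)‖ ^ 2 := him
  set ρ := ‖w - ((x : ℝ) : ℂ)‖ with hρ
  have h2 := reducedForm_coe (f := f) (r := r) (Γ := Γ) ⟨w, hw⟩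
  rw [UpperHalfPlane.coe_mk] at h2
  rw [h2, sub_add_cancel, hnorm]
  have hy := z.im_pos
  have hc2 : 0 < ((γ 1 0 : ℤ) : ℝ) ^ 2 := by rw [← sq_abs]; positivity
  -- Here Im z = Im w/(c²ρ²), so decay of order M at z contributes ρ^{2M}(Im w)^{-M}. The automorphy
  -- factor contributes the remaining ρ^{-r}.
  have hzim : z.im ^ (-M) = ((γ 1 0 : ℝ) ^ 2) ^ M * ρ ^ (2 * M) * w.im ^ (-M) := by
    rw [him', Real.mul_rpow (by positivity) (by positivity), Real.mul_rpow hy.le hc2.le,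
      Real.rpow_neg hc2.le, ← Real.rpow_natCast ρ, ← Real.rpow_mul hρ0.le, mul_neg,
      Real.rpow_neg hρ0.le]
    have := Real.rpow_pos_of_pos hc2 M
    have := Real.rpow_pos_of_pos hρ0 (2 * M)
    push_cast
    field_simp
  calc ‖slashReal f r γ z‖ * (|((γ 1 0 : ℤ) : ℝ)| ^ (-r) * ρ ^ (-r))
      ≤ C * z.im ^ (-M) * (|((γ 1 0 : ℤ) : ℝ)| ^ (-r) * ρ ^ (-r)) := by
        gcongr
        exact hC z
    _ = C * (((γ 1 0 : ℝ) ^ 2) ^ M * |(γ 1 0 : ℝ)| ^ (-r)) * (ρ ^ (2 * M) * ρ ^ (-r)) *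
        w.im ^ (-M) := by rw [hzim]; ring
    _ = _ := by rw [← Real.rpow_add hρ0, ← sub_eq_add_neg]

/-- The constant removed from f is negligible against ρ^{-r} as ρ → 0, so lower bounds for f pass to
the reduced form. -/
theorem eventually_half_le_sub_const {l : Filter ℝ} {c r : ℝ} (hc : 0 < c) (hr : 0 < r) (a : ℝ)
    (hl : l ≤ 𝓝[>] 0) : ∀ᶠ ρ in l, c / 2 * ρ ^ (-r) ≤ c * ρ ^ (-r) - a := by
  have h := (tendsto_rpow_neg_nhdsGT_zero (y := -r) (by linarith)).eventually_ge_atTop (a / (c / 2))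
  filter_upwards [hl h] with ρ hρ
  rw [div_le_iff₀ (by positivity)] at hρ
  linarith

/-- A form which does not vanish at a cusp is large on the vertical ray ending there. -/
theorem exists_le_norm_reducedForm_ray (hr : 0 < r) {γ : SL(2, ℤ)} (hc : γ 1 0 ≠ 0) {c V : ℝ}
    (hc0 : 0 < c) (hV : 0 < V)
    (h : ∀ z : UpperHalfPlane, V ≤ z.im → c ≤ ‖slashReal f r γ z‖) {x : ℝ}
    (hx : ((γ 0 0 : ℝ) / (γ 1 0 : ℝ) : ℝ) = x) :
    ∃ c' > 0, ∀ᶠ y : ℝ in 𝓝[>] 0,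
      c' * y ^ (-r) ≤ ‖reducedForm f r Γ ((x : ℂ) + Complex.I * y)‖ := by
  have hcR : 0 < |((γ 1 0 : ℤ) : ℝ)| := abs_pos.2 (by exact_mod_cast hc)
  have hc2 : 0 < ((γ 1 0 : ℤ) : ℝ) ^ 2 := by rw [← sq_abs]; positivity
  have hcr := Real.rpow_pos_of_pos hcR (-r)
  have hc1 : 0 < c * |((γ 1 0 : ℤ) : ℝ)| ^ (-r) := by positivity
  refine ⟨c * |((γ 1 0 : ℤ) : ℝ)| ^ (-r) / 2, by positivity, ?_⟩
  have hη : 0 < (V * (γ 1 0 : ℝ) ^ 2)⁻¹ := by positivity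
  filter_upwards [eventually_half_le_sub_const hc1 hr ‖cuspConst f r Γ‖ le_rfl,
    self_mem_nhdsWithin, mem_nhdsWithin_of_mem_nhds (Iio_mem_nhds hη)] with y hy hy0 hyη
  have hy0 : 0 < y := hy0
  refine hy.trans ?_
  have hwim : ((x : ℂ) + Complex.I * y).im = y := by simp
  have hw : 0 < ((x : ℂ) + Complex.I * y).im := by rwa [hwim]
  set w := (x : ℂ) + Complex.I * y with hwdef
  set z : UpperHalfPlane := γ⁻¹ • ⟨w, hw⟩ with hz
  have hγz : γ • z = ⟨w, hw⟩ := smul_inv_smul _ _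
  have hwx : ‖w - (x : ℂ)‖ = y := by
    rw [hwdef, add_sub_cancel_left, norm_mul, Complex.norm_I, one_mul, Complex.norm_real,
      Real.norm_eq_abs, abs_of_pos hy0]
  obtain ⟨-, him, hnorm⟩ := norm_apply_smul_eq (f := f) r γ hc z rfl
  rw [hγz, hx, UpperHalfPlane.coe_mk, hwx] at him hnorm
  have him' : y = z.im * (γ 1 0 : ℝ) ^ 2 * y ^ 2 := by
    rw [← him]; exact hwim.symm
  -- On the ray |w-x| = Im w = y, so Im z = 1/(c²y), which is large when y is small.
  have hzV : V ≤ z.im := by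
    have h1 : z.im * (γ 1 0 : ℝ) ^ 2 * y = 1 := by
      apply mul_right_cancel₀ hy0.ne'
      rw [one_mul]; nlinarith
    have h2 : y * (V * (γ 1 0 : ℝ) ^ 2) < 1 := by
      rw [← lt_div_iff₀ (by positivity), one_div]; exact hyη
    by_contra hlt
    push Not at hlt
    have : z.im * (γ 1 0 : ℝ) ^ 2 * y < V * (γ 1 0 : ℝ) ^ 2 * y := by gcongr
    linarith
  have h2 := reducedForm_coe (f := f) (r := r) (Γ := Γ) ⟨w, hw⟩
  rw [UpperHalfPlane.coe_mk] at h2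
  rw [h2]
  refine le_trans ?_ (norm_sub_norm_le _ _)
  rw [hnorm, mul_assoc]
  gcongr
  exact h z hzV

/-- Near every rational point there is a horocycle on which `f` is large. -/
theorem IsModularFormOfWeight.exists_horocycle (hf : IsModularFormOfWeight f r Γ μ)
    (hr : 0 < r) (hΓ : Γ.FiniteIndex) (hf0 : f ≠ 0) (x : ℚ) :
    ∃ c v : ℝ, 0 < c ∧ 0 < v ∧ ∃ w : ℕ → ℂ, Tendsto w atTop (𝓝 ((x : ℝ) : ℂ)) ∧
      ∀ᶠ N in atTop, 0 < (w N).im ∧ (w N).im = v * ‖w N - ((x : ℝ) : ℂ)‖ ^ 2 ∧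
        c * ‖w N - ((x : ℝ) : ℂ)‖ ^ (-r) ≤ ‖reducedForm f r Γ (w N)‖ := by
  obtain ⟨γ, hγ, hc, hγx⟩ := exists_cuspOf_eq_rat x
  obtain ⟨w₀, hw₀⟩ := exists_slashReal_ne_zero hf0 r γ
  have hcR : 0 < |((γ 1 0 : ℤ) : ℝ)| := abs_pos.2 (by exact_mod_cast hc)
  have hc2 : 0 < ((γ 1 0 : ℤ) : ℝ) ^ 2 := by rw [← sq_abs]; positivity
  have hcr := Real.rpow_pos_of_pos hcR (-r)
  have hs := norm_pos_iff.2 hw₀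
  set m : ℝ := ((cuspWidth Γ (cuspOf γ) : ℕ) : ℝ) with hm
  have hm0 : 0 < m := Nat.cast_pos.2 (cuspWidth_pos hΓ _)
  have hc1 : 0 < ‖slashReal f r γ w₀‖ * |((γ 1 0 : ℤ) : ℝ)| ^ (-r) := by positivity
  -- The points w₀ + Nm stay at one height and the slashed function keeps its nonzero modulus there.
  -- Their images under γ tend to x with Im w proportional to |w-x|², whether or not f is cuspidal
  -- at x.
  set z : ℕ → UpperHalfPlane := fun N => (N * m : ℝ) +ᵥ w₀ with hz
  set w : ℕ → ℂ := fun N => ((γ • z N : UpperHalfPlane) : ℂ) with hw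
  have hprod : ∀ N, ‖w N - ((x : ℝ) : ℂ)‖ * (|((γ 1 0 : ℤ) : ℝ)| * ‖cocycleFactor γ (z N)‖) = 1 :=
    fun N => by
      have := norm_smul_sub_mul γ hc (z N)
      rwa [hγx] at this
  have hcoc : Tendsto (fun N => |((γ 1 0 : ℤ) : ℝ)| * ‖cocycleFactor γ (z N)‖) atTop atTop := by
    refine Tendsto.const_mul_atTop hcR ?_
    have hlow : ∀ N : ℕ, |((γ 1 0 : ℤ) : ℝ)| * m * N - ‖cocycleFactor γ w₀‖ ≤
        ‖cocycleFactor γ (z N)‖ := by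
      intro N
      have h1 : cocycleFactor γ (z N) = ((γ 1 0 : ℤ) : ℂ) * ((N * m : ℝ) : ℂ) +
          cocycleFactor γ w₀ := by
        rw [cocycleFactor, cocycleFactor, hz, UpperHalfPlane.coe_vadd]; ring
      have h2 := norm_sub_le (cocycleFactor γ (z N)) (cocycleFactor γ w₀)
      rw [h1, add_sub_cancel_right, ← h1, norm_mul, Complex.norm_intCast, Complex.norm_real,
        Real.norm_eq_abs, abs_of_nonneg (a := (N : ℝ) * m) (by positivity)] at h2
      linarith
    refine tendsto_atTop_mono hlow (tendsto_atTop_add_const_right _ _ ?_)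
    exact tendsto_natCast_atTop_atTop.const_mul_atTop (by positivity)
  have hnormlim : Tendsto (fun N => ‖w N - ((x : ℝ) : ℂ)‖) atTop (𝓝 0) := by
    refine (tendsto_inv_atTop_zero.comp hcoc).congr fun N => ?_
    exact (eq_inv_of_mul_eq_one_left (hprod N)).symm
  have hpos : ∀ N, 0 < ‖w N - ((x : ℝ) : ℂ)‖ := by
    intro N
    refine (norm_nonneg _).lt_of_ne fun h => ?_
    have := hprod N
    rw [← h, zero_mul] at this
    exact zero_ne_one this
  refine ⟨‖slashReal f r γ w₀‖ * |((γ 1 0 : ℤ) : ℝ)| ^ (-r) / 2, w₀.im * (γ 1 0 : ℝ) ^ 2,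
    by positivity, mul_pos w₀.im_pos hc2, w, tendsto_iff_norm_sub_tendsto_zero.2 hnormlim, ?_⟩
  have hnl : Tendsto (fun N => ‖w N - ((x : ℝ) : ℂ)‖) atTop (𝓝[>] 0) :=
    tendsto_nhdsWithin_iff.2 ⟨hnormlim, Eventually.of_forall hpos⟩
  filter_upwards [hnl.eventually
    (eventually_half_le_sub_const hc1 hr ‖cuspConst f r Γ‖ le_rfl)] with N hN
  obtain ⟨-, him, hnorm⟩ := norm_apply_smul_eq (f := f) r γ hc (z N) rfl
  rw [hγx] at him hnorm
  refine ⟨UpperHalfPlane.im_pos _, ?_, hN.trans ?_⟩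
  · rw [hw, UpperHalfPlane.coe_im, him, hz, UpperHalfPlane.vadd_im]
  · have h2 := reducedForm_coe (f := f) (r := r) (Γ := Γ) (γ • z N)
    have h3 : ‖slashReal f r γ (z N)‖ = ‖slashReal f r γ w₀‖ :=
      norm_slashReal_vadd_nat_mul_cuspWidth hf γ N w₀
    change _ ≤ ‖reducedForm f r Γ ((γ • z N : UpperHalfPlane) : ℂ)‖
    rw [h2]
    refine le_trans (le_of_eq ?_) (norm_sub_norm_le _ _)
    rw [hnorm, h3, mul_assoc]

theorem exists_not_cuspidal (h : ¬ IsCuspFormOn f r Γ) : ∃ γ : SL(2, ℤ),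
    ¬ (0 < cuspParameter f r Γ γ ∨ cuspCoeff f r Γ γ 0 = 0) := by
  rw [IsCuspFormOn] at h
  push Not at h
  obtain ⟨𝔞, h⟩ := h
  rw [IsCuspidalAt] at h
  push Not at h
  obtain ⟨γ, -, h⟩ := h
  exact ⟨γ, by push Not; exact h⟩

theorem IsModularFormOfWeight.exists_le_norm_ray_of_not_isCuspidalAt
    (hf : IsModularFormOfWeight f r Γ μ) (hr : 0 < r) (hΓ : Γ.FiniteIndex) (hf0 : f ≠ 0) {x : ℚ}
    (hx : ¬ IsCuspidalAt f r Γ (x : OnePoint ℚ)) :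
    ∃ c > 0, ∀ᶠ y : ℝ in 𝓝[>] 0,
      c * y ^ (-r) ≤ ‖reducedForm f r Γ (((x : ℝ) : ℂ) + Complex.I * y)‖ := by
  rw [IsCuspidalAt] at hx
  push Not at hx
  obtain ⟨γ, hγ, h⟩ := hx
  obtain ⟨c, V, hc0, hV, hb⟩ := hf.exists_le_norm_slashReal hΓ hf0 (γ := γ) (by push Not; exact h)
  obtain ⟨hc, hγx⟩ := ratio_eq_of_cuspOf_eq hγ
  exact exists_le_norm_reducedForm_ray hr hc hc0 hV hb hγx

/-- If `f` is not a cusp form, then the points above which it is large are dense near `ℚ`. -/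
theorem IsModularFormOfWeight.exists_le_norm_ray_of_not_isCuspForm
    (hf : IsModularFormOfWeight f r Γ μ) (hr : 0 < r) (hΓ : Γ.FiniteIndex) (hf0 : f ≠ 0)
    (hncf : ¬ IsCuspFormOn f r Γ) (x : ℚ) {U : Set ℝ} (hU : U ∈ 𝓝 (x : ℝ)) :
    ∃ x₁ ∈ U, ∃ c > 0, ∀ᶠ y : ℝ in 𝓝[>] 0,
      c * y ^ (-r) ≤ ‖reducedForm f r Γ ((x₁ : ℂ) + Complex.I * y)‖ := by
  obtain ⟨γ₁, hγ₁⟩ := exists_not_cuspidal hncf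
  obtain ⟨c, V, hc0, hV, hb⟩ := hf.exists_le_norm_slashReal hΓ hf0 hγ₁
  obtain ⟨γ₀, hγ₀, hγ₀c, hγ₀x⟩ := exists_cuspOf_eq_rat x
  set B := γ₀⁻¹ * γ₁ with hB
  have hγB : γ₁ = γ₀ * B := by rw [hB, mul_inv_cancel_left]
  by_cases hs : B 1 0 = 0
  · have hcusp : cuspOf γ₁ = (x : OnePoint ℚ) := by
      rw [hγB, cuspOf_mul, (cuspOf_eq_infty_iff B).2 hs]
      exact hγ₀
    obtain ⟨h1, h2⟩ := ratio_eq_of_cuspOf_eq hcusp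
    exact ⟨x, mem_of_mem_nhds hU, exists_le_norm_reducedForm_ray hr h1 hc0 hV hb h2⟩
  -- P is parabolic with fixed point x and preserves the invariant norm. Its powers move the
  -- non-cuspidal cusp γ₁(∞) to points converging to x, and the lower bound travels along.
  · set P := γ₀ * ModularGroup.T ^ cuspWidth Γ (cuspOf γ₀) * γ₀⁻¹ with hP
    set m := cuspWidth Γ (cuspOf γ₀) with hm
    have hm0 : 0 < m := cuspWidth_pos hΓ _
    have hPmem : P ∈ petStabilizer f r := hf.le_petStabilizer (conj_T_pow_cuspWidth_mem Γ γ₀)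
    -- The first column is affine in N with slope proportional to the first column of γ₀, so the
    -- ratio of its entries tends to x.
    have hent : ∀ (N : ℕ) (i : Fin 2), (P ^ N * γ₁) i 0 =
        γ₀ i 0 * (B 0 0 + (m * N : ℕ) * B 1 0) + γ₀ i 1 * B 1 0 := by
      intro N i
      have e1 : P ^ N * γ₁ = γ₀ * (ModularGroup.T ^ ((m * N : ℕ) : ℤ) * B) := by
        rw [hP, conj_pow, hγB, ← pow_mul, zpow_natCast]
        group
      rw [e1]
      simp only [Matrix.SpecialLinearGroup.coe_mul, ModularGroup.coe_T_zpow]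
      simp [Matrix.mul_apply, Matrix.vecMul, dotProduct, Fin.sum_univ_two]
    have hslope : ((B 1 0 : ℤ) : ℝ) * m ≠ 0 :=
      mul_ne_zero (by exact_mod_cast hs) (by exact_mod_cast hm0.ne')
    have hent' : ∀ i : Fin 2, Tendsto (fun N : ℕ => ((P ^ N * γ₁) i 0 : ℝ) / N) atTop
        (𝓝 ((γ₀ i 0 : ℝ) * ((B 1 0 : ℤ) * m))) := by
      intro i
      have h0 : Tendsto (fun N : ℕ => ((γ₀ i 0 : ℝ) * B 0 0 + γ₀ i 1 * B 1 0) / (N : ℝ)) atTop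
          (𝓝 0) := tendsto_const_div_atTop_nhds_zero_nat _
      have h1 := h0.add_const ((γ₀ i 0 : ℝ) * ((B 1 0 : ℤ) * m))
      rw [zero_add] at h1
      refine h1.congr' ?_
      filter_upwards [eventually_gt_atTop 0] with N hN
      have hN' : (N : ℝ) ≠ 0 := by exact_mod_cast hN.ne'
      rw [hent N i]
      push_cast
      field_simp
      ring
    have hγ₀cR : ((γ₀ 1 0 : ℤ) : ℝ) ≠ 0 := by exact_mod_cast hγ₀c
    have hq : Tendsto (fun N : ℕ => ((P ^ N * γ₁) 0 0 : ℝ) / ((P ^ N * γ₁) 1 0 : ℝ)) atTop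
        (𝓝 (x : ℝ)) := by
      have h1 := (hent' 0).div (hent' 1) (mul_ne_zero hγ₀cR hslope)
      rw [mul_div_mul_right _ _ hslope, hγ₀x] at h1
      refine h1.congr' ?_
      filter_upwards [eventually_gt_atTop 0] with N hN
      have hN' : (N : ℝ) ≠ 0 := by exact_mod_cast hN.ne'
      exact div_div_div_cancel_right₀ hN' _ _
    have hne := (hent' 1).eventually_ne (mul_ne_zero hγ₀cR hslope)
    obtain ⟨N, hNU, hN0⟩ := ((hq.eventually hU).and hne).exists
    have hc1 : (P ^ N * γ₁) 1 0 ≠ 0 := by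
      intro h
      rw [h] at hN0
      simp at hN0
    refine ⟨_, hNU, exists_le_norm_reducedForm_ray hr hc1 hc0 hV (fun z hz => ?_) rfl⟩
    rw [norm_slashReal_eq, mul_smul, (petStabilizer f r).pow_mem hPmem N (γ₁ • z),
      ← norm_slashReal_eq]
    exact hb z hz

end

/-! ### Real-linear images of ray integrals -/

/-- The setting for ray integrals: a function on the upper half-plane with a generalized
Fourier series of positive frequencies, of growth `ρ < α`. -/
structure HasRayTransform (F : ℂ → ℂ) (ρ α : ℝ) : Prop where
  holo : DifferentiableOn ℂ F {z : ℂ | 0 < z.im}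
  decay : VerticalDecay F ρ
  pos : 0 < ρ
  lt : ρ < α
  series : ∃ (b : ℕ → ℂ) (l : ℕ → ℝ), HasExpSeries F b l

/-- The real-linear map `w ↦ u w + v w̄`. -/
noncomputable def conjComb (u v : ℂ) : ℂ →L[ℝ] ℂ :=
  (ContinuousLinearMap.mul ℝ ℂ u) + (ContinuousLinearMap.mul ℝ ℂ v).comp
    (Complex.conjCLE : ℂ →L[ℝ] ℂ)

theorem conjComb_apply (u v w : ℂ) : conjComb u v w = u * w + v * (starRingEnd ℂ) w := by
  simp [conjComb]

/-- A real-linear image of a ray integral. -/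
noncomputable def rayTransform (α : ℝ) (F : ℂ → ℂ) (u v : ℂ) (x : ℝ) : ℂ :=
  conjComb u v (rayIntegral α F x)

theorem norm_conjComb_le (u v w : ℂ) : ‖conjComb u v w‖ ≤ (‖u‖ + ‖v‖) * ‖w‖ := by
  rw [conjComb_apply, add_mul]
  refine (norm_add_le _ _).trans ?_
  rw [norm_mul, norm_mul, Complex.norm_conj]

namespace HasRayTransform

variable {F : ℂ → ℂ} {ρ α : ℝ}

theorem alpha_pos (h : HasRayTransform F ρ α) : 0 < α := h.pos.trans h.lt

theorem hasDerivAt_rayTransform_iteratedDeriv (h : HasRayTransform F ρ α) (u v : ℂ) {k : ℕ}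
    (hk : ρ + (k + 1 : ℕ) < α) (x : ℝ) :
    HasDerivAt (rayTransform α (iteratedDeriv k F) u v)
      (rayTransform α (iteratedDeriv (k + 1) F) u v x) x := by
  have h1 := hasDerivAt_rayIntegral (differentiableOn_iteratedDeriv_upperHalf h.holo k)
    (h.decay.iteratedDeriv h.holo k) (by have := h.pos; positivity)
    (by push_cast at hk; linarith) x
  rw [← iteratedDeriv_succ] at h1
  exact (conjComb u v).hasFDerivAt.comp_hasDerivAt x h1

theorem exists_holder (h : HasRayTransform F ρ α) (u v : ℂ) {k : ℕ} {s : ℝ} (hs : 0 < s)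
    (hs1 : s < 1) (hsk : s ≤ α - ρ - k) :
    ∃ K : ℝ, ∀ x y : ℝ, ‖rayTransform α (iteratedDeriv k F) u v x -
      rayTransform α (iteratedDeriv k F) u v y‖ ≤ K * |x - y| ^ s := by
  obtain ⟨K, hK⟩ := exists_rayIntegral_holder
    (differentiableOn_iteratedDeriv_upperHalf h.holo k) (h.decay.iteratedDeriv h.holo k)
    (α := α) (by have := h.pos; positivity) hs hs1 (by linarith)
  refine ⟨(‖u‖ + ‖v‖) * K, fun x y => ?_⟩
  rw [rayTransform, rayTransform, ← map_sub, mul_assoc]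
  exact (norm_conjComb_le u v _).trans (by gcongr; exact hK x y)

theorem continuous_rayTransform_iteratedDeriv (h : HasRayTransform F ρ α) (u v : ℂ) {k : ℕ}
    (hk : ρ + k < α) : Continuous (rayTransform α (iteratedDeriv k F) u v) := by
  have h0 : 0 < min (1 / 2) (α - ρ - k) := lt_min (by norm_num) (by linarith)
  obtain ⟨K, hK⟩ := h.exists_holder u v h0 ((min_le_left _ _).trans_lt (by norm_num))
    (min_le_right _ _)
  exact continuous_of_holder h0 hK

theorem continuous_rayTransform (h : HasRayTransform F ρ α) (u v : ℂ) :
    Continuous (rayTransform α F u v) := by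
  have := h.continuous_rayTransform_iteratedDeriv u v (k := 0) (by simpa using h.lt)
  rwa [iteratedDeriv_zero] at this

theorem iteratedDeriv_rayTransform (h : HasRayTransform F ρ α) (u v : ℂ) {k : ℕ}
    (hk : ρ + k < α) :
    iteratedDeriv k (rayTransform α F u v) = rayTransform α (iteratedDeriv k F) u v := by
  induction k with
  | zero => simp
  | succ k ih =>
    rw [iteratedDeriv_succ, ih (by push_cast at hk; linarith)]
    ext x
    exact (h.hasDerivAt_rayTransform_iteratedDeriv u v hk x).deriv

theorem contDiff_rayTransform (h : HasRayTransform F ρ α) (u v : ℂ) {k : ℕ} (hk : ρ + k < α) :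
    ContDiff ℝ k (rayTransform α F u v) := by
  refine contDiff_nat_iff_iteratedDeriv.2 ⟨fun j hj => ?_, fun j hj => ?_⟩
  · have hj' : (j : ℝ) ≤ k := by exact_mod_cast hj
    rw [h.iteratedDeriv_rayTransform u v (by linarith)]
    exact h.continuous_rayTransform_iteratedDeriv u v (by linarith)
  · have hj' : ((j + 1 : ℕ) : ℝ) ≤ k := by exact_mod_cast hj
    have hj2 : (j : ℝ) ≤ (j + 1 : ℕ) := by push_cast; linarith
    rw [h.iteratedDeriv_rayTransform u v (by linarith)]
    exact fun x => (h.hasDerivAt_rayTransform_iteratedDeriv u v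
      (by linarith) x).differentiableAt

theorem exists_norm_le (h : HasRayTransform F ρ α) (u v : ℂ) :
    ∃ M : ℝ, ∀ t, ‖rayTransform α F u v t‖ ≤ M := by
  obtain ⟨C, hC⟩ := exists_norm_rayIntegral_le h.decay h.pos.le h.lt
  exact ⟨(‖u‖ + ‖v‖) * C, fun t => (norm_conjComb_le u v _).trans (by gcongr; exact hC t)⟩

/-- Only the component u of the real-linear map survives, the conjugate part being annihilated. As
long as u ≠ 0, the real and imaginary parts determine F as well as the full function does. -/
theorem integral_mul_cauchyKernel (h : HasRayTransform F ρ α) (u v : ℂ) {z : ℂ}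
    (hz : 0 < z.im) :
    ∫ t : ℝ, rayTransform α F u v t * cauchyKernel α z t =
      u * ((2 * Real.pi / α : ℝ) : ℂ) * F z := by
  obtain ⟨b, l, hs⟩ := h.series
  have h1 := hs.integral_rayIntegral_mul_cauchyKernel h.holo.continuousOn h.decay h.pos.le h.lt hz
  have h2 := hs.integral_conj_rayIntegral_mul_cauchyKernel h.holo.continuousOn h.decay
    h.pos.le h.lt hz 1
  simp only [one_mul] at h2
  obtain ⟨C, hC⟩ := exists_norm_rayIntegral_le h.decay h.pos.le h.lt
  have hcont : Continuous (rayIntegral α F) := by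
    have h1 := h.continuous_rayTransform 1 0
    have h2 : rayTransform α F 1 0 = rayIntegral α F := by
      ext t; simp [rayTransform, conjComb_apply]
    rwa [h2] at h1
  have i1 := integrable_mul_cauchyKernel h.alpha_pos hcont hC hz
  have i2 := integrable_mul_cauchyKernel h.alpha_pos (g := fun t => (starRingEnd ℂ)
    (rayIntegral α F t)) (Complex.continuous_conj.comp hcont) (Mg := C)
    (fun t => by rw [Complex.norm_conj]; exact hC t) hz
  have e : ∀ t : ℝ, rayTransform α F u v t * cauchyKernel α z t =
      u * (rayIntegral α F t * cauchyKernel α z t) +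
      v * ((starRingEnd ℂ) (rayIntegral α F t) * cauchyKernel α z t) := by
    intro t
    rw [rayTransform, conjComb_apply]; ring
  simp only [e]
  rw [integral_add (i1.const_mul u) (i2.const_mul v), integral_const_mul, integral_const_mul, h1, h2]
  ring

/-- Taylor expansion of the derivatives of a ray integral at a real point where `F`, up to a
constant, satisfies a weighted bound. -/
theorem exists_taylor_bound (h : HasRayTransform F ρ α) (u v : ℂ) {x₀ A B C : ℝ} {a : ℂ}
    (hC : ∀ z : ℂ, 0 < z.im → ‖F z + a‖ ≤ C * ‖z - x₀‖ ^ A * z.im ^ (-B))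
    {k : ℕ} (hk : ρ + k < α) (hB : B + k < α) {n : ℕ} (hns : (n : ℝ) < α - k + A - B)
    (hsn : α - k + A - B < n + 1) :
    (∀ j ≤ n, IntegrableOn (fun t : ℝ => ((t ^ (α - 1) : ℝ) : ℂ) *
      iteratedDeriv j (iteratedDeriv k F) ((x₀ : ℂ) + Complex.I * t)) (Set.Ioi 0)) ∧
    ∃ K : ℝ, ∀ y : ℝ, ‖rayTransform α (iteratedDeriv k F) u v (x₀ + y) -
      ∑ j ∈ Finset.range (n + 1), ((y ^ j / j.factorial : ℝ) : ℂ) *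
        rayTransform α (iteratedDeriv j (iteratedDeriv k F)) u v x₀‖ ≤
          K * |y| ^ (α - k + A - B) := by
  obtain ⟨K₁, hK₁⟩ := norm_iteratedDeriv_le_of_weighted_bound (G := fun z => F z + a)
    (h.holo.add_const a) (S := {x₀}) (A := A) (B := B) (C := C) (by simpa using hC) k
  -- The k-th derivative of F + a is F^(k) plus a constant, which is a for k = 0 and 0 otherwise.
  obtain ⟨a', ha'⟩ : ∃ a' : ℂ, ∀ z, iteratedDeriv k (fun z => F z + a) z =
      iteratedDeriv k F z + a' := by
    cases k with
    | zero => exact ⟨a, fun z => by simp⟩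
    | succ k => exact ⟨0, fun z => by rw [iteratedDeriv_add_const_succ, add_zero]⟩
  obtain ⟨hint, K, hK⟩ := exists_rayIntegral_taylor_bound
    (differentiableOn_iteratedDeriv_upperHalf h.holo k) (h.decay.iteratedDeriv h.holo k)
    (by have := h.pos; positivity) hk (A := A) (B := B + k) (C := K₁) (s := α - k + A - B) (a := a')
    (n := n) (S := {x₀}) (fun x hx z hz => by rw [← ha']; exact hK₁ x hx z hz)
    hB (by ring) hns hsn
  refine ⟨hint x₀ rfl, (‖u‖ + ‖v‖) * K, fun y => ?_⟩
  have h1 : rayTransform α (iteratedDeriv k F) u v (x₀ + y) -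
      ∑ j ∈ Finset.range (n + 1), ((y ^ j / j.factorial : ℝ) : ℂ) *
        rayTransform α (iteratedDeriv j (iteratedDeriv k F)) u v x₀ =
      conjComb u v (rayIntegral α (iteratedDeriv k F) (x₀ + y) -
        ∑ j ∈ Finset.range (n + 1), ((y ^ j / j.factorial : ℝ) : ℂ) *
          rayIntegral α (iteratedDeriv j (iteratedDeriv k F)) x₀) := by
    rw [map_sub, map_sum]
    congr 1
    refine Finset.sum_congr rfl fun j _ => ?_
    rw [← Complex.real_smul, ← Complex.real_smul, map_smul]
    rfl
  rw [h1, mul_assoc]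
  exact (norm_conjComb_le u v _).trans (by gcongr; exact hK x₀ rfl y)

/-! ### Obstructions to regularity -/

variable {u v : ℂ}

/-- A lower bound for `F` along a vertical ray limits the regularity at its end point. -/
theorem not_isLittleO_of_ray (h : HasRayTransform F ρ α) (hu : u ≠ 0) {k : ℕ} (hk : (k : ℝ) < α)
    {x₀ : ℝ} {U : Set ℝ} (hU : U ∈ 𝓝 x₀) (hUo : IsOpen U)
    (hgU : ContDiffOn ℝ k (rayTransform α F u v) U) {r c : ℝ} (hr : 0 < r) (hrk : 0 ≤ α - k - r)
    (hc : 0 < c)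
    (hlow : ∀ᶠ y : ℝ in 𝓝[>] 0, c * y ^ (-r) ≤ ‖F ((x₀ : ℂ) + Complex.I * y)‖)
    (Q : Polynomial ℂ) :
    ¬ (fun t : ℝ => iteratedDeriv k (rayTransform α F u v) t - Q.eval ((t : ℂ) - x₀)) =o[𝓝 x₀]
      fun t => |t - x₀| ^ (α - k - r) := by
  intro ho
  obtain ⟨Mg, hMg⟩ := h.exists_norm_le u v
  have hα := h.alpha_pos
  set e := ‖u‖ * (2 * Real.pi / α) with he
  have he0 : 0 < e := by
    have := norm_pos_iff.2 hu
    have := Real.pi_pos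
    positivity
  -- On the ray both terms of the bound equal y^{-r}. With ε = ec/4 they add up to half of the lower
  -- bound e c y^{-r}, a contradiction as y → 0.
  obtain ⟨C, η, hη, hb⟩ := exists_pointwise_growth_bound (h.continuous_rayTransform u v) hMg hk hU
    hUo hgU Q hrk le_rfl (by linarith) ho (ε := e * c / 4) (by positivity)
  have hT := (tendsto_rpow_neg_nhdsGT_zero (y := -r) (by linarith)).eventually_gt_atTop
    (C / (e * c / 2))
  obtain ⟨y, hy1, hy2, hy0, hyη⟩ := (hlow.and (hT.and (eventually_mem_nhdsWithin.and
    (mem_nhdsWithin_of_mem_nhds (Iio_mem_nhds hη))))).exists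
  have hy0 : 0 < y := hy0
  have hyη : y < η := hyη
  have him : ((x₀ : ℂ) + Complex.I * y).im = y := by simp
  have hnm : ‖(x₀ : ℂ) + Complex.I * y - x₀‖ = y := by
    rw [add_sub_cancel_left, norm_mul, Complex.norm_I, one_mul, Complex.norm_real,
      Real.norm_eq_abs, abs_of_pos hy0]
  have h1 := hb ((x₀ : ℂ) + Complex.I * y) (by rwa [him]) (by rw [hnm]; exact hyη.le)
  rw [h.integral_mul_cauchyKernel u v (by rwa [him]), norm_mul, norm_mul, Complex.norm_real,
    Real.norm_of_nonneg (by have := Real.pi_pos; positivity), ← he, him, hnm,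
    ← Real.rpow_add hy0] at h1
  rw [show α - k - r - (α - k) = -r by ring, show α - k - r + -(α - k) = -r by ring] at h1
  have h2 : e * (c * y ^ (-r)) ≤ e * ‖F ((x₀ : ℂ) + Complex.I * y)‖ := by gcongr
  rw [div_lt_iff₀ (by positivity)] at hy2
  nlinarith

/-- A lower bound for `F` along a horocycle limits the pointwise regularity at its base point. -/
theorem not_isLittleO_of_horocycle (h : HasRayTransform F ρ α) (hu : u ≠ 0) {k : ℕ}
    (hk : (k : ℝ) < α) {x₀ : ℝ} {U : Set ℝ} (hU : U ∈ 𝓝 x₀) (hUo : IsOpen U)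
    (hgU : ContDiffOn ℝ k (rayTransform α F u v) U) {r c w : ℝ} (hr : 0 < r)
    (hrk : 0 ≤ 2 * (α - k) - r) (hc : 0 < c) (hw : 0 < w) {z : ℕ → ℂ}
    (hz : Tendsto z atTop (𝓝 (x₀ : ℂ)))
    (hlow : ∀ᶠ N in atTop, 0 < (z N).im ∧ (z N).im = w * ‖z N - (x₀ : ℂ)‖ ^ 2 ∧
      c * ‖z N - (x₀ : ℂ)‖ ^ (-r) ≤ ‖F (z N)‖)
    (Q : Polynomial ℂ) :
    ¬ (fun t : ℝ => iteratedDeriv k (rayTransform α F u v) t - Q.eval ((t : ℂ) - x₀)) =o[𝓝 x₀]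
      fun t => |t - x₀| ^ (2 * (α - k) - r) := by
  intro ho
  obtain ⟨Mg, hMg⟩ := h.exists_norm_le u v
  have hα := h.alpha_pos
  set e := ‖u‖ * (2 * Real.pi / α) with he
  have he0 : 0 < e := by
    have := norm_pos_iff.2 hu
    have := Real.pi_pos
    positivity
  set W := w ^ (-(r / 2)) + w ^ (-(α - k)) with hW
  have hW0 : 0 < W := by positivity
  -- On the horocycle Im z = w|z-x₀|². The value s' = α-k-r/2 makes both terms multiples of
  -- |z-x₀|^{-r} with total coefficient W, and the condition s' ≤ s is exactly `hrk`.
  obtain ⟨C, η, hη, hb⟩ := exists_pointwise_growth_bound (h.continuous_rayTransform u v) hMg hk hU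
    hUo hgU Q hrk (s' := α - k - r / 2) (by linarith) (by linarith) ho
    (ε := e * c / (2 * W)) (by positivity)
  have hz0 : Tendsto (fun N => ‖z N - (x₀ : ℂ)‖) atTop (𝓝[>] 0) := by
    refine tendsto_nhdsWithin_iff.2 ⟨tendsto_iff_norm_sub_tendsto_zero.1 hz, ?_⟩
    filter_upwards [hlow] with N hN
    refine (norm_nonneg _).lt_of_ne fun h0 => ?_
    have := hN.2.1
    rw [← h0] at this
    simp [this] at hN
  have hT := ((tendsto_rpow_neg_nhdsGT_zero (y := -r) (by linarith)).comp hz0).eventually_gt_atTop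
    (C / (e * c / 2))
  obtain ⟨N, ⟨him0, him, hN⟩, hN2, hy0, hyη⟩ := (hlow.and (hT.and
    ((hz0.eventually eventually_mem_nhdsWithin).and
    (hz0.eventually (mem_nhdsWithin_of_mem_nhds (Iio_mem_nhds hη)))))).exists
  have h1 := hb (z N) him0 (le_of_lt hyη)
  rw [Function.comp_apply] at hN2
  rw [h.integral_mul_cauchyKernel u v him0, norm_mul, norm_mul, Complex.norm_real,
    Real.norm_of_nonneg (by have := Real.pi_pos; positivity), ← he, him] at h1
  set y := ‖z N - (x₀ : ℂ)‖ with hy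
  have hy0 : 0 < y := hy0
  have hpow : ∀ b : ℝ, (w * y ^ 2) ^ b = w ^ b * y ^ (2 * b) := by
    intro b
    rw [Real.mul_rpow hw.le (by positivity), ← Real.rpow_natCast y, ← Real.rpow_mul hy0.le]
    norm_num
  rw [hpow, hpow, mul_left_comm (y ^ _), ← Real.rpow_add hy0,
    show α - k - r / 2 - (α - k) = -(r / 2) by ring,
    show 2 * (α - k) - r + 2 * -(α - k) = -r by ring,
    show 2 * -(r / 2) = -r by ring, ← add_mul, ← hW, ← mul_assoc] at h1
  have h2 : e * (c * y ^ (-r)) ≤ e * ‖F (z N)‖ := by gcongr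
  rw [div_lt_iff₀ (by positivity)] at hN2
  rw [show e * c / (2 * W) * W = e * c / 2 by field_simp] at h1
  nlinarith

/-- A lower bound for `F` along a horocycle limits the local regularity near its base point. -/
theorem not_holder_of_horocycle (h : HasRayTransform F ρ α) (hu : u ≠ 0) {k : ℕ}
    (hk : (k : ℝ) < α) {x₀ d : ℝ} (hd : 0 < d) {U : Set ℝ}
    (hUd : Set.Icc (x₀ - d) (x₀ + d) ⊆ U) (hUo : IsOpen U)
    (hgU : ContDiffOn ℝ k (rayTransform α F u v) U) {r c w : ℝ} (hr : 0 < r) (hc : 0 < c)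
    (hw : 0 < w) {z : ℕ → ℂ} (hz : Tendsto z atTop (𝓝 (x₀ : ℂ)))
    (hlow : ∀ᶠ N in atTop, 0 < (z N).im ∧ (z N).im = w * ‖z N - (x₀ : ℂ)‖ ^ 2 ∧
      c * ‖z N - (x₀ : ℂ)‖ ^ (-r) ≤ ‖F (z N)‖)
    {s L : ℝ} (hs : 0 ≤ s) (hsr : α - k - r / 2 < s) :
    ¬ ∀ t ∈ Set.Icc (x₀ - d) (x₀ + d), ∀ x ∈ Set.Icc (x₀ - d) (x₀ + d),
      ‖iteratedDeriv k (rayTransform α F u v) t - iteratedDeriv k (rayTransform α F u v) x‖ ≤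
        L * |t - x| ^ s := by
  intro hL
  obtain ⟨Mg, hMg⟩ := h.exists_norm_le u v
  have hα := h.alpha_pos
  set e := ‖u‖ * (2 * Real.pi / α) with he
  have he0 : 0 < e := by
    have := norm_pos_iff.2 hu
    have := Real.pi_pos
    positivity
  -- With s' above α-k-r/2, the bound (Im z)^{s'-(α-k)} is of size |z-x₀|^{q-r} with q > 0, which
  -- loses to |z-x₀|^{-r}. The condition s' < α-k is required by the kernel estimate.
  obtain ⟨s', hs'1, hs'2⟩ := exists_between (lt_min hsr (by linarith : α - k - r / 2 < α - k))
  obtain ⟨C, K, η, hη, hb⟩ := exists_uniform_growth_bound (h.continuous_rayTransform u v) hMg hk hd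
    hUd hUo hgU hs (hs'2.trans_le (min_le_left _ _)).le (hs'2.trans_le (min_le_right _ _))
    (abs_nonneg L) (fun t ht x hx => (hL t ht x hx).trans (by
      gcongr
      exact le_abs_self L))
  have hz0 : Tendsto (fun N => ‖z N - (x₀ : ℂ)‖) atTop (𝓝[>] 0) := by
    refine tendsto_nhdsWithin_iff.2 ⟨tendsto_iff_norm_sub_tendsto_zero.1 hz, ?_⟩
    filter_upwards [hlow] with N hN
    refine (norm_nonneg _).lt_of_ne fun h0 => ?_
    have := hN.2.1
    rw [← h0] at this
    simp [this] at hN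
  set q := 2 * (s' - (α - k)) + r with hq
  have hq0 : 0 < q := by rw [hq]; linarith
  have hA : Tendsto (fun N => ‖z N - (x₀ : ℂ)‖ ^ (-r)) atTop atTop :=
    (tendsto_rpow_neg_nhdsGT_zero (y := -r) (by linarith)).comp hz0
  have hB : Tendsto (fun N => K * w ^ (s' - (α - k)) * ‖z N - (x₀ : ℂ)‖ ^ q) atTop (𝓝 0) := by
    have h1 : Tendsto (fun y : ℝ => K * w ^ (s' - (α - k)) * y ^ q) (𝓝 0) (𝓝 0) := by
      have := ((Real.continuousAt_rpow_const 0 q (Or.inr hq0.le)).tendsto).const_mul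
        (K * w ^ (s' - (α - k)))
      rwa [Real.zero_rpow hq0.ne', mul_zero] at this
    exact h1.comp (hz0.mono_right nhdsWithin_le_nhds)
  obtain ⟨N, ⟨him0, him, hN⟩, hN2, hN3, hy0, hyη⟩ := (hlow.and
    ((hA.eventually_gt_atTop (C / (e * c / 2))).and
    (((tendsto_order.1 hB).2 (e * c / 2) (by positivity)).and
    ((hz0.eventually eventually_mem_nhdsWithin).and
    (hz0.eventually (mem_nhdsWithin_of_mem_nhds (Iio_mem_nhds hη))))))).exists
  have h1 := hb (z N) him0 (le_of_lt hyη)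
  rw [h.integral_mul_cauchyKernel u v him0, norm_mul, norm_mul, Complex.norm_real,
    Real.norm_of_nonneg (by have := Real.pi_pos; positivity), ← he, him] at h1
  set y := ‖z N - (x₀ : ℂ)‖ with hy
  have hy0 : 0 < y := hy0
  have hpow : (w * y ^ 2) ^ (s' - (α - k)) = w ^ (s' - (α - k)) * (y ^ q * y ^ (-r)) := by
    rw [Real.mul_rpow hw.le (by positivity), ← Real.rpow_natCast y, ← Real.rpow_mul hy0.le,
      ← Real.rpow_add hy0, hq]
    congr 2
    push_cast; ring
  have hyr := Real.rpow_pos_of_pos hy0 (-r)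
  rw [hpow] at h1
  have h2 : e * (c * y ^ (-r)) ≤ e * ‖F (z N)‖ := by gcongr
  rw [div_lt_iff₀ (by positivity)] at hN2
  have h3 : K * w ^ (s' - (α - k)) * y ^ q * y ^ (-r) ≤ e * c / 2 * y ^ (-r) := by gcongr
  nlinarith

end HasRayTransform

/-! ### Comparison of powers and suprema -/

/-- Taylor bounds are available only for non-integral exponents. As the Hölder exponents are
suprema, approximating from below by such values loses nothing. -/
theorem exists_not_nat_between {a b : ℝ} (ha : 0 ≤ a) (hab : a < b) :
    ∃ (s : ℝ) (n : ℕ), a < s ∧ s < b ∧ (n : ℝ) < s ∧ s < n + 1 := by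
  obtain ⟨s, h1, h2⟩ := exists_between (lt_min hab (Nat.lt_floor_add_one a))
  exact ⟨s, ⌊a⌋₊, h1, h2.trans_le (min_le_left _ _), (Nat.floor_le ha).trans_lt h1,
    h2.trans_le (min_le_right _ _)⟩

theorem isLittleO_abs_sub_rpow {s s' : ℝ} (hs' : 0 ≤ s') (h : s' < s) (x₀ : ℝ) :
    (fun t : ℝ => |t - x₀| ^ s) =o[𝓝 x₀] fun t => |t - x₀| ^ s' := by
  have h1 : Tendsto (fun t : ℝ => |t - x₀| ^ (s - s')) (𝓝 x₀) (𝓝 0) := by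
    have hc : Continuous fun t : ℝ => |t - x₀| ^ (s - s') :=
      (by fun_prop : Continuous fun t : ℝ => |t - x₀|).rpow_const fun _ => Or.inr (by linarith)
    simpa [Real.zero_rpow (sub_pos.2 h).ne'] using hc.tendsto x₀
  have h2 := (isBigO_refl (fun t : ℝ => |t - x₀| ^ s') (𝓝 x₀)).mul_isLittleO
    ((isLittleO_one_iff ℝ).2 h1)
  simp only [mul_one] at h2
  refine h2.congr_left fun t => ?_
  rw [← Real.rpow_add_of_nonneg (abs_nonneg _) hs' (by linarith)]
  congr 1; ring

theorem isBigO_abs_sub_rpow {s s' : ℝ} (hs' : 0 ≤ s') (h : s' ≤ s) (x₀ : ℝ) :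
    (fun t : ℝ => |t - x₀| ^ s) =O[𝓝 x₀] fun t => |t - x₀| ^ s' := by
  rcases h.eq_or_lt with rfl | h
  · exact isBigO_refl _ _
  · exact (isLittleO_abs_sub_rpow hs' h x₀).isBigO

theorem isBigO_abs_sub_of_differentiableAt {g : ℝ → ℂ} {x₀ : ℝ} (h : DifferentiableAt ℝ g x₀) :
    (fun t => g t - g x₀) =O[𝓝 x₀] fun t => |t - x₀| ^ (1 : ℝ) := by
  simpa using h.isBigO_sub.norm_right

theorem exists_Icc_sub_add_subset {U : Set ℝ} {x : ℝ} (hU : U ∈ 𝓝 x) :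
    ∃ d : ℝ, 0 < d ∧ Set.Icc (x - d) (x + d) ⊆ U := by
  obtain ⟨d, hd, hb⟩ := Metric.nhds_basis_closedBall.mem_iff.1 hU
  exact ⟨d, hd, by rwa [← Real.closedBall_eq_Icc]⟩

theorem exists_lipschitz_iteratedDeriv {g : ℝ → ℂ} {U : Set ℝ} (hUo : IsOpen U) {k : ℕ}
    (hg : ContDiffOn ℝ (k + 1 : ℕ) g U) {a b : ℝ} (hab : Set.Icc a b ⊆ U) :
    ∃ L : ℝ, ∀ t ∈ Set.Icc a b, ∀ x ∈ Set.Icc a b,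
      ‖iteratedDeriv k g t - iteratedDeriv k g x‖ ≤ L * |t - x| ^ (1 : ℝ) := by
  obtain ⟨L, hL⟩ := isCompact_Icc.exists_bound_of_continuousOn
    ((continuousOn_iteratedDeriv_of_contDiffOn hUo hg le_rfl).mono hab)
  refine ⟨L, fun t ht x hx => ?_⟩
  rw [Real.rpow_one]
  exact (convex_Icc a b).norm_image_sub_le_of_norm_hasDerivWithin_le
    (fun y hy => (hasDerivAt_iteratedDeriv_of_contDiffOn hUo hg k.lt_succ_self
      (hab hy)).hasDerivWithinAt) hL hx ht

theorem coe_le_sSup_of_forall_lt {S : Set EReal} {T : ℝ}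
    (h : ∀ e < T, ∃ s : ℝ, e < s ∧ (s : EReal) ∈ S) : (T : EReal) ≤ sSup S := by
  refine EReal.ge_of_forall_gt_iff_ge.1 fun e he => ?_
  obtain ⟨s, hs, hS⟩ := h e (by exact_mod_cast he)
  exact (EReal.coe_le_coe_iff.2 hs.le).trans (le_sSup hS)

/-! ### Predicates on the size of functions near the real line -/

/-- `F` is of order at least `y ^ (-r)` on the vertical ray ending at `x`. -/
def LargeOnRay (F : ℂ → ℂ) (r x : ℝ) : Prop :=
  ∃ c > 0, ∀ᶠ y : ℝ in 𝓝[>] 0, c * y ^ (-r) ≤ ‖F ((x : ℂ) + Complex.I * y)‖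

/-- `F` is of order at least `|z - x| ^ (-r)` along a sequence on a horocycle at `x`. -/
def LargeOnHorocycle (F : ℂ → ℂ) (r x : ℝ) : Prop :=
  ∃ c w : ℝ, 0 < c ∧ 0 < w ∧ ∃ z : ℕ → ℂ, Tendsto z atTop (𝓝 (x : ℂ)) ∧
    ∀ᶠ N in atTop, 0 < (z N).im ∧ (z N).im = w * ‖z N - (x : ℂ)‖ ^ 2 ∧
      c * ‖z N - (x : ℂ)‖ ^ (-r) ≤ ‖F (z N)‖

/-- The growth of a function of growth `ρ` and weight `r`, up to a constant, near a real point
at which it is cuspidal. -/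
def SmallNear (F : ℂ → ℂ) (ρ r x : ℝ) : Prop :=
  ∃ a : ℂ, ∀ M, ρ ≤ M → ∃ C : ℝ, ∀ z : ℂ, 0 < z.im →
    ‖F z + a‖ ≤ C * ‖z - x‖ ^ (2 * M - r) * z.im ^ (-M)

namespace HasRayTransform

variable {F : ℂ → ℂ} {ρ α r : ℝ} {u v : ℂ} {x : ℝ}

/-! ### Regularity -/

theorem memHolderAt_of_bound (h : HasRayTransform F ρ α) (u v : ℂ) {A B C : ℝ} {a : ℂ}
    (hC : ∀ z : ℂ, 0 < z.im → ‖F z + a‖ ≤ C * ‖z - x‖ ^ A * z.im ^ (-B)) (hB : B < α) {n : ℕ}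
    (hns : (n : ℝ) < α + A - B) (hsn : α + A - B < n + 1) :
    MemHolderAt (rayTransform α F u v) (α + A - B) x := by
  obtain ⟨-, K, hK⟩ := h.exists_taylor_bound u v hC (k := 0) (n := n) (by simpa using h.lt)
    (by simpa using hB) (by simpa using hns) (by simpa using hsn)
  simp only [iteratedDeriv_zero, Nat.cast_zero, sub_zero] at hK
  refine ⟨h.continuous_rayTransform u v, ∑ j ∈ Finset.range (n + 1),
    Polynomial.monomial j (((1 / j.factorial : ℝ) : ℂ) *
      rayTransform α (iteratedDeriv j F) u v x), Or.inr ?_, ?_⟩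
  · refine lt_of_le_of_lt ?_ hns
    rw [Nat.cast_le]
    refine Polynomial.natDegree_sum_le_of_forall_le _ _ fun j hj => ?_
    exact (Polynomial.natDegree_monomial_le _).trans (Nat.lt_succ_iff.1 (Finset.mem_range.1 hj))
  · refine IsBigO.of_bound K (Eventually.of_forall fun t => ?_)
    have h1 := hK (t - x)
    rw [add_sub_cancel] at h1
    rw [Real.norm_of_nonneg (by positivity), Polynomial.eval_finsetSum]
    convert h1 using 4 with j hj
    rw [Polynomial.eval_monomial]
    push_cast
    ring

/-- With M = s-α+r the resulting Taylor order α+(2M-r)-M equals s. The condition M < α means s <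
2α-r, and M ≥ ρ means s ≥ α-r+ρ, hence the lower end of the chosen interval. -/
theorem exists_memHolderAt_of_smallNear (h : HasRayTransform F ρ α) (u v : ℂ)
    (hx : SmallNear F ρ r x) (hr : r < 2 * α) {e : ℝ} (he : e < 2 * α - r) :
    ∃ s, e < s ∧ 0 ≤ s ∧ MemHolderAt (rayTransform α F u v) s x := by
  obtain ⟨a, hx⟩ := hx
  have hlt := h.lt
  obtain ⟨s, n, h1, h2, h3, h4⟩ := exists_not_nat_between
    (le_max_left 0 (max e (α - r + ρ))) (max_lt (by linarith) (max_lt he (by linarith)) :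
      _ < 2 * α - r)
  simp only [max_lt_iff] at h1
  obtain ⟨C, hC⟩ := hx (s - α + r) (by linarith)
  have hs : α + (2 * (s - α + r) - r) - (s - α + r) = s := by ring
  have := h.memHolderAt_of_bound u v hC (n := n) (by linarith) (by rwa [hs]) (by rwa [hs])
  rw [hs] at this
  exact ⟨s, h1.2.1, h1.1.le, this⟩

theorem exists_memHolderAt (h : HasRayTransform F ρ α) (u v : ℂ) (x : ℝ) {e : ℝ}
    (he : e < α - ρ) : ∃ s, e < s ∧ 0 ≤ s ∧ MemHolderAt (rayTransform α F u v) s x := by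
  have hlt := h.lt
  obtain ⟨s, n, h1, h2, h3, h4⟩ := exists_not_nat_between
    (le_max_left 0 e) (max_lt (by linarith) he)
  simp only [max_lt_iff] at h1
  obtain ⟨C, hC⟩ := h.decay (α - s) (by linarith)
  have hs : α + 0 - (α - s) = s := by ring
  have := h.memHolderAt_of_bound u v (x := x) (A := 0) (B := α - s) (C := C) (a := 0) (n := n)
    (by simpa using hC) (by linarith) (by rwa [hs]) (by rwa [hs])
  rw [hs] at this
  exact ⟨s, h1.2, h1.1.le, this⟩

/-- The expansion of g^(k) at x may have order s > 1, but only its value at x may be subtracted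
here. The rest of the Taylor polynomial is O(|t-x|), which produces the cap at 1. -/
theorem exists_memDerivHolderAt_of_smallNear (h : HasRayTransform F ρ α) (u v : ℂ)
    (hx : SmallNear F ρ r x) {k : ℕ} (hk : ρ + k < α) (hr : r < 2 * (α - k)) {e : ℝ}
    (he : e < min 1 (2 * (α - k) - r)) :
    ∃ s, e < s ∧ 0 ≤ s ∧ s ≤ 1 ∧ MemDerivHolderAt (rayTransform α F u v) k s x := by
  obtain ⟨a, hx⟩ := hx
  rw [lt_min_iff] at he
  obtain ⟨s, n, h1, h2, h3, h4⟩ := exists_not_nat_between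
    (le_max_left 0 (max e (α - k - r + ρ))) (max_lt (by linarith) (max_lt he.2 (by linarith)) :
      _ < 2 * (α - k) - r)
  simp only [max_lt_iff] at h1
  obtain ⟨C, hC⟩ := hx (s - (α - k) + r) (by linarith)
  have hs : α - k + (2 * (s - (α - k) + r) - r) - (s - (α - k) + r) = s := by ring
  obtain ⟨-, K, hK⟩ := h.exists_taylor_bound u v hC (n := n) hk (by linarith) (by rwa [hs])
    (by rwa [hs])
  rw [hs] at hK
  have hm0 : 0 ≤ min 1 s := le_min zero_le_one h1.1.le
  refine ⟨min 1 s, lt_min he.1 h1.2.1, hm0, min_le_left _ _, h.continuous_rayTransform u v,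
    ⟨x - 1, x + 1, by simp, (h.contDiff_rayTransform u v hk).contDiffOn⟩, ?_⟩
  rw [h.iteratedDeriv_rayTransform u v hk]
  have hO1 : (fun t => rayTransform α (iteratedDeriv k F) u v t -
      ∑ j ∈ Finset.range (n + 1), (((t - x) ^ j / j.factorial : ℝ) : ℂ) *
        rayTransform α (iteratedDeriv j (iteratedDeriv k F)) u v x) =O[𝓝 x]
      fun t => |t - x| ^ (min 1 s) := by
    refine IsBigO.trans (IsBigO.of_bound K (Eventually.of_forall fun t => ?_))
      (isBigO_abs_sub_rpow (s := s) hm0 (min_le_right _ _) x)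
    have := hK (t - x)
    rw [add_sub_cancel] at this
    rwa [Real.norm_of_nonneg (by positivity)]
  have hd : DifferentiableAt ℝ (fun t : ℝ =>
      ∑ j ∈ Finset.range (n + 1), (((t - x) ^ j / j.factorial : ℝ) : ℂ) *
        rayTransform α (iteratedDeriv j (iteratedDeriv k F)) u v x) x := by
    simp only [← Complex.real_smul]
    fun_prop
  have hO2 := (isBigO_abs_sub_of_differentiableAt hd).trans
    (isBigO_abs_sub_rpow (s := 1) hm0 (min_le_left _ _) x)
  refine (hO1.add hO2).congr_left fun t => ?_
  have hval : ∑ j ∈ Finset.range (n + 1), (((x - x) ^ j / j.factorial : ℝ) : ℂ) *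
        rayTransform α (iteratedDeriv j (iteratedDeriv k F)) u v x =
      rayTransform α (iteratedDeriv k F) u v x := by
    rw [Finset.sum_range_succ', Finset.sum_eq_zero]
    · simp
    · intro j _
      simp
  rw [hval]; ring

theorem exists_global_holder (h : HasRayTransform F ρ α) (u v : ℂ) {e : ℝ} (he : e < α - ρ) :
    ∃ (k : ℕ) (s : ℝ), 0 ≤ s ∧ s ≤ 1 ∧ e < k + s ∧ ρ + k < α ∧
      ∃ K : ℝ, ∀ y t : ℝ, ‖iteratedDeriv k (rayTransform α F u v) y -
        iteratedDeriv k (rayTransform α F u v) t‖ ≤ K * |y - t| ^ s := by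
  have hlt := h.lt
  obtain ⟨s, n, h1, h2, h3, h4⟩ := exists_not_nat_between
    (le_max_left 0 e) (max_lt (by linarith) he)
  simp only [max_lt_iff] at h1
  have hn : ρ + n < α := by linarith
  refine ⟨n, s - n, by linarith, by linarith, by linarith [h1.2], hn, ?_⟩
  rw [h.iteratedDeriv_rayTransform u v hn]
  exact h.exists_holder u v (by linarith) (by linarith) (by linarith)

theorem exists_memDerivHolderAt (h : HasRayTransform F ρ α) (u v : ℂ) (x : ℝ) {e : ℝ}
    (he : e < α - ρ) : ∃ (k : ℕ) (s : ℝ), 0 ≤ s ∧ s ≤ 1 ∧ e < k + s ∧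
      MemDerivHolderAt (rayTransform α F u v) k s x := by
  obtain ⟨k, s, h0, h1, h2, hk, K, hK⟩ := h.exists_global_holder u v he
  refine ⟨k, s, h0, h1, h2, h.continuous_rayTransform u v,
    ⟨x - 1, x + 1, by simp, (h.contDiff_rayTransform u v hk).contDiffOn⟩,
    IsBigO.of_bound K (Eventually.of_forall fun t => ?_)⟩
  rw [Real.norm_of_nonneg (by positivity)]
  exact hK t x

theorem exists_memDerivHolderOn (h : HasRayTransform F ρ α) (u v : ℂ) (Ω : Set ℝ) {e : ℝ}
    (he : e < α - ρ) : ∃ (k : ℕ) (s : ℝ), 0 ≤ s ∧ s ≤ 1 ∧ e < k + s ∧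
      MemDerivHolderOn (rayTransform α F u v) k s Ω := by
  obtain ⟨k, s, h0, h1, h2, hk, K, hK⟩ := h.exists_global_holder u v he
  exact ⟨k, s, h0, h1, h2, h.continuous_rayTransform u v,
    (h.contDiff_rayTransform u v hk).contDiffOn, fun _ _ _ => ⟨K, fun y _ t _ => hK y t⟩⟩

/-! ### Irregularity -/

theorem not_isBigO_of_largeOnRay (h : HasRayTransform F ρ α) (hu : u ≠ 0) (hr : 0 < r)
    (hx : LargeOnRay F r x) {k : ℕ} (hrk : 0 ≤ α - k - r) {U : Set ℝ} (hU : U ∈ 𝓝 x)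
    (hUo : IsOpen U) (hgU : ContDiffOn ℝ k (rayTransform α F u v) U) {s : ℝ}
    (hs : α - k - r < s) (Q : Polynomial ℂ) :
    ¬ (fun t : ℝ => iteratedDeriv k (rayTransform α F u v) t - Q.eval ((t : ℂ) - x)) =O[𝓝 x]
      fun t => |t - x| ^ s := by
  obtain ⟨c, hc, hlow⟩ := hx
  exact fun hO => h.not_isLittleO_of_ray hu (by linarith) hU hUo hgU hr hrk hc hlow Q
    (hO.trans_isLittleO (isLittleO_abs_sub_rpow hrk hs x))

theorem not_isBigO_of_largeOnHorocycle (h : HasRayTransform F ρ α) (hu : u ≠ 0) (hr : 0 < r)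
    (hx : LargeOnHorocycle F r x) {k : ℕ} (hrk : 0 ≤ 2 * (α - k) - r) {U : Set ℝ} (hU : U ∈ 𝓝 x)
    (hUo : IsOpen U) (hgU : ContDiffOn ℝ k (rayTransform α F u v) U) {s : ℝ}
    (hs : 2 * (α - k) - r < s) (Q : Polynomial ℂ) :
    ¬ (fun t : ℝ => iteratedDeriv k (rayTransform α F u v) t - Q.eval ((t : ℂ) - x)) =O[𝓝 x]
      fun t => |t - x| ^ s := by
  obtain ⟨c, w, hc, hw, z, hz, hlow⟩ := hx
  exact fun hO => h.not_isLittleO_of_horocycle hu (by linarith) hU hUo hgU hr hrk hc hw hz hlow Q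
    (hO.trans_isLittleO (isLittleO_abs_sub_rpow hrk hs x))

/-! ### The pointwise exponent -/

theorem pointwiseHolderExponent_of_smallNear (h : HasRayTransform F ρ α) (hu : u ≠ 0) (hr : 0 < r)
    (hrρ : r / 2 ≤ ρ) (hx : SmallNear F ρ r x) (hx' : LargeOnHorocycle F r x) :
    pointwiseHolderExponent (rayTransform α F u v) x = ((2 * α - r : ℝ) : EReal) := by
  have hlt := h.lt
  refine le_antisymm (sSup_le ?_) (coe_le_sSup_of_forall_lt fun e he => ?_)
  · rintro _ ⟨s, -, ⟨-, P, -, hP⟩, rfl⟩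
    rw [EReal.coe_le_coe_iff]
    by_contra! hs
    refine h.not_isBigO_of_largeOnHorocycle hu hr hx' (k := 0) (by push_cast; linarith) univ_mem
      isOpen_univ (contDiffOn_zero.2 (h.continuous_rayTransform u v).continuousOn) (s := s)
      (by push_cast; linarith) P ?_
    simpa using hP
  · obtain ⟨s, h1, h2, h3⟩ := h.exists_memHolderAt_of_smallNear u v hx (by linarith) he
    exact ⟨s, h1, s, h2, h3, rfl⟩

theorem pointwiseHolderExponent_of_largeOnRay (h : HasRayTransform F r α) (hu : u ≠ 0)
    (hx : LargeOnRay F r x) :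
    pointwiseHolderExponent (rayTransform α F u v) x = ((α - r : ℝ) : EReal) := by
  have hlt := h.lt
  refine le_antisymm (sSup_le ?_) (coe_le_sSup_of_forall_lt fun e he => ?_)
  · rintro _ ⟨s, -, ⟨-, P, -, hP⟩, rfl⟩
    rw [EReal.coe_le_coe_iff]
    by_contra! hs
    refine h.not_isBigO_of_largeOnRay hu h.pos hx (k := 0) (by push_cast; linarith) univ_mem
      isOpen_univ (contDiffOn_zero.2 (h.continuous_rayTransform u v).continuousOn) (s := s)
      (by push_cast; linarith) P ?_
    simpa using hP
  · obtain ⟨s, h1, h2, h3⟩ := h.exists_memHolderAt u v x he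
    exact ⟨s, h1, s, h2, h3, rfl⟩

end HasRayTransform

namespace HasRayTransform

variable {F : ℂ → ℂ} {ρ α r : ℝ} {u v : ℂ} {x : ℝ}

/-! ### Failure of higher smoothness -/

theorem iteratedDeriv_sub_eq_sub_eval (g : ℝ → ℂ) (k : ℕ) (x : ℝ) :
    (fun t : ℝ => iteratedDeriv k g t - iteratedDeriv k g x) = fun t : ℝ =>
      iteratedDeriv k g t - (Polynomial.C (iteratedDeriv k g x)).eval ((t : ℂ) - x) := by
  simp

/-- With k the integer part of α-r/2, class C^{k+1} would make g^(k) locally Lipschitz, while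
α-k-r/2 < 1 forbids the Hölder exponent 1. -/
theorem not_contDiffOn_of_largeOnHorocycle (h : HasRayTransform F (r / 2) α) (hu : u ≠ 0)
    (hx : LargeOnHorocycle F r x) {U : Set ℝ} (hU : U ∈ 𝓝 x) (hUo : IsOpen U) :
    ¬ ContDiffOn ℝ (⌊α - r / 2⌋₊ + 1 : ℕ) (rayTransform α F u v) U := by
  intro hg
  have hr := h.pos
  have hlt := h.lt
  obtain ⟨d, hd, hdU⟩ := exists_Icc_sub_add_subset hU
  obtain ⟨L, hL⟩ := exists_lipschitz_iteratedDeriv hUo hg hdU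
  obtain ⟨c, w, hc, hw, z, hz, hlow⟩ := hx
  have h1 : (⌊α - r / 2⌋₊ : ℝ) ≤ α - r / 2 := Nat.floor_le (by linarith)
  have h2 := Nat.lt_floor_add_one (α - r / 2)
  exact h.not_holder_of_horocycle hu (by linarith) hd hdU hUo
    (hg.of_le (by exact_mod_cast Nat.le_succ _)) (r := r) (by linarith) hc hw hz hlow (s := 1)
    zero_le_one (by linarith) hL

theorem not_memDerivHolderOn_of_largeOnHorocycle (h : HasRayTransform F (r / 2) α) (hu : u ≠ 0)
    (hx : LargeOnHorocycle F r x) {U : Set ℝ} (hU : U ∈ 𝓝 x) (hUo : IsOpen U) {k : ℕ} {s : ℝ}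
    (hk : (k : ℝ) < α) (hs : 0 ≤ s) (hks : α - k - r / 2 < s) :
    ¬ MemDerivHolderOn (rayTransform α F u v) k s U := by
  rintro ⟨-, hg, hH⟩
  have hr := h.pos
  obtain ⟨d, hd, hdU⟩ := exists_Icc_sub_add_subset hU
  obtain ⟨L, hL⟩ := hH _ hdU isCompact_Icc
  obtain ⟨c, w, hc, hw, z, hz, hlow⟩ := hx
  exact h.not_holder_of_horocycle hu hk hd hdU hUo hg (r := r) (by linarith) hc hw hz hlow
    hs hks hL

theorem not_contDiffOn_of_largeOnRay (h : HasRayTransform F r α) (hu : u ≠ 0)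
    (hx : LargeOnRay F r x) {U : Set ℝ} (hU : U ∈ 𝓝 x) (hUo : IsOpen U) :
    ¬ ContDiffOn ℝ (⌊α - r⌋₊ + 1 : ℕ) (rayTransform α F u v) U := by
  intro hg
  have hlt := h.lt
  have h1 : (⌊α - r⌋₊ : ℝ) ≤ α - r := Nat.floor_le (by linarith)
  have h2 := Nat.lt_floor_add_one (α - r)
  have hd := (hasDerivAt_iteratedDeriv_of_contDiffOn hUo hg (Nat.lt_succ_self _)
    (mem_of_mem_nhds hU)).differentiableAt
  have hO := isBigO_abs_sub_of_differentiableAt hd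
  rw [iteratedDeriv_sub_eq_sub_eval] at hO
  exact h.not_isBigO_of_largeOnRay hu h.pos hx (by linarith) hU hUo
    (hg.of_le (by exact_mod_cast Nat.le_succ _)) (by linarith) _ hO

theorem not_memDerivHolderOn_of_largeOnRay (h : HasRayTransform F r α) (hu : u ≠ 0)
    (hx : LargeOnRay F r x) {U : Set ℝ} (hU : U ∈ 𝓝 x) (hUo : IsOpen U) {k : ℕ} {s : ℝ}
    (hk : 0 ≤ α - k - r) (hks : α - k - r < s) :
    ¬ MemDerivHolderOn (rayTransform α F u v) k s U := by
  rintro ⟨-, hg, hH⟩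
  obtain ⟨d, hd, hdU⟩ := exists_Icc_sub_add_subset hU
  obtain ⟨L, hL⟩ := hH _ hdU isCompact_Icc
  have hO : (fun t : ℝ => iteratedDeriv k (rayTransform α F u v) t -
      iteratedDeriv k (rayTransform α F u v) x) =O[𝓝 x] fun t => |t - x| ^ s := by
    refine IsBigO.of_bound L ?_
    filter_upwards [Icc_mem_nhds (by linarith : x - d < x) (by linarith : x < x + d)] with t ht
    rw [Real.norm_of_nonneg (by positivity)]
    exact hL t ht x ⟨by linarith, by linarith⟩
  rw [iteratedDeriv_sub_eq_sub_eval] at hO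
  exact h.not_isBigO_of_largeOnRay hu h.pos hx hk hU hUo hg hks _ hO

/-! ### The restricted local exponent -/

theorem le_restrictedHolderExponent (h : HasRayTransform F ρ α) (u v : ℂ) (x : ℝ) :
    ((α - ρ : ℝ) : EReal) ≤ restrictedHolderExponent (rayTransform α F u v) x := by
  refine coe_le_sSup_of_forall_lt fun e he => ?_
  obtain ⟨k, s, h0, h1, h2, h3⟩ := h.exists_memDerivHolderAt u v x he
  exact ⟨k + s, h2, k, s, h0, h1, h3, rfl⟩

theorem le_restrictedHolderExponent_of_smallNear (h : HasRayTransform F ρ α) (u v : ℂ)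
    (hx : SmallNear F ρ r x) {k : ℕ} (hk : ρ + k < α) (hr : r < 2 * (α - k)) :
    ((k + min 1 (2 * (α - k) - r) : ℝ) : EReal) ≤
      restrictedHolderExponent (rayTransform α F u v) x := by
  refine coe_le_sSup_of_forall_lt fun e he => ?_
  obtain ⟨s, h0, h1, h2, h3⟩ := h.exists_memDerivHolderAt_of_smallNear u v hx hk hr (e := e - k)
    (by linarith)
  exact ⟨k + s, by linarith, k, s, h1, h2, h3, rfl⟩

/-- An upper bound for the restricted local exponent of a function not of class `C^{k+1}`. -/
theorem _root_.restrictedHolderExponent_le {g : ℝ → ℂ} {x : ℝ} {k : ℕ} {s₀ : ℝ} (hs₀ : 0 ≤ s₀)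
    (h1 : ∀ U ∈ 𝓝 x, IsOpen U → ¬ ContDiffOn ℝ (k + 1 : ℕ) g U)
    (h2 : ∀ s, s₀ < s → s ≤ 1 → ¬ MemDerivHolderAt g k s x) :
    restrictedHolderExponent g x ≤ ((k + s₀ : ℝ) : EReal) := by
  refine sSup_le ?_
  rintro _ ⟨j, s, -, hs1, hmem, rfl⟩
  rw [EReal.coe_le_coe_iff]
  by_contra! hlt
  -- Orders below k contribute at most k because s ≤ 1. Orders above k would require class C^{k+1}.
  rcases lt_trichotomy j k with hj | rfl | hj
  · have : (j : ℝ) + 1 ≤ k := by exact_mod_cast hj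
    linarith
  · exact h2 s (by linarith) hs1 hmem
  · obtain ⟨-, ⟨a, b, hab, hg⟩, -⟩ := hmem
    exact h1 _ (isOpen_Ioo.mem_nhds hab) isOpen_Ioo (hg.of_le (by exact_mod_cast hj))

theorem not_memDerivHolderAt_of_largeOnHorocycle (h : HasRayTransform F ρ α) (hu : u ≠ 0)
    (hr : 0 < r) (hx : LargeOnHorocycle F r x) {k : ℕ} (hrk : 0 ≤ 2 * (α - k) - r) {s : ℝ}
    (hs : 2 * (α - k) - r < s) : ¬ MemDerivHolderAt (rayTransform α F u v) k s x := by
  rintro ⟨-, ⟨a, b, hab, hg⟩, hO⟩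
  rw [iteratedDeriv_sub_eq_sub_eval] at hO
  exact h.not_isBigO_of_largeOnHorocycle hu hr hx hrk (isOpen_Ioo.mem_nhds hab) isOpen_Ioo hg hs
    _ hO

theorem not_memDerivHolderAt_of_largeOnRay (h : HasRayTransform F ρ α) (hu : u ≠ 0)
    (hr : 0 < r) (hx : LargeOnRay F r x) {k : ℕ} (hrk : 0 ≤ α - k - r) {s : ℝ}
    (hs : α - k - r < s) : ¬ MemDerivHolderAt (rayTransform α F u v) k s x := by
  rintro ⟨-, ⟨a, b, hab, hg⟩, hO⟩
  rw [iteratedDeriv_sub_eq_sub_eval] at hO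
  exact h.not_isBigO_of_largeOnRay hu hr hx hrk (isOpen_Ioo.mem_nhds hab) isOpen_Ioo hg hs
    _ hO

/-- The derivative of critical integral order does not exist as a continuous function. -/
theorem not_contDiffOn_of_largeOnRay_of_eq (h : HasRayTransform F r α) (hu : u ≠ 0)
    (hx : LargeOnRay F r x) {U : Set ℝ} (hU : U ∈ 𝓝 x) (hUo : IsOpen U) {k : ℕ}
    (hk : α - r = k) : ¬ ContDiffOn ℝ k (rayTransform α F u v) U := by
  intro hg
  obtain ⟨c, hc, hlow⟩ := hx
  -- At the critical order the comparison power is |t-x|⁰ = 1, so mere continuity of g^(k) at x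
  -- already gives the forbidden little-o.
  have hk0 : α - k - r = 0 := by linarith
  refine h.not_isLittleO_of_ray hu (by linarith [h.pos]) hU hUo hg h.pos hk0.ge hc hlow
    (Polynomial.C (iteratedDeriv k (rayTransform α F u v) x)) ?_
  rw [hk0, ← iteratedDeriv_sub_eq_sub_eval]
  simp only [Real.rpow_zero]
  rw [isLittleO_one_iff]
  have hc := ((continuousOn_iteratedDeriv_of_contDiffOn hUo hg le_rfl).continuousAt hU).tendsto
  simpa using hc.sub_const (iteratedDeriv k (rayTransform α F u v) x)

theorem restrictedHolderExponent_of_horocycle (h : HasRayTransform F (r / 2) α) (hu : u ≠ 0)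
    (hx : SmallNear F (r / 2) r x) (hx' : LargeOnHorocycle F r x) :
    restrictedHolderExponent (rayTransform α F u v) x =
      ((⌊α - r / 2⌋ + min 1 (2 * Int.fract (α - r / 2)) : ℝ) : EReal) := by
  have hr := h.pos
  have hlt := h.lt
  set k := ⌊α - r / 2⌋₊ with hk
  have h1 : (k : ℝ) ≤ α - r / 2 := Nat.floor_le (by linarith)
  have h2 : α - r / 2 < k + 1 := Nat.lt_floor_add_one _
  have hfl : ((⌊α - r / 2⌋ : ℤ) : ℝ) = k :=
    (natCast_floor_eq_intCast_floor (by linarith)).symm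
  have hfr : Int.fract (α - r / 2) = α - r / 2 - k := by rw [Int.fract, hfl]
  rw [hfl, hfr]
  refine le_antisymm (restrictedHolderExponent_le (le_min zero_le_one (by linarith))
    (fun U hU hUo => h.not_contDiffOn_of_largeOnHorocycle hu hx' hU hUo) fun s hs hs1 => ?_) ?_
  · rcases min_lt_iff.1 hs with hs | hs
    · linarith
    · exact h.not_memDerivHolderAt_of_largeOnHorocycle hu (by linarith) hx' (by linarith)
        (by linarith)
  -- If α-r/2 = k, the k-th derivative lies outside the range of the expansion, but the value to be
  -- reached is k itself, which the global exponent gives.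
  · rcases h1.eq_or_lt with h1 | h1
    · have := h.le_restrictedHolderExponent u v x
      rw [← h1]
      simpa [← h1] using this
    · have := h.le_restrictedHolderExponent_of_smallNear u v hx (k := k) (by linarith)
        (by linarith)
      rwa [show 2 * (α - r / 2 - k) = 2 * (α - k) - r by ring]

/-- The number of derivatives is limited by non-cuspidal points arbitrarily close to x. The Hölder
exponent of the last one is limited by the horocycle at x itself. -/
theorem restrictedHolderExponent_of_smallNear_of_largeOnRay (h : HasRayTransform F r α)
    (hu : u ≠ 0) (hx : SmallNear F r r x) (hx' : LargeOnHorocycle F r x)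
    (hnear : ∀ U ∈ 𝓝 x, ∃ x₁ ∈ U, LargeOnRay F r x₁) (hZ : ¬ ∃ n : ℤ, α - r = n) :
    restrictedHolderExponent (rayTransform α F u v) x =
      ((⌊α - r⌋ + min 1 (2 * Int.fract (α - r) + r) : ℝ) : EReal) := by
  have hr := h.pos
  have hlt := h.lt
  set k := ⌊α - r⌋₊ with hk
  have h1 : (k : ℝ) ≤ α - r := Nat.floor_le (by linarith)
  have h1 : (k : ℝ) < α - r := h1.lt_of_ne fun h => hZ ⟨k, by rw [← h]; simp⟩
  have hfl : ((⌊α - r⌋ : ℤ) : ℝ) = k :=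
    (natCast_floor_eq_intCast_floor (by linarith)).symm
  have hfr : Int.fract (α - r) = α - r - k := by rw [Int.fract, hfl]
  rw [hfl, hfr, show 2 * (α - r - k) + r = 2 * (α - k) - r by ring]
  refine le_antisymm (restrictedHolderExponent_le (le_min zero_le_one (by linarith))
    (fun U hU hUo => ?_) fun s hs hs1 => ?_) ?_
  · obtain ⟨x₁, hx₁, hl⟩ := hnear U hU
    exact h.not_contDiffOn_of_largeOnRay hu hl (hUo.mem_nhds hx₁) hUo
  · rcases min_lt_iff.1 hs with hs | hs
    · linarith
    · exact h.not_memDerivHolderAt_of_largeOnHorocycle hu hr hx' (by linarith) hs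
  · exact h.le_restrictedHolderExponent_of_smallNear u v hx (k := k) (by linarith) (by linarith)

/-- If α-r = k is an integer, nearby non-cuspidal points destroy even the continuous k-th
derivative, so cuspidality at x brings no gain over the global exponent. -/
theorem restrictedHolderExponent_of_largeOnRay (h : HasRayTransform F r α) (hu : u ≠ 0)
    (hnear : ∀ U ∈ 𝓝 x, ∃ x₁ ∈ U, LargeOnRay F r x₁)
    (hx : LargeOnRay F r x ∨ ∃ n : ℤ, α - r = n) :
    restrictedHolderExponent (rayTransform α F u v) x = ((α - r : ℝ) : EReal) := by
  have hr := h.pos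
  have hlt := h.lt
  refine le_antisymm ?_ (h.le_restrictedHolderExponent u v x)
  set k := ⌊α - r⌋₊ with hk
  have h1 : (k : ℝ) ≤ α - r := Nat.floor_le (by linarith)
  have hle : restrictedHolderExponent (rayTransform α F u v) x ≤
      ((k + (α - k - r) : ℝ) : EReal) := by
    refine restrictedHolderExponent_le (by linarith) (fun U hU hUo => ?_) fun s hs hs1 => ?_
    · obtain ⟨x₁, hx₁, hl⟩ := hnear U hU
      exact h.not_contDiffOn_of_largeOnRay hu hl (hUo.mem_nhds hx₁) hUo
    · rcases hx with hx | ⟨n, hn⟩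
      · exact h.not_memDerivHolderAt_of_largeOnRay hu hr hx (by linarith) hs
      · rintro ⟨-, ⟨a, b, hab, hg⟩, -⟩
        have hkn : α - r = k := by
          rw [hk, natCast_floor_eq_intCast_floor (by linarith), hn, Int.floor_intCast]
        obtain ⟨x₁, hx₁, hl⟩ := hnear _ (isOpen_Ioo.mem_nhds hab)
        exact h.not_contDiffOn_of_largeOnRay_of_eq hu hl (isOpen_Ioo.mem_nhds hx₁) isOpen_Ioo
          hkn hg
  rwa [show (k + (α - k - r) : ℝ) = α - r by ring] at hle

/-! ### The local exponent -/

theorem le_holderExponentOn (h : HasRayTransform F ρ α) (u v : ℂ) (Ω : Set ℝ) :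
    ((α - ρ : ℝ) : EReal) ≤ holderExponentOn (rayTransform α F u v) Ω := by
  refine coe_le_sSup_of_forall_lt fun e he => ?_
  obtain ⟨k, s, h0, h1, h2, h3⟩ := h.exists_memDerivHolderOn u v Ω he
  exact ⟨k + s, h2, k, s, h0, h1, h3, rfl⟩

/-- An upper bound for the exponent on an open set of a function not of class `C^{k+1}`. -/
theorem _root_.holderExponentOn_le {g : ℝ → ℂ} {Ω : Set ℝ} {k : ℕ} {s₀ : ℝ} (hs₀ : 0 ≤ s₀)
    (h1 : ¬ ContDiffOn ℝ (k + 1 : ℕ) g Ω)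
    (h2 : ∀ s, s₀ < s → ¬ MemDerivHolderOn g k s Ω) :
    holderExponentOn g Ω ≤ ((k + s₀ : ℝ) : EReal) := by
  refine sSup_le ?_
  rintro _ ⟨j, s, -, hs1, hmem, rfl⟩
  rw [EReal.coe_le_coe_iff]
  by_contra! hlt
  rcases lt_trichotomy j k with hj | rfl | hj
  · have : (j : ℝ) + 1 ≤ k := by exact_mod_cast hj
    linarith
  · exact h2 s (by linarith) hmem
  · exact h1 (hmem.2.1.of_le (by exact_mod_cast hj))

theorem holderExponentOn_of_largeOnHorocycle (h : HasRayTransform F (r / 2) α) (hu : u ≠ 0)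
    (hx : LargeOnHorocycle F r x) {U : Set ℝ} (hU : U ∈ 𝓝 x) (hUo : IsOpen U) :
    holderExponentOn (rayTransform α F u v) U = ((α - r / 2 : ℝ) : EReal) := by
  have hr := h.pos
  have hlt := h.lt
  refine le_antisymm ?_ (h.le_holderExponentOn u v U)
  set k := ⌊α - r / 2⌋₊ with hk
  have h1 : (k : ℝ) ≤ α - r / 2 := Nat.floor_le (by linarith)
  have hle := holderExponentOn_le (g := rayTransform α F u v) (Ω := U) (k := k)
    (s₀ := α - k - r / 2) (by linarith)
    (h.not_contDiffOn_of_largeOnHorocycle hu hx hU hUo) fun s hs =>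
    h.not_memDerivHolderOn_of_largeOnHorocycle hu hx hU hUo (by linarith) (by linarith) hs
  rwa [show (k + (α - k - r / 2) : ℝ) = α - r / 2 by ring] at hle

theorem holderExponentOn_of_largeOnRay (h : HasRayTransform F r α) (hu : u ≠ 0)
    (hx : LargeOnRay F r x) {U : Set ℝ} (hU : U ∈ 𝓝 x) (hUo : IsOpen U) :
    holderExponentOn (rayTransform α F u v) U = ((α - r : ℝ) : EReal) := by
  have hr := h.pos
  have hlt := h.lt
  refine le_antisymm ?_ (h.le_holderExponentOn u v U)
  set k := ⌊α - r⌋₊ with hk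
  have h1 : (k : ℝ) ≤ α - r := Nat.floor_le (by linarith)
  have hle := holderExponentOn_le (g := rayTransform α F u v) (Ω := U) (k := k)
    (s₀ := α - k - r) (by linarith)
    (h.not_contDiffOn_of_largeOnRay hu hx hU hUo) fun s hs =>
    h.not_memDerivHolderOn_of_largeOnRay hu hx hU hUo (by linarith) hs
  rwa [show (k + (α - k - r) : ℝ) = α - r by ring] at hle

/-- The exponent has the same value on every open neighbourhood of x, so the limit is that of a
constant sequence. -/
theorem _root_.hasLocalHolderExponent_of_forall {g : ℝ → ℂ} {x : ℝ} {e : EReal}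
    (h : ∀ U ∈ 𝓝 x, IsOpen U → holderExponentOn g U = e) : HasLocalHolderExponent g x e := by
  intro a b _ _ hab
  refine tendsto_const_nhds.congr fun n => (h _ (isOpen_Ioo.mem_nhds ?_) isOpen_Ioo).symm
  have hx : x ∈ ⋂ n, Set.Ioo (a n) (b n) := by rw [hab]; rfl
  exact Set.mem_iInter.1 hx n

/-! ### Differentiability -/

/-- The affine approximation has error o(|t-x|). Stating the obstructions with little-o rather than
big-O allows the borderline exponent 1 to be excluded too. -/
theorem _root_.isLittleO_of_differentiableAt {g : ℝ → ℂ} {x s : ℝ} (hg : DifferentiableAt ℝ g x)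
    (hs : 0 ≤ s) (hs1 : s ≤ 1) : ∃ Q : Polynomial ℂ,
    (fun t : ℝ => iteratedDeriv 0 g t - Q.eval ((t : ℂ) - x)) =o[𝓝 x] fun t => |t - x| ^ s := by
  refine ⟨Polynomial.C (g x) + Polynomial.C (deriv g x) * Polynomial.X, ?_⟩
  have h1 := hg.hasDerivAt.isLittleO
  have h2 : (fun t : ℝ => t - x) =O[𝓝 x] fun t => |t - x| ^ s := by
    have := isBigO_abs_sub_rpow (s := 1) hs hs1 x
    simp only [Real.rpow_one] at this
    exact (isBigO_abs_left.1 this)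
  refine (h1.trans_isBigO h2).congr_left fun t => ?_
  simp only [iteratedDeriv_zero, Polynomial.eval_add, Polynomial.eval_C, Polynomial.eval_mul,
    Polynomial.eval_X, Complex.real_smul]
  push_cast
  ring

theorem not_differentiableAt_of_largeOnRay (h : HasRayTransform F r α) (hu : u ≠ 0)
    (hx : LargeOnRay F r x) (h1 : α - r ≤ 1) :
    ¬ DifferentiableAt ℝ (rayTransform α F u v) x := by
  intro hd
  have hlt := h.lt
  have hα := h.alpha_pos
  obtain ⟨Q, hQ⟩ := isLittleO_of_differentiableAt hd (s := α - r) (by linarith) h1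
  obtain ⟨c, hc, hlow⟩ := hx
  refine h.not_isLittleO_of_ray hu (k := 0) (by simpa using hα) univ_mem isOpen_univ
    (contDiffOn_zero.2 (h.continuous_rayTransform u v).continuousOn) h.pos
    (by push_cast; linarith) hc hlow Q ?_
  simpa using hQ

theorem not_differentiableAt_of_largeOnHorocycle (h : HasRayTransform F ρ α) (hu : u ≠ 0)
    (hr : 0 < r) (hx : LargeOnHorocycle F r x) (h0 : r ≤ 2 * α) (h1 : 2 * α - r ≤ 1) :
    ¬ DifferentiableAt ℝ (rayTransform α F u v) x := by
  intro hd
  have hα := h.alpha_pos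
  obtain ⟨Q, hQ⟩ := isLittleO_of_differentiableAt hd (s := 2 * α - r) (by linarith) h1
  obtain ⟨c, w, hc, hw, z, hz, hlow⟩ := hx
  refine h.not_isLittleO_of_horocycle hu (k := 0) (by simpa using hα) univ_mem isOpen_univ
    (contDiffOn_zero.2 (h.continuous_rayTransform u v).continuousOn) hr
    (by push_cast; linarith) hc hw hz hlow Q ?_
  simpa using hQ

theorem hasDerivAt_of_smallNear (h : HasRayTransform F ρ α) (u v : ℂ) (hx : SmallNear F ρ r x)
    (hr : r + 1 < 2 * α) :
    IntegrableOn (fun t : ℝ => ((t ^ (α - 1) : ℝ) : ℂ) * deriv F ((x : ℂ) + Complex.I * t))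
      (Set.Ioi 0) ∧
    HasDerivAt (rayTransform α F u v) (rayTransform α (deriv F) u v x) x := by
  obtain ⟨a, hx⟩ := hx
  have hlt := h.lt
  -- The hypothesis r+1 < 2α leaves room for an expansion of order s > 1. Hence n ≥ 1, and the
  -- linear coefficient, the ray integral of F', is the derivative.
  obtain ⟨s, n, h1, h2, h3, h4⟩ := exists_not_nat_between
    (zero_le_one.trans (le_max_left 1 (α - r + ρ))) (max_lt (by linarith) (by linarith) :
      _ < 2 * α - r)
  rw [max_lt_iff] at h1
  obtain ⟨C, hC⟩ := hx (s - α + r) (by linarith)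
  have hs : α - (0 : ℕ) + (2 * (s - α + r) - r) - (s - α + r) = s := by push_cast; ring
  obtain ⟨hint, K, hK⟩ := h.exists_taylor_bound u v hC (k := 0) (n := n) (by simpa using hlt)
    (by push_cast; linarith) (by rwa [hs]) (by rwa [hs])
  rw [hs] at hK
  simp only [iteratedDeriv_zero] at hK hint
  have hn1 : 1 ≤ n := by
    by_contra hn
    have : n = 0 := by omega
    rw [this] at h4
    push_cast at h4
    linarith
  refine ⟨by simpa using hint 1 hn1, ?_⟩
  set P : ℝ → ℂ := fun t => ∑ j ∈ Finset.range (n + 1), (((t - x) ^ j / j.factorial : ℝ) : ℂ) *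
    rayTransform α (iteratedDeriv j F) u v x with hP
  have hPd : HasDerivAt P (rayTransform α (deriv F) u v x) x := by
    have hterm : ∀ j ∈ Finset.range (n + 1), HasDerivAt
        (fun t : ℝ => (((t - x) ^ j / j.factorial : ℝ) : ℂ) *
          rayTransform α (iteratedDeriv j F) u v x)
        (if j = 1 then rayTransform α (deriv F) u v x else 0) x := by
      intro j _
      have e1 : HasDerivAt (fun t : ℝ => (t - x) ^ j / (j.factorial : ℝ))
          (j * (x - x) ^ (j - 1) * 1 / (j.factorial : ℝ)) x :=
        (((hasDerivAt_id x).sub_const x).pow j).div_const _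
      have e2 := e1.ofReal_comp.mul_const (rayTransform α (iteratedDeriv j F) u v x)
      refine e2.congr_deriv ?_
      rcases j with _ | _ | j
      · simp
      · simp
      · simp
    have := HasDerivAt.fun_sum hterm
    rw [Finset.sum_ite_eq' _ 1, if_pos (Finset.mem_range.2 (by omega))] at this
    exact this
  have hdiff : HasDerivAt (fun t => rayTransform α F u v t - P t) 0 x := by
    have hx0 : rayTransform α F u v x - P x = 0 := by
      have := hK 0
      rw [abs_zero, Real.zero_rpow (by linarith), mul_zero, add_zero] at this
      have h5 := norm_le_zero_iff.1 this
      simpa [hP] using h5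
    rw [hasDerivAt_iff_isLittleO]
    simp only [hx0, sub_zero, smul_zero]
    have hO : (fun t => rayTransform α F u v t - P t) =O[𝓝 x] fun t => |t - x| ^ s := by
      refine IsBigO.of_bound K (Eventually.of_forall fun t => ?_)
      have := hK (t - x)
      rw [add_sub_cancel] at this
      rwa [Real.norm_of_nonneg (by positivity)]
    have := hO.trans_isLittleO (isLittleO_abs_sub_rpow zero_le_one h1.1 x)
    simp only [Real.rpow_one] at this
    exact isLittleO_abs_right.1 this
  have := hdiff.add hPd
  rw [zero_add] at this
  refine this.congr_of_eventuallyEq (Eventually.of_forall fun t => ?_)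
  simp

end HasRayTransform

/-! ### Fractional integrals of modular forms as ray integrals -/

theorem I_mul_ofReal_cpow {t : ℝ} (ht : 0 < t) (β : ℝ) :
    (Complex.I * t) ^ (β : ℂ) = Complex.I ^ (β : ℂ) * ((t ^ β : ℝ) : ℂ) := by
  have ht' : (t : ℂ) ≠ 0 := by exact_mod_cast ht.ne'
  rw [Complex.ofReal_cpow ht.le, Complex.cpow_def_of_ne_zero (mul_ne_zero Complex.I_ne_zero ht'),
    Complex.cpow_def_of_ne_zero Complex.I_ne_zero, Complex.cpow_def_of_ne_zero ht',
    Complex.log_mul_ofReal t ht _ Complex.I_ne_zero, Complex.ofReal_log ht.le, ← Complex.exp_add]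
  congr 1
  ring

/-- The constant relating fractional integrals and ray integrals. -/
noncomputable def rayConst (Γ : Subgroup SL(2, ℤ)) (α : ℝ) : ℝ :=
  (2 * Real.pi) ^ α / ((cuspWidth Γ OnePoint.infty : ℝ) ^ α * Real.Gamma α)

section

variable {f : UpperHalfPlane → ℂ} {r : ℝ} {Γ : Subgroup SL(2, ℤ)} {μ : Γ → ℂ} {α : ℝ}

theorem rayConst_pos (hΓ : Γ.FiniteIndex) (hα : 0 < α) : 0 < rayConst Γ α := by
  have hm0 : (0 : ℝ) < (cuspWidth Γ OnePoint.infty : ℝ) := Nat.cast_pos.2 (cuspWidth_pos hΓ _)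
  have := Real.pi_pos
  have := Real.Gamma_pos_of_pos hα
  rw [rayConst]
  positivity

theorem IsModularFormOfWeight.hasRayTransform (hf : IsModularFormOfWeight f r Γ μ) (hr : 0 < r)
    (hΓ : Γ.FiniteIndex) (hf0 : f ≠ 0) (hα : alphaZero f r Γ < α) :
    HasRayTransform (reducedForm f r Γ) (alphaZero f r Γ) α :=
  ⟨hf.differentiableOn_reducedForm, hf.verticalDecay_reducedForm hr hΓ hf0, alphaZero_pos hr, hα,
    _, _, hf.hasExpSeries_reducedForm hΓ hf0⟩

theorem IsModularFormOfWeight.tendsto_fracIntegralPartialSum (hf : IsModularFormOfWeight f r Γ μ)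
    (hr : 0 < r) (hΓ : Γ.FiniteIndex) (hf0 : f ≠ 0) (hα : alphaZero f r Γ < α) (y : ℝ) :
    Tendsto (fun N : ℕ => fracIntegralPartialSum f r Γ α N y) atTop
      (𝓝 (rayConst Γ α * rayIntegral α (reducedForm f r Γ) y)) := by
  have h := hf.hasRayTransform hr hΓ hf0 hα
  have hα0 := h.alpha_pos
  have hm0 : (0 : ℝ) < (cuspWidth Γ OnePoint.infty : ℝ) := Nat.cast_pos.2 (cuspWidth_pos hΓ _)
  have hs := (HasExpSeries.tendsto_sum_rayCoeff hm0 (hf.hasExpSeries_reducedForm hΓ hf0) h.holo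
    h.decay h.pos.le h.lt y).const_mul (rayConst Γ α : ℂ)
  refine hs.congr fun N => ?_
  rw [fracIntegralPartialSum, Finset.mul_sum]
  refine Finset.sum_congr rfl fun n _ => ?_
  rw [rayCoeff, reducedCoeff]
  split_ifs with hn
  · have hpi := Real.pi_pos
    have hG := Real.Gamma_pos_of_pos hα0
    have e1 : rayConst Γ α * (Real.Gamma α *
        (2 * Real.pi * (n + cuspParameter f r Γ 1) / (cuspWidth Γ OnePoint.infty : ℝ)) ^ (-α)) =
        1 / ((n : ℝ) + cuspParameter f r Γ 1) ^ α := by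
      rw [rayConst, Real.rpow_neg (by positivity), Real.div_rpow (by positivity) hm0.le,
        Real.mul_rpow (by positivity) hn.le]
      have h1 := Real.rpow_pos_of_pos hm0 α
      have h2 := Real.rpow_pos_of_pos hn α
      have h3 := Real.rpow_pos_of_pos (by positivity : 0 < 2 * Real.pi) α
      field_simp
    have e2 : Complex.exp (Complex.I * ((2 * Real.pi * (n + cuspParameter f r Γ 1) /
        (cuspWidth Γ OnePoint.infty : ℝ) : ℝ) : ℂ) * y) =
        Complex.exp (2 * Real.pi * Complex.I * (n + cuspParameter f r Γ 1) *
          ((y : ℂ) / (cuspWidth Γ OnePoint.infty : ℂ))) := by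
      congr 1
      push_cast
      ring
    rw [e2, ← mul_assoc, ← mul_assoc, ← Complex.ofReal_mul, e1]
    push_cast
    ring
  · simp

theorem IsModularFormOfWeight.fracIntegral_eq (hf : IsModularFormOfWeight f r Γ μ)
    (hr : 0 < r) (hΓ : Γ.FiniteIndex) (hf0 : f ≠ 0) (hα : alphaZero f r Γ < α) (y : ℝ) :
    fracIntegral f r Γ α y = rayConst Γ α * rayIntegral α (reducedForm f r Γ) y :=
  (hf.tendsto_fracIntegralPartialSum hr hΓ hf0 hα y).limUnder_eq

theorem rayIntegrand_eq (x : ℝ) {t : ℝ} (ht : 0 < t) :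
    rayIntegrand f α x t = Complex.I ^ (α : ℂ) * (((t ^ (α - 1) : ℝ) : ℂ) *
      deriv (reducedForm f r Γ) ((x : ℂ) + Complex.I * t)) := by
  have h1 : Complex.I ^ ((α - 1 : ℝ) : ℂ) * Complex.I = Complex.I ^ (α : ℂ) := by
    rw [Complex.ofReal_sub, Complex.ofReal_one, Complex.cpow_sub _ _ Complex.I_ne_zero,
      Complex.cpow_one, div_mul_cancel₀ _ Complex.I_ne_zero]
  rw [rayIntegrand, I_mul_ofReal_cpow ht, deriv_reducedForm, ← h1]
  ring

/-- The parametrization z = x+it yields i^α, which cancels against (im)^α since m > 0, leaving a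
real positive constant. -/
theorem rayDerivative_eq (hΓ : Γ.FiniteIndex) (x : ℝ) :
    rayDerivative f Γ α x = rayConst Γ α * rayIntegral α (deriv (reducedForm f r Γ)) x := by
  have hm0 : (0 : ℝ) < (cuspWidth Γ OnePoint.infty : ℝ) := Nat.cast_pos.2 (cuspWidth_pos hΓ _)
  have hI : Complex.I ^ (α : ℂ) ≠ 0 := by
    rw [Ne, Complex.cpow_eq_zero_iff]
    exact fun h => Complex.I_ne_zero h.1
  have h1 : ∫ t in Set.Ioi (0 : ℝ), rayIntegrand f α x t =
      Complex.I ^ (α : ℂ) * rayIntegral α (deriv (reducedForm f r Γ)) x := by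
    rw [rayIntegral, ← integral_const_mul]
    exact setIntegral_congr_fun measurableSet_Ioi fun t ht => rayIntegrand_eq x ht
  have h2 := I_mul_ofReal_cpow hm0 α
  rw [Complex.ofReal_natCast] at h2
  rw [rayDerivative, h1, h2, rayConst]
  push_cast
  field_simp

theorem integrableOn_rayIntegrand {x : ℝ}
    (h : IntegrableOn (fun t : ℝ => ((t ^ (α - 1) : ℝ) : ℂ) *
      deriv (reducedForm f r Γ) ((x : ℂ) + Complex.I * t)) (Set.Ioi 0)) :
    IntegrableOn (rayIntegrand f α x) (Set.Ioi 0) :=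
  IntegrableOn.congr_fun (h.const_mul (Complex.I ^ (α : ℂ)))
    (fun _ ht => (rayIntegrand_eq x ht).symm) measurableSet_Ioi

/-- The identity, the real part and the imaginary part are of the form `w ↦ u w + v w̄`. -/
theorem exists_eq_conjComb {p : ℂ → ℂ}
    (hp : p ∈ ({id, fun w => (w.re : ℂ), fun w => (w.im : ℂ)} : Set (ℂ → ℂ))) :
    ∃ u v : ℂ, u ≠ 0 ∧ ∀ w, p w = conjComb u v w := by
  simp only [Set.mem_insert_iff, Set.mem_singleton_iff] at hp
  rcases hp with rfl | rfl | rfl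
  · exact ⟨1, 0, one_ne_zero, fun w => by simp [conjComb_apply]⟩
  · refine ⟨1 / 2, 1 / 2, by norm_num, fun w => ?_⟩
    simp only [conjComb_apply]
    rw [Complex.re_eq_add_conj]; ring
  · refine ⟨1 / (2 * Complex.I), -(1 / (2 * Complex.I)), by simp, fun w => ?_⟩
    simp only [conjComb_apply]
    rw [Complex.im_eq_sub_conj]; ring

theorem conjComb_ofReal_mul (u v w : ℂ) (c : ℝ) :
    conjComb u v (c * w) = conjComb (u * c) (v * c) w := by
  rw [conjComb_apply, conjComb_apply, map_mul, Complex.conj_ofReal]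
  ring

end

/-! ### The regularity of fractional integrals -/

theorem theorem2p2 (f : UpperHalfPlane → ℂ) (r : ℝ) (hr : 0 < r)
    (Γ : Subgroup SL(2, ℤ)) (hΓ : Γ.FiniteIndex) (μ : Γ → ℂ)
    (hf : IsModularFormOfWeight f r Γ μ) (hf0 : f ≠ 0)
    (hκ : ∀ γ : SL(2, ℤ), ∃ q : ℚ, cuspParameter f r Γ γ = (q : ℝ))
    (α : ℝ) (hα : alphaZero f r Γ < α) :
    -- the series defining `f_α` converges on the real line
    (∀ y : ℝ, Tendsto (fun N : ℕ => fracIntegralPartialSum f r Γ α N y) atTop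
      (𝓝 (fracIntegral f r Γ α y))) ∧
    -- `p ∘ f_α` is `f_α`, `Re f_α` or `Im f_α`
    ∀ p ∈ ({id, fun w => (w.re : ℂ), fun w => (w.im : ℂ)} : Set (ℂ → ℂ)), ∀ x : ℚ,
      -- the exponent `β`
      ((IsCuspidalAt f r Γ (x : OnePoint ℚ) →
          pointwiseHolderExponent (p ∘ fracIntegral f r Γ α) x = ((2 * α - r : ℝ) : EReal)) ∧
        (¬ IsCuspidalAt f r Γ (x : OnePoint ℚ) →
          pointwiseHolderExponent (p ∘ fracIntegral f r Γ α) x = ((α - r : ℝ) : EReal))) ∧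
      -- the exponent `β*`
      ((IsCuspFormOn f r Γ →
          restrictedHolderExponent (p ∘ fracIntegral f r Γ α) x =
            ((⌊α - r / 2⌋ + min 1 (2 * Int.fract (α - r / 2)) : ℝ) : EReal)) ∧
        (¬ IsCuspFormOn f r Γ → IsCuspidalAt f r Γ (x : OnePoint ℚ) →
          (¬ ∃ n : ℤ, α - r = n) →
          restrictedHolderExponent (p ∘ fracIntegral f r Γ α) x =
            ((⌊α - r⌋ + min 1 (2 * Int.fract (α - r) + r) : ℝ) : EReal)) ∧
        (¬ IsCuspFormOn f r Γ →
          (¬ IsCuspidalAt f r Γ (x : OnePoint ℚ) ∨ ∃ n : ℤ, α - r = n) →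
          restrictedHolderExponent (p ∘ fracIntegral f r Γ α) x = ((α - r : ℝ) : EReal))) ∧
      -- the exponent `β**`
      HasLocalHolderExponent (p ∘ fracIntegral f r Γ α) x ((α - alphaZero f r Γ : ℝ) : EReal) ∧
      -- differentiability
      (α - alphaZero f r Γ ≤ 1 → ¬ IsCuspidalAt f r Γ (x : OnePoint ℚ) →
        ¬ DifferentiableAt ℝ (p ∘ fracIntegral f r Γ α) x) ∧
      (IsCuspidalAt f r Γ (x : OnePoint ℚ) →
        (DifferentiableAt ℝ (p ∘ fracIntegral f r Γ α) x ↔ (r + 1) / 2 < α) ∧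
        ((r + 1) / 2 < α →
          MeasureTheory.IntegrableOn (rayIntegrand f α x) (Set.Ioi 0) ∧
          HasDerivAt (p ∘ fracIntegral f r Γ α) (p (rayDerivative f Γ α x)) x)) := by
  have h := hf.hasRayTransform hr hΓ hf0 hα
  have hC := rayConst_pos hΓ h.alpha_pos
  refine ⟨fun y => ?_, fun p hp x => ?_⟩
  · rw [hf.fracIntegral_eq hr hΓ hf0 hα]
    exact hf.tendsto_fracIntegralPartialSum hr hΓ hf0 hα y
  obtain ⟨u, v, hu, hpuv⟩ := exists_eq_conjComb hp
  have hu' : u * (rayConst Γ α : ℂ) ≠ 0 := mul_ne_zero hu (by exact_mod_cast hC.ne')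
  -- The positive real constant is absorbed into u and v. It commutes with conjugation and keeps the
  -- first coefficient nonzero.
  have hg : p ∘ fracIntegral f r Γ α = rayTransform α (reducedForm f r Γ)
      (u * (rayConst Γ α : ℂ)) (v * (rayConst Γ α : ℂ)) := by
    ext y
    rw [Function.comp_apply, hpuv, hf.fracIntegral_eq hr hΓ hf0 hα, conjComb_ofReal_mul,
      rayTransform]
  have hder : p (rayDerivative f Γ α x) = rayTransform α (deriv (reducedForm f r Γ))
      (u * (rayConst Γ α : ℂ)) (v * (rayConst Γ α : ℂ)) x := by
    rw [hpuv, rayDerivative_eq (r := r) hΓ, conjComb_ofReal_mul, rayTransform]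
  rw [hg, hder]
  have hhalf := half_le_alphaZero (f := f) (Γ := Γ) hr
  have hsmall : IsCuspidalAt f r Γ (x : OnePoint ℚ) →
      SmallNear (reducedForm f r Γ) (alphaZero f r Γ) r x := fun hx =>
    ⟨cuspConst f r Γ, fun _ hM => hf.exists_norm_le_of_isCuspidalAt hr hΓ hf0 hx hM⟩
  have hhoro : LargeOnHorocycle (reducedForm f r Γ) r x := hf.exists_horocycle hr hΓ hf0 x
  have hray : ¬ IsCuspidalAt f r Γ (x : OnePoint ℚ) → LargeOnRay (reducedForm f r Γ) r x :=
    fun hx => hf.exists_le_norm_ray_of_not_isCuspidalAt hr hΓ hf0 hx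
  have hnear : ¬ IsCuspFormOn f r Γ → ∀ U ∈ 𝓝 (x : ℝ), ∃ x₁ ∈ U,
      LargeOnRay (reducedForm f r Γ) r x₁ := fun hx U hU =>
    hf.exists_le_norm_ray_of_not_isCuspForm hr hΓ hf0 hx x hU
  have hncf : ¬ IsCuspidalAt f r Γ (x : OnePoint ℚ) → ¬ IsCuspFormOn f r Γ :=
    fun hx hcf => hx (hcf _)
  have hcusp : IsCuspFormOn f r Γ → HasRayTransform (reducedForm f r Γ) (r / 2) α := fun hcf =>
    alphaZero_of_isCuspForm hcf ▸ h
  have hncusp : ¬ IsCuspFormOn f r Γ → HasRayTransform (reducedForm f r Γ) r α := fun hcf => by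
    rwa [alphaZero_of_not_isCuspForm hcf] at h
  refine ⟨⟨fun hx => ?_, fun hx => ?_⟩, ⟨fun hcf => ?_, fun hcf hx hZ => ?_, fun hcf hx => ?_⟩,
    ?_, fun h1 hx => ?_, fun hx => ⟨⟨fun hd => ?_, fun h1 => ?_⟩, fun h1 => ?_⟩⟩
  · exact h.pointwiseHolderExponent_of_smallNear hu' hr hhalf (hsmall hx) hhoro
  · exact (hncusp (hncf hx)).pointwiseHolderExponent_of_largeOnRay hu' (hray hx)
  · exact (hcusp hcf).restrictedHolderExponent_of_horocycle hu'
      (alphaZero_of_isCuspForm hcf ▸ hsmall (hcf _)) hhoro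
  · have hs := hsmall hx
    rw [alphaZero_of_not_isCuspForm hcf] at hs
    exact (hncusp hcf).restrictedHolderExponent_of_smallNear_of_largeOnRay hu' hs hhoro
      (hnear hcf) hZ
  · exact (hncusp hcf).restrictedHolderExponent_of_largeOnRay hu' (hnear hcf) (hx.imp_left hray)
  · refine hasLocalHolderExponent_of_forall fun U hU hUo => ?_
    by_cases hcf : IsCuspFormOn f r Γ
    · rw [alphaZero_of_isCuspForm hcf]
      exact (hcusp hcf).holderExponentOn_of_largeOnHorocycle hu' hhoro hU hUo
    · rw [alphaZero_of_not_isCuspForm hcf]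
      obtain ⟨x₁, hx₁, hl⟩ := hnear hcf U hU
      exact (hncusp hcf).holderExponentOn_of_largeOnRay hu' hl (hUo.mem_nhds hx₁) hUo
  · rw [alphaZero_of_not_isCuspForm (hncf hx)] at h1
    exact (hncusp (hncf hx)).not_differentiableAt_of_largeOnRay hu' (hray hx) h1
  · by_contra! hle
    exact h.not_differentiableAt_of_largeOnHorocycle hu' hr hhoro (by linarith) (by linarith) hd
  · exact (h.hasDerivAt_of_smallNear _ _ (hsmall hx) (by linarith)).2.differentiableAt
  · obtain ⟨h2, h3⟩ := h.hasDerivAt_of_smallNear (u * (rayConst Γ α : ℂ))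
      (v * (rayConst Γ α : ℂ)) (hsmall hx) (by linarith)
    exact ⟨integrableOn_rayIntegrand h2, h3⟩
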